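/- Let $\sigma=\{R_1^{r_1},\dots,R_p^{r_p},c_1,\dots,c_q,f_1^{k_1},\dots,f_s^{k_s}\}$ be a finite vocabulary of relation, constant and function symbols that contains at least one relation or function symbol of positive arity. A finite ordered $\sigma$-structure $\mathbf A$ has domain $A=\{0,\dots,n-1\}$, $n\ge 1$, with its natural order. Its binary encoding $\mathrm{bin}(\mathbf A)$ is the concatenation of the encodings of its relations ($n^{r_i}$ bits, one for each tuple in lexicographic order), its constants ($\lceil\log_2 n\rceil$ bits each, the value in binary) and its functions ($\lceil\log_2 n\rceil\, n^{k_i}$ bits: for each of the $\lceil\log_2 n\rceil$ bit positions of the value, the $k_i$-ary relation telling for which tuples that bit is $1$); let $\hat n=|\mathrm{bin}(\mathbf A)|$. All machines are deterministic with a finite state set, alphabet $\{0,1,\sqcup\}$, a partial transition function (the computation stops where it is undefined), and tapes with a leftmost cell; an input is accepted if an accepting state is reached. The number on an address-tape is the one written in binary between its leftmost cell and its first blank cell ($0$ if the leftmost cell is blank). A random-access machine has a read-only input-tape, one read-write address-tape (initially holding $0$) and at least one work-tape (initially blank). If $i$ is the number on the address-tape, the machine reads cell $i+1$ of the input, or an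 end-marker if $i$ is at least the input length. It is given $\mathrm{bin}(\mathbf A)$ as input. A direct-access machine for $\sigma$ has, for each relation symbol $R_i$, $r_i$ address-tapes; for each function symbol $f_i$, $k_i$ address-tapes and one read-only value-tape; a read-only constant-tape for each constant symbol, holding its value in binary; one more read-only tape holding $n$ in binary; and at least one work-tape. Address-, value- and work-tapes are initially blank. Each transition depends on the state, on all scanned symbols and, for each $R_i$, on whether the tuple of numbers on the address-tapes of $R_i$ belongs to $R_i^{\mathbf A}$; it gives the new state, a symbol to write and a head move for each address- and work-tape, and a head move for each read-only tape. After each transition the value-tape of each $f_i$ is overwritten with the value of $f_i^{\mathbf A}$, in binary, at the numbers now on its address-tapes, or with blanks if one of these numbers is not less than $n$. **Theorem.** For every class $\mathcal C$ of finite ordered $\sigma$-structures the following are equivalent. 1. $\mathcal C$ is decided by a random-access machine in time polylogarithmic in $\hat n$: there are a random-access machine, a function $T:\mathbb N\to\mathbb N$ and $k\in\mathbb N$ with $T(m)=O(\lceil\log_2 m\rceil^k)$ such that, for every $\mathbf A$, on input $\mathrm{bin}(\mathbf A)$ the machine accepts or stops within $T(\hat n)$ steps, and it accepts iff $\mathbf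 A\in\mathcal C$. 2. $\mathcal C$ is decided by a direct-access machine for $\sigma$ in time polylogarithmic in $n$: there are a direct-access machine for $\sigma$, a function $T:\mathbb N\to\mathbb N$ and $k\in\mathbb N$ with $T(m)=O(\lceil\log_2 m\rceil^k)$ such that, for every $\mathbf A$, on input $\mathbf A$ the machine accepts or stops within $T(n)$ steps, and it accepts iff $\mathbf A\in\mathcal C$. -/

import Mathlib

namespace PolylogTM

/-! ## Vocabularies, finite ordered structures, and their binary encoding -/

/-- A finite vocabulary, listed as `R_1, …, R_p, c_1, …, c_q, f_1, …, f_s`, with the arities of the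
relation and of the function symbols. The order symbol is not listed. -/
structure Vocabulary where
  /-- the number of relation symbols -/
  p : ℕ
  /-- the number of constant symbols -/
  q : ℕ
  /-- the number of function symbols -/
  s : ℕ
  /-- the arities of the relation symbols -/
  relArity : Fin p → ℕ
  /-- the arities of the function symbols -/
  funArity : Fin s → ℕ

/-- A finite ordered structure over the vocabulary `σ`. Its domain is `{0, …, n - 1}`, that is
`Fin n`, with `n ≥ 1`, linearly ordered by the natural order of `Fin n`. -/
structure OrderedStructure (σ : Vocabulary) where
  /-- the cardinality of the domain -/
  n : ℕ
  n_pos : 0 < n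
  /-- the interpretations of the relation symbols -/
  rel : (i : Fin σ.p) → Set (Fin (σ.relArity i) → Fin n)
  /-- the interpretations of the constant symbols -/
  const : Fin σ.q → Fin n
  /-- the interpretations of the function symbols -/
  fn : (i : Fin σ.s) → (Fin (σ.funArity i) → Fin n) → Fin n

/-- The `w` low order bits of `v`, most significant bit first. -/
def toBin (w v : ℕ) : List Bool :=
  (List.range w).map fun i => v.testBit (w - 1 - i)

/-- All `k`-tuples over `{0, …, n - 1}` in lexicographic order. -/
def tuples (n : ℕ) : (k : ℕ) → List (Fin k → Fin n)
  | 0 => [Fin.elim0]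
  | k + 1 => (List.finRange n).flatMap fun a => (tuples n k).map (Fin.cons a)

namespace OrderedStructure

variable {σ : Vocabulary} (A : OrderedStructure σ)

/-- `⌈log₂ n⌉`, where `n` is the size of the domain. -/
def width : ℕ := Nat.clog 2 A.n

open Classical in
/-- The encoding of a relation: one bit for every tuple, of length `n ^ r`. -/
noncomputable def binRel (i : Fin σ.p) : List Bool :=
  (tuples A.n (σ.relArity i)).map fun a => decide (a ∈ A.rel i)

/-- The encoding of a constant: its value in binary, of length `⌈log n⌉`. -/
def binConst (i : Fin σ.q) : List Bool := toBin A.width (A.const i)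

/-- The encoding of a function: for each of the `⌈log n⌉` bits of its value (most significant bit
first), the relation that says for which tuples that bit is `1`. Its length is
`⌈log n⌉ * n ^ k`. -/
def binFun (i : Fin σ.s) : List Bool :=
  (List.range A.width).flatMap fun m =>
    (tuples A.n (σ.funArity i)).map fun a => (A.fn i a : ℕ).testBit (A.width - 1 - m)

/-- The binary encoding of the whole structure: relations, then constants, then functions. -/
noncomputable def bin : List Bool :=
  (List.finRange σ.p).flatMap A.binRel ++
    ((List.finRange σ.q).flatMap A.binConst ++ (List.finRange σ.s).flatMap A.binFun)

open Classical in
/-- The answer to the query whether a tuple of numbers belongs to the `i`-th relation. It is `false`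
when a component lies outside of the domain. -/
noncomputable def relQuery (i : Fin σ.p) (a : Fin (σ.relArity i) → ℕ) : Bool :=
  if h : ∀ j, a j < A.n then decide ((fun j => (⟨a j, h j⟩ : Fin A.n)) ∈ A.rel i) else false

/-- The value of the `i`-th function in binary, of length `⌈log n⌉`, at a tuple of numbers; the
empty string when a component lies outside of the domain. -/
def funQuery (i : Fin σ.s) (a : Fin (σ.funArity i) → ℕ) : List Bool :=
  if h : ∀ j, a j < A.n then toBin A.width (A.fn i fun j => ⟨a j, h j⟩) else []

end OrderedStructure

/-! ## Tapes -/

/-- The alphabet `Σ = {0, 1, ⊔}`. -/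
inductive Sym
  | zero
  | one
  | blank
  deriving DecidableEq

/-- The directions in which a head moves. -/
inductive Dir
  | left
  | right
  | stay
  deriving DecidableEq

/-- A bit as a symbol of the alphabet. -/
def Sym.ofBool : Bool → Sym
  | false => Sym.zero
  | true => Sym.one

/-- A tape with a leftmost cell (cell `0`) and no rightmost cell, with the position of its head. -/
structure Tape where
  cells : ℕ → Sym
  head : ℕ

namespace Tape

/-- The cell contents of a tape that holds the given binary string and blanks after it. -/
def contents (l : List Bool) : ℕ → Sym :=
  fun i => (l[i]?).elim Sym.blank Sym.ofBool

/-- A tape that holds the given binary string, with the head on the leftmost cell. -/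
def init (l : List Bool) : Tape := ⟨contents l, 0⟩

/-- The scanned symbol. -/
def read (t : Tape) : Sym := t.cells t.head

/-- Write a symbol in the scanned cell. -/
def write (t : Tape) (a : Sym) : Tape := ⟨Function.update t.cells t.head a, t.head⟩

/-- Move the head. A head on the leftmost cell does not move left: it stays there. -/
def move (t : Tape) : Dir → Tape
  | Dir.left => ⟨t.cells, t.head - 1⟩
  | Dir.right => ⟨t.cells, t.head + 1⟩
  | Dir.stay => t

/-- The position of the first blank cell. (Every tape of a computation has one.) -/
noncomputable def firstBlank (t : Tape) : ℕ := sInf {i | t.cells i = Sym.blank}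

/-- The number stored in binary, most significant bit first, between the leftmost cell and the first
blank cell; it is `0` if the leftmost cell is blank. -/
noncomputable def number (t : Tape) : ℕ :=
  ((List.range t.firstBlank).map t.cells).foldl
    (fun v a => 2 * v + if a = Sym.one then 1 else 0) 0

end Tape

/-! ## Computations -/

section Computation

variable {Γ : Type} (step : Γ → Option Γ) (c₀ : Γ) (acc : Set Γ)

/-- The configuration reached after exactly `t` steps from `c₀`, if the computation lasts that
long; `step c = none` means that the computation stops in `c`. -/
def configAt : ℕ → Option Γ
  | 0 => some c₀
  | t + 1 => (configAt t).bind step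

/-- An accepting configuration is reached. -/
def ReachesAccepting : Prop := ∃ t, ∃ c ∈ configAt step c₀ t, c ∈ acc

/-- Within `T` steps the computation reaches an accepting configuration, or stops. -/
def FinishesWithin (T : ℕ) : Prop :=
  ∃ t ≤ T, ∃ c ∈ configAt step c₀ t, c ∈ acc ∨ step c = none

end Computation

/-- `T(n) = O(⌈log n⌉ ^ k)` for some `k`. -/
def IsPolylog (T : ℕ → ℕ) : Prop :=
  ∃ k : ℕ, (fun n => (T n : ℝ)) =O[Filter.atTop] fun n => ((Nat.clog 2 n : ℕ) : ℝ) ^ k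

/-! ## Random-access Turing machines -/

/-- A (deterministic) random-access Turing machine with `k ≥ 1` work-tapes. Tape `0` is the
address-tape, tapes `1, …, k` are the work-tapes. The transition function is partial: where it is
undefined (`none`), the computation stops. In its second argument, `none` is the end-marker of the
input-tape. -/
structure RandomAccessTM where
  Q : Type
  [finite_Q : Finite Q]
  k : ℕ
  k_pos : 0 < k
  start : Q
  accept : Set Q
  δ : Q → Option Sym → (Fin (k + 1) → Sym) → Option (Q × (Fin (k + 1) → Sym × Dir))

namespace RandomAccessTM

variable (M : RandomAccessTM)

/-- Configurations: the state, and the address-tape and the work-tapes. -/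
structure Config where
  state : M.Q
  tapes : Fin (M.k + 1) → Tape

/-- Initially the address-tape holds a `0` and the work-tapes are blank. -/
def initial : M.Config where
  state := M.start
  tapes := fun l => if l = 0 then Tape.init [false] else Tape.init []

/-- One step on the input string `w`: the input head scans the cell whose number is on the
address-tape, or the end-marker if that number is not less than the length of `w`. -/
noncomputable def step (w : List Bool) (c : M.Config) : Option M.Config :=
  (M.δ c.state (w[(c.tapes 0).number]?.map Sym.ofBool) fun l => (c.tapes l).read).map
    fun r => ⟨r.1, fun l => ((c.tapes l).write (r.2 l).1).move (r.2 l).2⟩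

/-- The accepting configurations. -/
def accepting : Set M.Config := {c | c.state ∈ M.accept}

/-- `M` decides the class `C` of structures, given by their binary encodings, in time `T` with
respect to the length of the encoding. -/
def DecidesInTime {σ : Vocabulary} (C : Set (OrderedStructure σ)) (T : ℕ → ℕ) : Prop :=
  ∀ A : OrderedStructure σ,
    (A ∈ C ↔ ReachesAccepting (M.step A.bin) M.initial M.accepting) ∧
      FinishesWithin (M.step A.bin) M.initial M.accepting (T A.bin.length)

end RandomAccessTM

/-! ## Direct-access Turing machines -/

/-- The tapes of a direct-access machine with `k` work-tapes on which it writes: the address-tapes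
of the relations and of the functions, and the work-tapes. -/
inductive WritableTape (σ : Vocabulary) (k : ℕ)
  | relAddr (i : Fin σ.p) (j : Fin (σ.relArity i))
  | funAddr (i : Fin σ.s) (j : Fin (σ.funArity i))
  | work (i : Fin k)

/-- The read-only tapes of a direct-access machine: the value-tapes of the functions, the
constant-tapes of the constant symbols, and the constant-tape for the size of the domain. -/
inductive ReadOnlyTape (σ : Vocabulary)
  | value (i : Fin σ.s)
  | const (i : Fin σ.q)
  | size

/-- A (deterministic) direct-access Turing machine that takes `σ`-structures as an input, with
`k ≥ 1` work-tapes. The transition depends on the state, on the symbols scanned on all tapes, and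
on the answers to the current queries to the relations. It gives the new state, a symbol and a move
for every writable tape, and a move for every read-only tape. Where it is undefined (`none`), the
computation stops. -/
structure DirectAccessTM (σ : Vocabulary) where
  Q : Type
  [finite_Q : Finite Q]
  k : ℕ
  k_pos : 0 < k
  start : Q
  accept : Set Q
  δ : Q → (WritableTape σ k → Sym) → (ReadOnlyTape σ → Sym) → (Fin σ.p → Bool) →
    Option (Q × (WritableTape σ k → Sym × Dir) × (ReadOnlyTape σ → Dir))

namespace DirectAccessTM

variable {σ : Vocabulary} (M : DirectAccessTM σ)

/-- Configurations: the state and all tapes. -/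
structure Config where
  state : M.Q
  wr : WritableTape σ M.k → Tape
  ro : ReadOnlyTape σ → Tape

/-- Initially the constant-tapes hold the values of the constants (in binary, of length `⌈log n⌉`)
and the size of the domain (in binary, without leading zeros); all other tapes are blank. -/
def initial (A : OrderedStructure σ) : M.Config where
  state := M.start
  wr := fun _ => Tape.init []
  ro := fun
    | .value _ => Tape.init []
    | .const i => Tape.init (A.binConst i)
    | .size => Tape.init (toBin A.n.size A.n)

/-- The cell contents of the read-only tape `l` after a step, where `wr` are the writable tapes
after the step and `old` is the previous content of `l`: a value-tape is updated to the value of its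
function at the numbers on the address-tapes, every other tape is unchanged. -/
noncomputable def newContents {k : ℕ} (A : OrderedStructure σ) (wr : WritableTape σ k → Tape) :
    (l : ReadOnlyTape σ) → (old : ℕ → Sym) → ℕ → Sym
  | .value i, _ => Tape.contents (A.funQuery i fun j => (wr (.funAddr i j)).number)
  | .const _, old => old
  | .size, old => old

/-- The configuration that results from `c` by the action `r` of the transition function. -/
noncomputable def next (A : OrderedStructure σ) (c : M.Config)
    (r : M.Q × (WritableTape σ M.k → Sym × Dir) × (ReadOnlyTape σ → Dir)) : M.Config :=
  let wr : WritableTape σ M.k → Tape := fun l => ((c.wr l).write (r.2.1 l).1).move (r.2.1 l).2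
  { state := r.1
    wr := wr
    ro := fun l => ⟨newContents A wr l (c.ro l).cells, ((c.ro l).move (r.2.2 l)).head⟩ }

/-- One step on the input structure `A`. -/
noncomputable def step (A : OrderedStructure σ) (c : M.Config) : Option M.Config :=
  (M.δ c.state (fun l => (c.wr l).read) (fun l => (c.ro l).read)
    fun i => A.relQuery i fun j => (c.wr (.relAddr i j)).number).map (M.next A c)

/-- The accepting configurations. -/
def accepting : Set M.Config := {c | c.state ∈ M.accept}

/-- `M` decides the class `C` of structures in time `T` with respect to the size of the domain. -/
def DecidesInTime (C : Set (OrderedStructure σ)) (T : ℕ → ℕ) : Prop :=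
  ∀ A : OrderedStructure σ,
    (A ∈ C ↔ ReachesAccepting (M.step A) (M.initial A) M.accepting) ∧
      FinishesWithin (M.step A) (M.initial A) M.accepting (T A.n)

end DirectAccessTM

end PolylogTM

/-! Both machine models are compared with one algebra of functions on bit strings, `Cob`, in the
style of Cobham: it is generated from oracles by composition, case distinction on the first bit, and
recursion along the bits of a string. A round of a recursion may lengthen the accumulators only by
an amount polynomial in the lengths of the parameters, so polynomially many rounds keep all lengths
polynomial (`Cob.len`). Lengths are measured against `width`, that is ⌈log n⌉, so polynomial here
means polylogarithmic in n.

Three facts carry the proof.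

Functions of the algebra can be executed. They compile into programs on stacks of bits at polynomial
cost (`Host.compiles_of_cob`). A tape can hold a stack, and a finite control can run a fixed
program, since only finitely many remainders of it ever occur; so both kinds of machine execute such
programs (`raMachine_implements`, `daMachine_implements`).

Machines can be simulated in the algebra. A configuration is a finite family of strings, each tape
being cut at its head into two stacks, and a time-bounded run is a recursion along a clock string
whose length is at least the running time (`Guest.exists_cob`).

The oracles of either model can be computed from those of the other (`cob_raOracles`,
`cob_daOracles`), so `Cob.lift` passes from one algebra to the other. A position in the encoding is
decoded by arithmetic: subtract the lengths of the preceding blocks and take base n digits of the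
rest. Conversely, the bits that answer a query to the structure lie at computable positions of the
encoding.

The arithmetic needs n, which a random-access machine is not given. A symbol of positive arity makes
the length of the encoding strictly increasing in n ≥ 1 (`encLen_lt`), so n is found by binary
search, asking whether the cell with number `encLen σ m` exists (`num_search`); with nullary symbols
and constants only, the length would not determine n. Finally the two time scales agree: log n̂ is
at most linear in log n (`exists_clog_encLen_le`), and at least log n when there is a symbol of
positive arity (`clog_le_clog_encLen`). -/

namespace PolylogTM

/-! ## Polynomially bounded functions -/

/-- `f` is bounded by a polynomial, in the normal form `(N + 2) ^ d`. -/
def PolyBdd (f : ℕ → ℕ) : Prop := ∃ d, ∀ N, f N ≤ (N + 2) ^ d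

namespace PolyBdd

theorem pow_le {a b : ℕ} (h : a ≤ b) (N : ℕ) : (N + 2) ^ a ≤ (N + 2) ^ b :=
  Nat.pow_le_pow_right (by omega) h

theorem const (c : ℕ) : PolyBdd fun _ => c :=
  ⟨c, fun N => (Nat.lt_two_pow_self).le.trans (Nat.pow_le_pow_left (by omega) c)⟩

theorem id : PolyBdd fun N => N := ⟨1, fun N => by simp⟩

theorem add {f g : ℕ → ℕ} (hf : PolyBdd f) (hg : PolyBdd g) : PolyBdd fun N => f N + g N := by
  obtain ⟨a, ha⟩ := hf
  obtain ⟨b, hb⟩ := hg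
  refine ⟨max a b + 1, fun N => ?_⟩
  have h1 := (ha N).trans (pow_le (le_max_left a b) N)
  have h2 := (hb N).trans (pow_le (le_max_right a b) N)
  -- One more factor N + 2 ≥ 2 absorbs the sum of two powers.
  rw [pow_succ]
  nlinarith [Nat.zero_le ((N + 2) ^ max a b * N)]

theorem mul {f g : ℕ → ℕ} (hf : PolyBdd f) (hg : PolyBdd g) : PolyBdd fun N => f N * g N := by
  obtain ⟨a, ha⟩ := hf
  obtain ⟨b, hb⟩ := hg
  exact ⟨a + b, fun N => by rw [pow_add]; exact Nat.mul_le_mul (ha N) (hb N)⟩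

theorem pow {f : ℕ → ℕ} (hf : PolyBdd f) (k : ℕ) : PolyBdd fun N => f N ^ k := by
  obtain ⟨a, ha⟩ := hf
  exact ⟨a * k, fun N => by rw [pow_mul]; exact Nat.pow_le_pow_left (ha N) k⟩

theorem comp_pow {f : ℕ → ℕ} (hf : PolyBdd f) (k : ℕ) : PolyBdd fun N => (f N + 2) ^ k :=
  (hf.add (const 2)).pow k

theorem pow_self (k : ℕ) : PolyBdd fun N => (N + 2) ^ k := ⟨k, fun _ => le_rfl⟩

end PolyBdd

/-! ## Functions on bit strings computable by bounded recursion relative to oracles -/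

/-- Functions of an environment and of a family of bit strings. -/
abbrev Fn (E ι : Type) := E → (ι → List Bool) → List Bool

/-- A family of oracles that depend on an environment. -/
structure Oracles (E : Type) where
  Op : Type
  Arg : Op → Type
  [finite_Arg : ∀ o, Finite (Arg o)]
  val : (o : Op) → Fn E (Arg o)

attribute [instance] Oracles.finite_Arg

variable {E : Type}

/-- The functions generated from the oracles by composition, case distinction on the first bit, and
recursion along the bits of a string in which each step makes the values longer by at most an amount
that is polynomial in the lengths of the parameters. -/
inductive Cob (size : E → ℕ) (O : Oracles E) : ∀ {ι : Type}, Fn E ι → Prop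
  | var {ι : Type} (i : ι) : Cob size O fun _ s => s i
  | nil {ι : Type} : Cob (ι := ι) size O fun _ _ => []
  | cons {ι : Type} (b : Bool) {F : Fn E ι} : Cob size O F → Cob size O fun e s => b :: F e s
  | tail {ι : Type} {F : Fn E ι} : Cob size O F → Cob size O fun e s => (F e s).tail
  | case {ι : Type} {F : Fn E ι} (G : Option Bool → Fn E ι) : Cob size O F →
      (∀ o, Cob size O (G o)) → Cob size O fun e s => G (F e s).head? e s
  | oracle (o : O.Op) : Cob size O (O.val o)
  | comp {ι κ : Type} [Finite κ] {F : Fn E κ} {G : κ → Fn E ι} : Cob size O F →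
      (∀ j, Cob size O (G j)) → Cob size O fun e s => F e fun j => G j e s
  | fold {ι κ : Type} [Finite κ] {X : Fn E ι} {I : κ → Fn E ι} (G : Bool → κ → Fn E (κ ⊕ ι)) (k : κ) :
      Cob size O X → (∀ j, Cob size O (I j)) → (∀ b j, Cob size O (G b j)) →
      (∃ d, ∀ N e s, size e ≤ N → (∀ i, (s i).length ≤ N) → ∀ b M a,
        (∀ j, (a j).length ≤ M) → ∀ j, (G b j e (Sum.elim a s)).length ≤ M + (N + 2) ^ d) →
      Cob size O fun e s =>
        (X e s).foldl (fun a b j => G b j e (Sum.elim a s)) (fun j => I j e s) k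

/-- The values of the oracles are of polynomial length. -/
def Oracles.Short (O : Oracles E) (size : E → ℕ) : Prop :=
  ∀ o, ∃ d, ∀ N e s, size e ≤ N → (∀ i, (s i).length ≤ N) → (O.val o e s).length ≤ (N + 2) ^ d

/-- A finite family of exponents is bounded, and every bound in use is monotone in its exponent, so
one exponent serves all members. -/
theorem exists_uniform_pow {κ : Type} [Finite κ] {P : κ → ℕ → Prop}
    (hP : ∀ j d d', d ≤ d' → P j d → P j d') (h : ∀ j, ∃ d, P j d) : ∃ d, ∀ j, P j d := by
  choose f hf using h
  obtain ⟨d, hd⟩ := (Set.finite_range f).bddAbove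
  exact ⟨d, fun j => hP j _ _ (hd ⟨j, rfl⟩) (hf j)⟩

/-- The lengths of the values are bounded by `(N + 2) ^ d` where `N` bounds the size of the
environment and the lengths of the arguments. -/
def LenBdd (size : E → ℕ) {ι : Type} (F : Fn E ι) (d : ℕ) : Prop :=
  ∀ N e s, size e ≤ N → (∀ i, (s i).length ≤ N) → (F e s).length ≤ (N + 2) ^ d

theorem LenBdd.uniform {size : E → ℕ} {ι κ : Type} [Finite κ] {F : κ → Fn E ι}
    (h : ∀ j, ∃ d, LenBdd size (F j) d) : ∃ d, ∀ j, LenBdd size (F j) d :=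
  exists_uniform_pow (P := fun j d => LenBdd size (F j) d)
    (fun _ _ _ h H N e s h1 h2 => (H N e s h1 h2).trans (PolyBdd.pow_le h N)) h

section Fold

variable {κ : Type} (g : Bool → (κ → List Bool) → κ → List Bool) (D : ℕ)

/-- The growth per round is additive and independent of the accumulators, so it sums to the number
of rounds times `D`; growth by a constant factor would be exponential. -/
theorem foldl_length_le (hg : ∀ b M a, (∀ j, (a j).length ≤ M) → ∀ j, (g b a j).length ≤ M + D)
    (x : List Bool) (a : κ → List Bool) (M : ℕ) (ha : ∀ j, (a j).length ≤ M) (j : κ) :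
    (x.foldl (fun a b => g b a) a j).length ≤ M + x.length * D := by
  induction x generalizing a M with
  | nil => simpa using ha j
  | cons b x ih =>
    have := ih (g b a) (M + D) (hg b M a ha)
    simp only [List.foldl_cons, List.length_cons]
    calc _ ≤ _ := this
      _ = _ := by ring

end Fold

namespace Cob

variable {size : E → ℕ} {O : Oracles E} {ι : Type}

/-- The growth condition of `fold` replaces the explicit bounding function of Cobham's limited
recursion. This bound is what makes polynomial cost possible in the compilation. -/
theorem len (hO : O.Short size) {F : Fn E ι} (hF : Cob size O F) : ∃ d, LenBdd size F d := by
  induction hF with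
  | var i => exact ⟨1, fun N e s _ h => (h i).trans (by simp)⟩
  | nil => exact ⟨0, by simp [LenBdd]⟩
  | cons b _ ih =>
    obtain ⟨d, hd⟩ := ih
    obtain ⟨d', hd'⟩ := (PolyBdd.pow_self d).add (PolyBdd.const 1)
    exact ⟨d', fun N e s h1 h2 => le_trans (by simpa using hd N e s h1 h2) (hd' N)⟩
  | tail _ ih =>
    obtain ⟨d, hd⟩ := ih
    refine ⟨d, fun N e s h1 h2 => le_trans ?_ (hd N e s h1 h2)⟩
    simp
  | case G _ _ _ ihG =>
    obtain ⟨d, hd⟩ := LenBdd.uniform ihG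
    exact ⟨d, fun N e s h1 h2 => hd _ N e s h1 h2⟩
  | oracle o => exact hO o
  | comp _ _ ihF ihG =>
    obtain ⟨d, hd⟩ := ihF
    obtain ⟨d', hd'⟩ := LenBdd.uniform ihG
    obtain ⟨d'', hd''⟩ := (PolyBdd.id.add (PolyBdd.pow_self d')).comp_pow d
    refine ⟨d'', fun N e s h1 h2 => le_trans ?_ (hd'' N)⟩
    -- The outer function is used with the bound N + (N + 2) ^ d', in which N still dominates the
    -- size of the environment.
    exact hd _ e _ (by omega) fun j => (hd' j N e s h1 h2).trans (by omega)
  | fold G k _ _ _ hG ihX ihI _ =>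
    obtain ⟨dX, hX⟩ := ihX
    obtain ⟨dI, hI⟩ := LenBdd.uniform ihI
    obtain ⟨d, hd⟩ := hG
    obtain ⟨d', hd'⟩ := (PolyBdd.pow_self dI).add
      ((PolyBdd.pow_self dX).mul (PolyBdd.pow_self d))
    refine ⟨d', fun N e s h1 h2 => le_trans ?_ (hd' N)⟩
    refine (foldl_length_le (fun b a j => G b j e (Sum.elim a s)) ((N + 2) ^ d)
      (fun b M a => hd N e s h1 h2 b M a) _ _ ((N + 2) ^ dI) (hI · N e s h1 h2) k).trans ?_
    exact Nat.add_le_add_left (Nat.mul_le_mul_right _ (hX N e s h1 h2)) _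

/-- Replacing the oracles by other ones in which they can be computed. -/
theorem lift {O' : Oracles E} (hO : ∀ o, Cob size O' (O.val o)) {F : Fn E ι} (hF : Cob size O F) :
    Cob size O' F := by
  induction hF with
  | var i => exact .var i
  | nil => exact .nil
  | cons b _ ih => exact .cons b ih
  | tail _ ih => exact .tail ih
  | case G _ _ ih ih' => exact .case G ih ih'
  | oracle o => exact hO o
  | comp _ _ ih ih' => exact .comp ih ih'
  | fold G k _ _ _ hG ihX ihI ihG => exact .fold G k ihX ihI ihG hG

theorem const (l : List Bool) : Cob (ι := ι) size O fun _ _ => l := by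
  induction l with
  | nil => exact nil
  | cons b l ih => exact cons b ih

end Cob

/-- A function with values in a type without encoding on which one can distinguish cases. -/
def FinCob (size : E → ℕ) (O : Oracles E) {ι α : Type} (φ : E → (ι → List Bool) → α) : Prop :=
  ∀ G : α → Fn E ι, (∀ a, Cob size O (G a)) → Cob size O fun e s => G (φ e s) e s

namespace FinCob

variable {size : E → ℕ} {O : Oracles E} {ι α β : Type}

theorem const (a : α) : FinCob (ι := ι) size O fun _ _ => a := fun _ hG => hG a

theorem map {φ : E → (ι → List Bool) → α} (hφ : FinCob size O φ) (f : α → β) :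
    FinCob size O fun e s => f (φ e s) :=
  fun G hG => hφ (fun a => G (f a)) fun a => hG (f a)

/-- `FinCob` is in continuation-passing form, so two distinctions combine by nesting, without any
code for the values. -/
theorem pair {φ : E → (ι → List Bool) → α} {ψ : E → (ι → List Bool) → β}
    (hφ : FinCob size O φ) (hψ : FinCob size O ψ) : FinCob size O fun e s => (φ e s, ψ e s) :=
  fun G hG => hφ (fun a e s => G (a, ψ e s) e s) fun a => hψ (fun b => G (a, b)) fun b => hG (a, b)

theorem map₂ {γ : Type} {φ : E → (ι → List Bool) → α} {ψ : E → (ι → List Bool) → β}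
    (hφ : FinCob size O φ) (hψ : FinCob size O ψ) (f : α → β → γ) :
    FinCob size O fun e s => f (φ e s) (ψ e s) :=
  (hφ.pair hψ).map fun p => f p.1 p.2

theorem pi_fin {m : ℕ} {α : Type} {φ : Fin m → E → (ι → List Bool) → α}
    (hφ : ∀ j, FinCob size O (φ j)) : FinCob size O fun e s j => φ j e s := by
  induction m with
  | zero =>
    convert const (size := size) (O := O) (ι := ι) (fun j : Fin 0 => (j.elim0 : α)) using 3
  | succ m ih =>
    convert (ih fun j => hφ j.castSucc).map₂ (hφ (Fin.last m))
      (fun f a => (Fin.snoc (α := fun _ => α) f a : Fin (m + 1) → α)) using 3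
    exact funext fun j => by refine Fin.lastCases ?_ (fun j => ?_) j <;> simp

/-- Nested distinctions, one for each index along an enumeration of `κ`. Finiteness is essential. -/
theorem pi {κ : Type} [Finite κ] {φ : κ → E → (ι → List Bool) → α}
    (hφ : ∀ j, FinCob size O (φ j)) : FinCob size O fun e s j => φ j e s := by
  obtain ⟨m, ⟨f⟩⟩ := Finite.exists_equiv_fin κ
  convert (pi_fin fun j => hφ (f.symm j)).map fun g j => g (f j) using 4
  simp

theorem head? {F : Fn E ι} (hF : Cob size O F) : FinCob size O fun e s => (F e s).head? :=
  fun G hG => Cob.case G hF hG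

theorem isNil {F : Fn E ι} (hF : Cob size O F) :
    FinCob size O fun e s => (F e s).isEmpty := by
  convert (head? hF).map Option.isNone using 3
  rename_i e s
  cases F e s <;> rfl

theorem headD {F : Fn E ι} (hF : Cob size O F) (b : Bool) :
    FinCob size O fun e s => (F e s).headD b := by
  convert (head? hF).map (fun o => o.getD b) using 3
  rename_i e s
  cases F e s <;> rfl

/-- Only boundedly many case distinctions can be nested, hence the truncation at a fixed `m`. -/
theorem length_min {F : Fn E ι} (hF : Cob size O F) (m : ℕ) :
    FinCob size O fun e s => min (F e s).length m := by
  induction m generalizing F with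
  | zero => simpa using const 0
  | succ m ih =>
    have := ((isNil hF).pair (ih hF.tail)).map fun p => if p.1 then 0 else p.2 + 1
    convert this using 3
    rename_i e s
    cases F e s <;> simp

end FinCob

/-! ### Recursion with structured accumulators -/

namespace Cob

variable {size : E → ℕ} {O : Oracles E} {ι : Type}

theorem ite {c : E → (ι → List Bool) → Bool} {F G : Fn E ι} (hc : FinCob size O c)
    (hF : Cob size O F) (hG : Cob size O G) :
    Cob size O fun e s => if c e s then F e s else G e s :=
  hc (fun b e s => if b then F e s else G e s) fun b => by cases b <;> simpa

theorem consBit {c : E → (ι → List Bool) → Bool} {F : Fn E ι} (hc : FinCob size O c)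
    (hF : Cob size O F) : Cob size O fun e s => c e s :: F e s :=
  hc (fun b e s => b :: F e s) fun b => hF.cons b

/-- Recursion with accumulators in a type that is encoded by a family of bit strings. -/
theorem foldAcc {κ A : Type} [Finite κ] {X : Fn E ι} (toA : (κ → List Bool) → A)
    (ofA : A → κ → List Bool) (hA : ∀ a, toA (ofA a) = a) {I : E → (ι → List Bool) → A}
    (g : Bool → E → (ι → List Bool) → A → A) (k : κ) (hX : Cob size O X)
    (hI : ∀ j, Cob size O fun e s => ofA (I e s) j)
    (hg : ∀ b j, Cob size O fun e (s : κ ⊕ ι → List Bool) =>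
      ofA (g b e (fun i => s (.inr i)) (toA fun j => s (.inl j))) j)
    (hl : ∀ k, ∃ d, ∀ N e s, size e ≤ N → (∀ i, (s i).length ≤ N) → ∀ b M a,
        (∀ j, (a j).length ≤ M) → (ofA (g b e s (toA a)) k).length ≤ M + (N + 2) ^ d) :
    Cob size O fun e s => ofA ((X e s).foldl (fun a b => g b e s a) (I e s)) k := by
  obtain ⟨d, hd⟩ := exists_uniform_pow
    (P := fun k d => ∀ N e (s : ι → List Bool), size e ≤ N → (∀ i, (s i).length ≤ N) →
        ∀ b M (a : κ → List Bool), (∀ j, (a j).length ≤ M) → (ofA (g b e s (toA a)) k).length ≤ M + (N + 2) ^ d)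
    (fun j d d' h H N e s h1 h2 b M a h3 =>
      (H N e s h1 h2 b M a h3).trans (Nat.add_le_add_left (PolyBdd.pow_le h N) _)) hl
  have key := Cob.fold (size := size) (O := O) (X := X) (I := fun j e s => ofA (I e s) j)
    (fun b j e (s : κ ⊕ ι → List Bool) =>
      ofA (g b e (fun i => s (.inr i)) (toA fun j => s (.inl j))) j) k hX hI hg
    ⟨d, fun N e s h1 h2 b M a h3 j => hd j N e s h1 h2 b M a h3⟩
  convert key using 3 with e s
  generalize I e s = a
  -- The recursion on codes follows the recursion on `A`, because decoding after encoding is the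
  -- identity. The converse is not needed: only codes occur as accumulators.
  have : ∀ (x : List Bool) (a : A), ofA (x.foldl (fun a b => g b e s a) a) =
      x.foldl (fun a b j => ofA (g b e s (toA a)) j) (ofA a) := by
    intro x
    induction x with
    | nil => intro a; rfl
    | cons b x ih =>
      intro a
      rw [List.foldl_cons, List.foldl_cons, ih]
      congr 1
      funext j
      rw [hA]
  exact congrFun (this _ a) k

variable (size) in
/-- Steps that make the accumulators longer by a polynomial amount only. -/
def Slow {A : Type} (len : A → ℕ) (g : Bool → E → (ι → List Bool) → A → List Bool) : Prop :=
  ∃ d, ∀ N e s, size e ≤ N → (∀ i, (s i).length ≤ N) → ∀ b a,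
    (g b e s a).length ≤ len a + (N + 2) ^ d

theorem fold₁ {X I : Fn E ι} (g : Bool → E → (ι → List Bool) → List Bool → List Bool)
    (hX : Cob size O X) (hI : Cob size O I)
    (hg : ∀ b, Cob size O fun e (s : Fin 1 ⊕ ι → List Bool) =>
      g b e (fun i => s (.inr i)) (s (.inl 0)))
    (hl : Slow size List.length g) :
    Cob size O fun e s => (X e s).foldl (fun a b => g b e s a) (I e s) := by
  obtain ⟨d, hd⟩ := hl
  exact foldAcc (κ := Fin 1) (fun a => a 0) (fun a _ => a) (fun _ => rfl) g 0 hX (fun _ => hI)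
    (fun b _ => hg b) fun _ => ⟨d, fun N e s h1 h2 b M a h3 =>
      (hd N e s h1 h2 b (a 0)).trans (Nat.add_le_add_right (h3 0) _)⟩

/-- The larger of the lengths of two bit strings. -/
abbrev len₂ (a : List Bool × List Bool) : ℕ := max a.1.length a.2.length

theorem fold₂ {X I₁ I₂ : Fn E ι}
    (g₁ g₂ : Bool → E → (ι → List Bool) → List Bool × List Bool → List Bool)
    (hX : Cob size O X) (hI₁ : Cob size O I₁) (hI₂ : Cob size O I₂)
    (hg₁ : ∀ b, Cob size O fun e (s : Fin 2 ⊕ ι → List Bool) =>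
      g₁ b e (fun i => s (.inr i)) (s (.inl 0), s (.inl 1)))
    (hg₂ : ∀ b, Cob size O fun e (s : Fin 2 ⊕ ι → List Bool) =>
      g₂ b e (fun i => s (.inr i)) (s (.inl 0), s (.inl 1)))
    (hl₁ : Slow size len₂ g₁) (hl₂ : Slow size len₂ g₂) :
    (Cob size O fun e s =>
      ((X e s).foldl (fun a b => (g₁ b e s a, g₂ b e s a)) (I₁ e s, I₂ e s)).1) ∧
    (Cob size O fun e s =>
      ((X e s).foldl (fun a b => (g₁ b e s a, g₂ b e s a)) (I₁ e s, I₂ e s)).2) := by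
  obtain ⟨d₁, hd₁⟩ := hl₁
  obtain ⟨d₂, hd₂⟩ := hl₂
  have key := fun k => foldAcc (size := size) (O := O) (κ := Fin 2) (X := X)
    (fun a => (a 0, a 1)) (fun a => ![a.1, a.2]) (fun _ => rfl)
    (I := fun e s => (I₁ e s, I₂ e s)) (fun b e s a => (g₁ b e s a, g₂ b e s a)) k hX
    (fun j => by fin_cases j <;> simpa) (fun b j => by
      fin_cases j
      · simpa using hg₁ b
      · simpa using hg₂ b) (fun j => by
      fin_cases j
      · exact ⟨d₁, fun N e s h1 h2 b M a h3 => (hd₁ N e s h1 h2 b _).trans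
          (Nat.add_le_add_right (max_le (h3 0) (h3 1)) _)⟩
      · exact ⟨d₂, fun N e s h1 h2 b M a h3 => (hd₂ N e s h1 h2 b _).trans
          (Nat.add_le_add_right (max_le (h3 0) (h3 1)) _)⟩)
  exact ⟨key 0, key 1⟩

end Cob

end PolylogTM

namespace PolylogTM

/-! ## Programs on stacks of bits -/

/-- The resources of a machine with stacks of bits: in addition to work stacks, which are numbered,
it has special stacks and heads on read-only tapes, and it can ask the environment questions about
these. -/
structure Host (E : Type) where
  Addr : Type
  Head : Type
  Ask : Type
  answer : E → (Addr → List Bool) → (Head → ℕ) → Ask → Option Bool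

namespace Host

variable {E : Type} (H : Host E)

/-- The names of the stacks. -/
abbrev Stack := H.Addr ⊕ ℕ

/-- The contents of the stacks, and the positions of the heads. -/
@[ext]
structure State where
  stk : H.Stack → List Bool
  pos : H.Head → ℕ

/-- The instructions. -/
inductive Op
  | push (k : H.Stack) (b : Bool)
  | pop (k : H.Stack)
  | right (h : H.Head)
  | left (h : H.Head)
  | ask (a : H.Ask)

open Classical in
/-- The result and the effect of an instruction. -/
noncomputable def exec (e : E) : H.Op → H.State → Option Bool × H.State
  | .push k b, s => (none, ⟨Function.update s.stk k (b :: s.stk k), s.pos⟩)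
  | .pop k, s => ((s.stk k).head?, ⟨Function.update s.stk k (s.stk k).tail, s.pos⟩)
  | .right h, s => (none, ⟨s.stk, Function.update s.pos h (s.pos h + 1)⟩)
  | .left h, s => (none, ⟨s.stk, Function.update s.pos h (s.pos h - 1)⟩)
  | .ask a, s => (H.answer e (fun k => s.stk (.inl k)) s.pos a, s)

/-- Programs. `loop a f` performs `a` and `f b` as long as the result of `a` is `some b`. -/
inductive Prog
  | skip
  | acc
  | case (a : H.Op) (f : Option Bool → Prog)
  | seq (p q : Prog)
  | loop (a : H.Op) (f : Bool → Prog)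

variable {H}

/-- `Exec e p s s' t`: the program `p` leads from the state `s` to `s'` at the cost `t`. -/
inductive Exec (e : E) : H.Prog → H.State → H.State → ℕ → Prop
  | skip {s} : Exec e .skip s s 1
  | case {a f s s' t} : Exec e (f (H.exec e a s).1) (H.exec e a s).2 s' t →
      Exec e (.case a f) s s' (t + 2)
  | seq {p q s s' s'' t t'} : Exec e p s s' t → Exec e q s' s'' t' →
      Exec e (.seq p q) s s'' (t + t' + 1)
  | exit {a f s} : (H.exec e a s).1 = none → Exec e (.loop a f) s (H.exec e a s).2 2
  | iter {a f s b s' s'' t t'} : (H.exec e a s).1 = some b →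
      Exec e (f b) (H.exec e a s).2 s' t → Exec e (.loop a f) s' s'' t' →
      Exec e (.loop a f) s s'' (t + t' + 2)

/-- `p` leads from `s` to `s'` at a cost of at most `T`. -/
def Runs (e : E) (p : H.Prog) (s s' : H.State) (T : ℕ) : Prop := ∃ t ≤ T, Exec e p s s' t

namespace Runs

variable {e : E} {p q : H.Prog} {s s' s'' : H.State} {T T' : ℕ}

theorem mono (h : Runs e p s s' T) (hT : T ≤ T') : Runs e p s s' T' := by
  obtain ⟨t, ht, h⟩ := h
  exact ⟨t, ht.trans hT, h⟩

theorem congr (h : Runs e p s s' T) (hs : s' = s'') (hT : T ≤ T') : Runs e p s s'' T' :=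
  hs ▸ h.mono hT

theorem skip : Runs e .skip s s 1 := ⟨1, le_rfl, .skip⟩

theorem seq (h : Runs e p s s' T) (h' : Runs e q s' s'' T') :
    Runs e (.seq p q) s s'' (T + T' + 1) := by
  obtain ⟨t, ht, h⟩ := h
  obtain ⟨t', ht', h'⟩ := h'
  exact ⟨_, by omega, .seq h h'⟩

theorem case {a : H.Op} {f : Option Bool → H.Prog} {o : Option Bool}
    (ha : H.exec e a s = (o, s')) (h : Runs e (f o) s' s'' T) :
    Runs e (.case a f) s s'' (T + 2) := by
  obtain ⟨t, ht, h⟩ := h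
  exact ⟨t + 2, by omega, .case (by rwa [ha])⟩

theorem exit {a : H.Op} {f : Bool → H.Prog} (ha : H.exec e a s = (none, s')) :
    Runs e (.loop a f) s s' 2 :=
  ⟨2, le_rfl, by have := Exec.exit (f := f) (congrArg Prod.fst ha); rwa [ha] at this⟩

theorem iter {a : H.Op} {f : Bool → H.Prog} {b : Bool} {s₁ : H.State}
    (ha : H.exec e a s = (some b, s₁)) (h : Runs e (f b) s₁ s' T)
    (h' : Runs e (.loop a f) s' s'' T') : Runs e (.loop a f) s s'' (T + T' + 2) := by
  obtain ⟨t, ht, h⟩ := h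
  obtain ⟨t', ht', h'⟩ := h'
  exact ⟨t + t' + 2, by omega, .iter (congrArg Prod.fst ha) (by rwa [ha]) h'⟩

open Classical in
theorem exit_pop {k : H.Stack} {f : Bool → H.Prog} (hk : s.stk k = []) :
    Runs e (.loop (.pop k) f) s ⟨Function.update s.stk k [], s.pos⟩ 2 :=
  exit (Prod.ext (by simp [exec, hk]) (by simp [exec, hk]))

end Runs

namespace Prog

/-- A single instruction. -/
def op (a : H.Op) : H.Prog := .case a fun _ => .skip

/-- Empty a stack. -/
def clear (k : H.Stack) : H.Prog := .loop (.pop k) fun _ => .skip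

/-- Move the content of a stack onto another one, in reverse order. -/
def pour (k k' : H.Stack) : H.Prog := .loop (.pop k) fun b => op (.push k' b)

/-- Move the content of a stack onto two other ones, in reverse order. -/
def pour₂ (k k₁ k₂ : H.Stack) : H.Prog :=
  .loop (.pop k) fun b => .seq (op (.push k₁ b)) (op (.push k₂ b))

/-- Copy the content of a stack onto another one with the help of an empty stack. -/
def copy (k k' tmp : H.Stack) : H.Prog := .seq (pour k tmp) (pour₂ tmp k k')

end Prog

open Function

open Classical in
theorem runs_push {e : E} {k : H.Stack} {b : Bool} {s : H.State} :
    Runs e (Prog.op (.push k b)) s ⟨update s.stk k (b :: s.stk k), s.pos⟩ 3 :=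
  Runs.case (o := none) rfl Runs.skip

open Classical in
theorem runs_clear {e : E} {k : H.Stack} (s : H.State) :
    Runs e (Prog.clear k) s ⟨update s.stk k [], s.pos⟩ (3 * (s.stk k).length + 2) := by
  obtain ⟨stk, pos⟩ := s
  generalize hl : stk k = l
  induction l generalizing stk with
  | nil => exact (Runs.exit_pop hl).congr rfl (by simp)
  | cons b l ih =>
    have h := ih (update stk k l) (by simp)
    have := Runs.iter (a := .pop k) (f := fun _ => Prog.skip) (e := e) (s := ⟨stk, pos⟩)
      (s₁ := ⟨update stk k l, pos⟩) (b := b) (by simp [exec, hl]) Runs.skip h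
    refine this.congr (by simp) ?_
    simp [hl]
    omega

open Classical in
theorem runs_pour {e : E} {k k' : H.Stack} (hk : k ≠ k') (s : H.State) :
    Runs e (Prog.pour k k') s
      ⟨update (update s.stk k' ((s.stk k).reverse ++ s.stk k')) k [], s.pos⟩
      (5 * (s.stk k).length + 2) := by
  obtain ⟨stk, pos⟩ := s
  generalize hl : stk k = l
  induction l generalizing stk with
  | nil => exact (Runs.exit_pop hl).congr (by simp [hl]) (by simp)
  | cons b l ih =>
    have h := ih (update (update stk k l) k' (b :: stk k')) (by simp [hk])
    have := Runs.iter (a := .pop k) (f := fun b => Prog.op (.push k' b)) (e := e)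
      (s := ⟨stk, pos⟩)
      (s₁ := ⟨update stk k l, pos⟩) (b := b) (by simp [exec, hl])
      (s' := ⟨update (update stk k l) k' (b :: stk k'), pos⟩)
      (by simpa [hk.symm] using runs_push (e := e) (k := k') (b := b) (s := ⟨update stk k l, pos⟩)) h
    refine this.congr ?_ ?_
    · simp [hk, hl, update_comm hk]
    · simp [hk, hl]
      omega

open Classical in
theorem runs_pour₂ {e : E} {k k₁ k₂ : H.Stack} (h₁ : k ≠ k₁) (h₂ : k ≠ k₂) (h₁₂ : k₁ ≠ k₂)
    (s : H.State) :
    Runs e (Prog.pour₂ k k₁ k₂) s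
      ⟨update (update (update s.stk k₁ ((s.stk k).reverse ++ s.stk k₁)) k₂
        ((s.stk k).reverse ++ s.stk k₂)) k [], s.pos⟩
      (9 * (s.stk k).length + 2) := by
  obtain ⟨stk, pos⟩ := s
  generalize hl : stk k = l
  induction l generalizing stk with
  | nil => exact (Runs.exit_pop hl).congr (by simp [hl]) (by simp)
  | cons b l ih =>
    have h := ih (update (update (update stk k l) k₁ (b :: stk k₁)) k₂ (b :: stk k₂))
      (by simp [h₁, h₂])
    have h' : Runs e (.seq (Prog.op (.push k₁ b)) (Prog.op (.push k₂ b))) ⟨update stk k l, pos⟩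
        ⟨update (update (update stk k l) k₁ (b :: stk k₁)) k₂ (b :: stk k₂), pos⟩ 7 := by
      have a := runs_push (e := e) (k := k₁) (b := b) (s := ⟨update stk k l, pos⟩)
      have b := runs_push (e := e) (k := k₂) (b := b)
        (s := ⟨update (update stk k l) k₁ (b :: stk k₁), pos⟩)
      simp only [ne_eq, h₁.symm, h₂.symm, h₁₂.symm, not_false_eq_true, update_of_ne] at a b
      exact a.seq b
    have := Runs.iter (a := .pop k)
      (f := fun b => .seq (Prog.op (.push k₁ b)) (Prog.op (.push k₂ b))) (e := e)
      (s := ⟨stk, pos⟩)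
      (s₁ := ⟨update stk k l, pos⟩) (b := b) (by simp [exec, hl]) h' h
    refine this.congr (State.ext (funext fun x => ?_) rfl) ?_
    · by_cases hx : x = k
      · simp [hx]
      by_cases hx₁ : x = k₁
      · subst hx₁
        simp [hx, h₁₂, h₁, h₂, hl]
      by_cases hx₂ : x = k₂
      · subst hx₂
        simp [hx, h₁, h₂, hl]
      simp [hx, hx₁, hx₂]
    · simp [h₁, h₂, hl]
      omega

open Classical in
-- Each pouring reverses the order, so two of them restore it; the second one writes to the source
-- and to the target at once.
theorem runs_copy {e : E} {k k' tmp : H.Stack} (h₁ : tmp ≠ k) (h₂ : tmp ≠ k') (h₁₂ : k ≠ k')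
    (s : H.State) (ht : s.stk tmp = []) :
    Runs e (Prog.copy k k' tmp) s
      ⟨update s.stk k' (s.stk k ++ s.stk k'), s.pos⟩ (14 * (s.stk k).length + 5) := by
  have a := runs_pour (e := e) h₁.symm s
  have b := runs_pour₂ (e := e) h₁ h₂ h₁₂
    ⟨update (update s.stk tmp ((s.stk k).reverse ++ s.stk tmp)) k [], s.pos⟩
  refine (a.seq b).congr (State.ext (funext fun x => ?_) rfl) ?_
  · by_cases hx : x = tmp
    · subst hx
      simp [h₂, ht]
    by_cases hx₁ : x = k
    · subst hx₁
      simp [hx, h₁₂, ht, h₁]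
    by_cases hx₂ : x = k'
    · subst hx₂
      simp [hx, hx₁, h₁, ht]
    simp [hx, hx₁, hx₂]
  · simp [ht, h₁]
    omega

/-! ## Compilation of recursive functions into programs -/

/-- The state with the given work stacks in which everything else is at its initial value. -/
def work (s : ℕ → List Bool) : H.State := ⟨Sum.elim (fun _ => []) s, fun _ => 0⟩

open Classical in
theorem work_update (s : ℕ → List Bool) (i : ℕ) (l : List Bool) :
    (⟨update (work (H := H) s).stk (.inr i) l, (work (H := H) s).pos⟩ : H.State) =
      work (update s i l) := by
  simp only [work, Sum.update_elim_inr]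

/-- Within costs bounded by `(N + 2) ^ d`, the program `p` assigns the value of `F` at the stacks
`loc` to the stack `dst`, using stacks from `base` on as auxiliary memory. -/
def Assigns (size : E → ℕ) {ι : Type} (F : Fn E ι) (loc : ι → ℕ) (dst base d : ℕ)
    (p : H.Prog) : Prop :=
  ∀ N e (s : ℕ → List Bool), size e ≤ N → (∀ i, (s (loc i)).length ≤ N) → (s dst).length ≤ N →
    (∀ j ≥ base, s j = []) →
    Runs e p (work s) (work (update s dst (F e fun i => s (loc i)))) ((N + 2) ^ d)

variable (H) in
/-- `F` can be compiled into programs. -/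
def Compiles (size : E → ℕ) {ι : Type} (F : Fn E ι) : Prop :=
  ∃ d, ∀ (loc : ι → ℕ) (dst base : ℕ), (∀ i, loc i < base) → dst < base →
    ∃ p : H.Prog, Assigns size F loc dst base d p

section Steps

variable {e : E} (s : ℕ → List Bool) (i j t : ℕ)

theorem work_push (b : Bool) : Runs e (Prog.op (.push (.inr i) b)) (work (H := H) s)
    (work (update s i (b :: s i))) 3 := by
  rw [← work_update]
  exact runs_push

theorem work_clear : Runs e (Prog.clear (.inr i)) (work (H := H) s) (work (update s i []))
    (3 * (s i).length + 2) := by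
  rw [← work_update]
  exact runs_clear _

theorem exec_work_pop : H.exec e (.pop (.inr i)) (work s) =
    ((s i).head?, work (update s i (s i).tail)) := by
  rw [← work_update]
  rfl

theorem work_copy (hij : i ≠ j) (hti : t ≠ i) (htj : t ≠ j) (ht : s t = []) :
    Runs e (Prog.copy (.inr i) (.inr j) (.inr t)) (work (H := H) s)
      (work (update s j (s i ++ s j))) (14 * (s i).length + 5) := by
  rw [← work_update]
  exact runs_copy (by simpa) (by simpa) (by simpa) _ ht

end Steps

variable {size : E → ℕ} {ι : Type}

namespace Compiles

theorem var (i : ι) : Compiles H size fun _ (s : ι → List Bool) => s i := by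
  -- The cost of clearing, 3N + 2, of copying, 14N + 5, and 1 for the sequence.
  obtain ⟨d, hd⟩ : ∃ d, ∀ N, 17 * N + 8 ≤ (N + 2) ^ d :=
    ((PolyBdd.const 17).mul PolyBdd.id).add (PolyBdd.const 8)
  refine ⟨d, fun loc dst base hl hdst => ?_⟩
  -- The target may be one of the arguments. Clearing it would then destroy the value.
  by_cases h : loc i = dst
  · refine ⟨.skip, fun N e s h1 h2 h3 h4 => ?_⟩
    rw [← h, update_eq_self]
    exact Runs.skip.mono Nat.one_le_two_pow |>.mono (Nat.pow_le_pow_left (by omega) _)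
  · refine ⟨.seq (.clear (.inr dst)) (.copy (.inr (loc i)) (.inr dst) (.inr base)),
      fun N e s h1 h2 h3 h4 => ?_⟩
    have a := work_clear (H := H) (e := e) s dst
    have b := work_copy (H := H) (e := e) (update s dst []) (loc i) dst base h (hl i).ne' hdst.ne'
      (by rw [update_of_ne hdst.ne', h4 _ le_rfl])
    refine (a.seq b).congr (by simp [h]) ?_
    · have := h2 i
      rw [update_of_ne h]
      exact le_trans (by omega) (hd N)

theorem nil : Compiles H size fun _ (_ : ι → List Bool) => [] := by
  obtain ⟨d, hd⟩ : ∃ d, ∀ N, 3 * N + 2 ≤ (N + 2) ^ d :=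
    ((PolyBdd.const 3).mul PolyBdd.id).add (PolyBdd.const 2)
  refine ⟨d, fun loc dst base hl hdst => ⟨.clear (.inr dst), fun N e s h1 h2 h3 h4 => ?_⟩⟩
  exact (work_clear s dst).mono (le_trans (by omega) (hd N))

theorem cons {F : Fn E ι} (hF : Compiles H size F) (b : Bool) :
    Compiles H size fun e s => b :: F e s := by
  obtain ⟨d₀, hF⟩ := hF
  obtain ⟨d, hd⟩ := (PolyBdd.pow_self d₀).add (PolyBdd.const 4)
  refine ⟨d, fun loc dst base hl hdst => ?_⟩
  obtain ⟨p, hp⟩ := hF loc dst base hl hdst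
  refine ⟨.seq p (Prog.op (.push (.inr dst) b)), fun N e s h1 h2 h3 h4 => ?_⟩
  have := (hp N e s h1 h2 h3 h4).seq (work_push _ dst b)
  simp only [update_self, update_idem] at this
  exact this.mono (hd N)

theorem tail {F : Fn E ι} (hF : Compiles H size F) :
    Compiles H size fun e s => (F e s).tail := by
  obtain ⟨d₀, hF⟩ := hF
  obtain ⟨d, hd⟩ := (PolyBdd.pow_self d₀).add (PolyBdd.const 4)
  refine ⟨d, fun loc dst base hl hdst => ?_⟩
  obtain ⟨p, hp⟩ := hF loc dst base hl hdst
  refine ⟨.seq p (Prog.op (.pop (.inr dst))), fun N e s h1 h2 h3 h4 => ?_⟩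
  have := (hp N e s h1 h2 h3 h4).seq (Runs.case (f := fun _ => Prog.skip) (exec_work_pop _ dst) Runs.skip)
  simp only [update_self, update_idem] at this
  exact this.mono (hd N)

theorem case {F : Fn E ι} (G : Option Bool → Fn E ι) (hF : Compiles H size F)
    (hl : ∃ d, LenBdd size F d) (hG : ∀ o, Compiles H size (G o)) :
    Compiles H size fun e s => G (F e s).head? e s := by
  obtain ⟨d₀, hF⟩ := hF
  obtain ⟨d₂, hlen⟩ := hl
  obtain ⟨d₁, hG⟩ := exists_uniform_pow
    (P := fun o d => ∀ (loc : ι → ℕ) (dst base : ℕ), (∀ i, loc i < base) → dst < base →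
      ∃ p : H.Prog, Assigns size (G o) loc dst base d p)
    (fun o d d' h H loc dst base h1 h2 => (H loc dst base h1 h2).imp
      fun p hp N e s a b c d => (hp N e s a b c d).mono (PolyBdd.pow_le h N)) hG
  obtain ⟨d, hd⟩ : ∃ d, ∀ N, (N + 2) ^ d₀ + (3 * (N + 2) ^ d₂ + 2 + (N + 2) ^ d₁ + 1 + 2) + 1 ≤
      (N + 2) ^ d :=
    (PolyBdd.pow_self d₀).add (((((((PolyBdd.const 3).mul (PolyBdd.pow_self d₂)).add
      (PolyBdd.const 2)).add (PolyBdd.pow_self d₁)).add (PolyBdd.const 1)).add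
      (PolyBdd.const 2))) |>.add (PolyBdd.const 1)
  refine ⟨d, fun loc dst base hl hdst => ?_⟩
  -- The value of `F` goes to the fresh stack `base` and not to `dst`, since `dst` may hold an
  -- argument that the branches still need.
  obtain ⟨p, hp⟩ := hF loc base (base + 1) (fun i => (hl i).trans (by omega)) (by omega)
  choose q hq using fun o => hG o loc dst base hl hdst
  refine ⟨.seq p (.case (.pop (.inr base)) fun o => .seq (.clear (.inr base)) (q o)),
    fun N e s h1 h2 h3 h4 => ?_⟩
  have a := hp N e s h1 h2 (by simp [h4 base le_rfl]) fun j hj => h4 j (by omega)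
  set v := F e fun i => s (loc i) with hv
  have b := exec_work_pop (H := H) (e := e) (update s base v) base
  simp only [update_self, update_idem] at b
  have c := work_clear (H := H) (e := e) (update s base v.tail) base
  -- Auxiliary stacks are empty by convention, so emptying `base` restores the original state before
  -- the branch is taken.
  have hs : update s base [] = s := by rw [← h4 base le_rfl, update_eq_self]
  simp only [update_self, update_idem, hs] at c
  have hvl : v.length ≤ (N + 2) ^ d₂ := hlen N e _ h1 h2
  refine (a.seq (Runs.case b (c.seq (hq _ N e s h1 h2 h3 h4)))).mono (le_trans ?_ (hd N))
  have : v.tail.length ≤ v.length := by simp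
  omega

end Compiles

/-- The stacks `s` with those from `b` on replaced by `v 0, …, v (m - 1)`. -/
def place (s : ℕ → List Bool) (b m : ℕ) (v : ℕ → List Bool) : ℕ → List Bool :=
  fun i => if b ≤ i ∧ i < b + m then v (i - b) else s i

section place

variable {s : ℕ → List Bool} {b m : ℕ} {v : ℕ → List Bool}

theorem place_add {j : ℕ} (h : j < m) : place s b m v (b + j) = v j := by simp [place, h]

theorem place_lt {i : ℕ} (h : i < b) : place s b m v i = s i := by
  rw [place, if_neg (by omega)]

theorem place_ge {i : ℕ} (h : b + m ≤ i) : place s b m v i = s i := by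
  rw [place, if_neg (by omega)]

theorem place_succ : place s b (m + 1) v = update (place s b m v) (b + m) (v m) := by
  funext i
  by_cases h : i = b + m
  · subst h
    simp [place]
  · rw [update_of_ne h]
    simp only [place]
    congr 1
    simp only [eq_iff_iff]
    omega

theorem place_self (h : ∀ j < m, v j = s (b + j)) : place s b m v = s := by
  funext i
  by_cases h' : b ≤ i ∧ i < b + m
  · rw [place, if_pos h', h _ (by omega)]
    congr 1
    omega
  · rw [place, if_neg h']

end place

/-- The program `p` assigns the values of the functions `G 0, …, G (m - 1)` at the stacks `loc` to
the stacks from `b` on. -/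
def AssignsMany (size : E → ℕ) (G : ℕ → Fn E ι) (m : ℕ) (loc : ι → ℕ) (b base d : ℕ)
    (p : H.Prog) : Prop :=
  ∀ N e (s : ℕ → List Bool), size e ≤ N → (∀ i, (s (loc i)).length ≤ N) →
    (∀ j < m, (s (b + j)).length ≤ N) → (∀ j ≥ base, s j = []) →
    Runs e p (work s) (work (place s b m fun j => G j e fun i => s (loc i))) ((N + 2) ^ d)

/-- The block of targets is disjoint from the arguments, so an assignment does not spoil the
arguments of the later ones. -/
theorem Compiles.many {G : ℕ → Fn E ι} (hG : ∀ j, Compiles H size (G j)) (m : ℕ) :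
    ∃ d, ∀ (loc : ι → ℕ) (b base : ℕ), (∀ i, loc i < base) →
      (∀ i, loc i < b ∨ b + m ≤ loc i) → b + m ≤ base →
      ∃ p : H.Prog, AssignsMany size G m loc b base d p := by
  induction m with
  | zero =>
    refine ⟨0, fun loc b base _ _ _ => ⟨.skip, fun N e s h1 h2 h3 h4 => ?_⟩⟩
    rw [place_self (by simp)]
    exact Runs.skip
  | succ m ih =>
    obtain ⟨d₀, h₀⟩ := ih
    obtain ⟨d₁, h₁⟩ := hG m
    obtain ⟨d, hd⟩ : ∃ d, ∀ N, (N + 2) ^ d₀ + (N + 2) ^ d₁ + 1 ≤ (N + 2) ^ d :=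
      ((PolyBdd.pow_self d₀).add (PolyBdd.pow_self d₁)).add (PolyBdd.const 1)
    refine ⟨d, fun loc b base hl hl' hb => ?_⟩
    obtain ⟨p, hp⟩ := h₀ loc b base hl (fun i => (hl' i).imp id fun h => by omega) (by omega)
    obtain ⟨q, hq⟩ := h₁ loc (b + m) base hl (by omega)
    refine ⟨.seq p q, fun N e s h1 h2 h3 h4 => ?_⟩
    have a := hp N e s h1 h2 (fun j hj => h3 j (by omega)) h4
    have hs : ∀ i, place s b m (fun j => G j e fun i => s (loc i)) (loc i) = s (loc i) := fun i =>
      (hl' i).elim place_lt fun h => place_ge (by omega)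
    have c := hq N e (place s b m fun j => G j e fun i => s (loc i)) h1
      (fun i => by rw [hs]; exact h2 i) (by rw [place_ge le_rfl]; exact h3 m (by omega))
      (fun j hj => by rw [place_ge (by omega)]; exact h4 j hj)
    simp only [hs] at c
    rw [place_succ]
    exact (a.seq c).mono (hd N)

variable (H size) in
theorem exists_clearMany (m : ℕ) : ∃ d, ∀ (b base : ℕ), b + m ≤ base →
    ∃ p : H.Prog, ∀ N e (s : ℕ → List Bool), size e ≤ N → (∀ j < m, (s (b + j)).length ≤ N) →
      (∀ j ≥ base, s j = []) →
      Runs e p (work s) (work (place s b m fun _ => [])) ((N + 2) ^ d) := by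
  obtain ⟨d, hd⟩ := Compiles.many (H := H) (size := size) (ι := Empty)
    (G := fun _ _ _ => []) (fun _ => Compiles.nil) m
  refine ⟨d, fun b base hb => ?_⟩
  obtain ⟨p, hp⟩ := hd (fun i => i.elim) b base (fun i => i.elim) (fun i => i.elim) hb
  exact ⟨p, fun N e s h1 h2 h3 => hp N e s h1 (fun i => i.elim) h2 h3⟩

/-- The extension of a family indexed by `κ` along an enumeration of `κ`. -/
def extend {κ α : Type} {m : ℕ} (f : κ ≃ Fin m) (a : α) (v : κ → α) : ℕ → α :=
  fun j => if h : j < m then v (f.symm ⟨j, h⟩) else a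

theorem extend_apply {κ α : Type} {m : ℕ} (f : κ ≃ Fin m) (a : α) (v : κ → α) (k : κ) :
    extend f a v (f k) = v k := by
  simp [extend]

theorem extend_induction {κ α : Type} {m : ℕ} (f : κ ≃ Fin m) {a : α} {v : κ → α} {P : α → Prop}
    (ha : P a) (hv : ∀ k, P (v k)) (j : ℕ) : P (extend f a v j) := by
  unfold extend
  split
  · exact hv _
  · exact ha

theorem extend_fn {κ : Type} {m : ℕ} (f : κ ≃ Fin m) (G : κ → Fn E ι) (e : E)
    (s : ι → List Bool) (j : ℕ) :
    extend f (fun _ _ => []) G j e s = extend f [] (fun k => G k e s) j := by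
  unfold extend
  split <;> rfl

/-! ### Compilation of composition and of a round of recursion -/

namespace Compiles

/-- The inner values are put on fresh stacks from `base` on, the outer program reads them there, and
they are erased afterwards. The length bound on the inner functions turns the cost of the outer
program into a polynomial in N. -/
theorem comp {κ : Type} [Finite κ] {F : Fn E κ} {G : κ → Fn E ι} (hF : Compiles H size F)
    (hG : ∀ j, Compiles H size (G j)) (hl : ∃ d, ∀ j, LenBdd size (G j) d) :
    Compiles H size fun e s => F e fun j => G j e s := by
  obtain ⟨m, ⟨f⟩⟩ := Finite.exists_equiv_fin κ
  obtain ⟨d₀, hF⟩ := hF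
  obtain ⟨d₁, hG⟩ := many (G := extend f (fun _ _ => []) G) (extend_induction f nil hG) m
  obtain ⟨d₂, hcl⟩ := exists_clearMany H size m
  obtain ⟨d₃, hlen⟩ := hl
  obtain ⟨d, hd⟩ : ∃ d, ∀ N, (N + 2) ^ d₁ + (((N + (N + 2) ^ d₃ + 2) ^ d₀) +
      ((N + (N + 2) ^ d₃ + 2) ^ d₂) + 1) + 1 ≤ (N + 2) ^ d :=
    have h := PolyBdd.id.add (PolyBdd.pow_self d₃)
    ((PolyBdd.pow_self d₁).add (((h.comp_pow d₀).add (h.comp_pow d₂)).add (.const 1))).add (.const 1)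
  refine ⟨d, fun loc dst base hloc hdst => ?_⟩
  obtain ⟨p, hp⟩ := hG loc base (base + m) (fun i => (hloc i).trans_le (by omega))
    (fun i => .inl (hloc i)) le_rfl
  obtain ⟨q, hq⟩ := hF (fun k => base + f k) dst (base + m) (fun k => by have := (f k).2; omega)
    (by omega)
  obtain ⟨r, hr⟩ := hcl base (base + m) le_rfl
  refine ⟨.seq p (.seq q r), fun N e s h1 h2 h3 h4 => ?_⟩
  have a := hp N e s h1 h2 (fun j _ => by simp [h4 (base + j) (by omega)])
    fun j hj => h4 j (by omega)
  simp only [extend_fn] at a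
  set v := extend f [] (fun k => G k e fun i => s (loc i)) with hv
  have hvk : ∀ k, v (f k) = G k e fun i => s (loc i) := fun k => extend_apply f _ _ k
  have hvl : ∀ j, (v j).length ≤ (N + 2) ^ d₃ := extend_induction
    (P := fun l : List Bool => l.length ≤ (N + 2) ^ d₃) f (Nat.zero_le _) fun k => hlen k N e _ h1 h2
  have hpl : ∀ k : κ, place s base m v (base + f k) = G k e fun i => s (loc i) := fun k => by
    rw [place_add (f k).2, hvk]
  have hout : ∀ j ≥ base + m, place s base m v j = [] := fun j hj => by
    rw [place_ge hj, h4 j (by omega)]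
  have b := hq (N + (N + 2) ^ d₃) e (place s base m v) (by omega)
    (fun k => by rw [place_add (f k).2]; exact (hvl _).trans (by omega))
    (by rw [place_lt hdst]; omega) hout
  simp only [hpl] at b
  have c := hr (N + (N + 2) ^ d₃) e (update (place s base m v) dst
    (F e fun k => G k e fun i => s (loc i))) (by omega)
    (fun j hj => by
      rw [update_of_ne (by omega), place_add hj]; exact (hvl _).trans (by omega))
    (fun j hj => by rw [update_of_ne (by omega), hout j hj])
  refine (a.seq (b.seq c)).congr ?_ (hd N)
  congr 1
  funext i
  by_cases hi : i = dst
  · subst hi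
    rw [place_lt hdst, update_self, update_self]
  rw [update_of_ne hi]
  by_cases h : i < base
  · rw [place_lt h, update_of_ne hi, place_lt h]
  rw [h4 i (by omega)]
  by_cases h' : i < base + m
  · obtain ⟨j, rfl⟩ := Nat.exists_eq_add_of_le (not_lt.mp h)
    rw [place_add (by omega)]
  · rw [place_ge (by omega), update_of_ne hi, hout i (by omega)]

/-- One iteration of a recursion: the values of the step function are assigned to the accumulators,
which are the stacks from `b` on. -/
theorem body {κ : Type} {m : ℕ} (f : κ ≃ Fin m) {G : κ → Fn E (κ ⊕ ι)}
    (hG : ∀ j, Compiles H size (G j)) : ∃ d, ∀ (loc : ι → ℕ) (b : ℕ), (∀ i, loc i < b) →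
      ∃ p : H.Prog, ∀ N e (s : ℕ → List Bool) (a : ℕ → List Bool), size e ≤ N →
        (∀ i, (s (loc i)).length ≤ N) → (∀ j < m, (a j).length ≤ N) →
        (∀ k, (G k e (Sum.elim (fun k => a (f k)) fun i => s (loc i))).length ≤ N) →
        (∀ j ≥ b, s j = []) →
        Runs e p (work (place s b m a)) (work (place s b m
          (extend f [] fun k => G k e (Sum.elim (fun k => a (f k)) fun i => s (loc i)))))
          ((N + 2) ^ d) := by
  obtain ⟨d₁, h₁⟩ := many (G := extend f (fun _ _ => []) G) (extend_induction f nil hG) m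
  obtain ⟨d₂, h₂⟩ := many (H := H) (size := size) (ι := ℕ)
    (G := fun j _ s => s j) (fun j => var _) m
  obtain ⟨d₃, h₃⟩ := exists_clearMany H size m
  obtain ⟨d, hd⟩ : ∃ d, ∀ N, (N + 2) ^ d₁ + ((N + 2) ^ d₂ + (N + 2) ^ d₃ + 1) + 1 ≤ (N + 2) ^ d :=
    ((PolyBdd.pow_self d₁).add (((PolyBdd.pow_self d₂).add (.pow_self d₃)).add (.const 1))).add
      (.const 1)
  refine ⟨d, fun loc b hloc => ?_⟩
  -- All components of the step read all the old accumulators, so the new values are first collected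
  -- in a second block, at `b + m`, and copied back once they are complete.
  obtain ⟨p, hp⟩ := h₁ (Sum.elim (fun k => b + f k) loc) (b + m) (b + 2 * m)
    (by
      rintro (k | i)
      · have := (f k).2
        simp only [Sum.elim_inl]
        omega
      · have := hloc i
        simp only [Sum.elim_inr]
        omega)
    (by
      rintro (k | i)
      · have := (f k).2
        simp only [Sum.elim_inl]
        omega
      · have := hloc i
        simp only [Sum.elim_inr]
        omega) (by omega)
  -- Without accumulators there is no cell in the second block to which the copying below could
  -- refer.
  rcases Nat.eq_zero_or_pos m with rfl | hm
  · refine ⟨.skip, fun N e s a _ _ _ _ _ => ?_⟩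
    rw [place_self (by simp), place_self (by simp)]
    exact Runs.skip.mono (Nat.one_le_pow _ _ (by omega))
  -- Copying is an instance of `many` with arguments indexed by all of ℕ; the minimum keeps every
  -- source inside the second block and does not matter for j < m.
  obtain ⟨q, hq⟩ := h₂ (fun j => b + m + min j (m - 1)) b (b + 2 * m)
    (fun j => by have := min_le_right j (m - 1); omega) (fun j => .inr (by omega)) (by omega)
  obtain ⟨r, hr⟩ := h₃ (b + m) (b + 2 * m) (by omega)
  refine ⟨.seq p (.seq q r), fun N e s a h1 h2 h3 h4 h5 => ?_⟩
  have A := hp N e (place s b m a) h1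
    (by
      rintro (k | i)
      · simpa only [Sum.elim_inl, place_add (f k).2] using h3 _ (f k).2
      · simpa only [Sum.elim_inr, place_lt (hloc i)] using h2 i)
    (fun j hj => by rw [place_ge (by omega), h5 _ (by omega)]; exact Nat.zero_le _)
    (fun j hj => by rw [place_ge (by omega), h5 _ (by omega)])
  have hctx : (fun i => place s b m a (Sum.elim (fun k => b + (f k : ℕ)) loc i)) =
      Sum.elim (fun k => a (f k)) fun i => s (loc i) := by
    funext i
    rcases i with k | i
    · simp [place_add (f k).2]
    · simp [place_lt (hloc i)]
  simp only [hctx, extend_fn] at A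
  set v := extend f [] (fun k => G k e (Sum.elim (fun k => a (f k)) fun i => s (loc i))) with hv
  have hvl : ∀ j, (v j).length ≤ N := extend_induction
    (P := fun l : List Bool => l.length ≤ N) f (Nat.zero_le _) fun k => h4 k
  have B := hq N e (place (place s b m a) (b + m) m v) h1
    (fun j => by
      rw [place_add (by have := min_le_right j (m - 1); omega)]
      exact hvl _)
    (fun j hj => by rw [place_lt (by omega), place_add hj]; exact h3 j hj)
    (fun j hj => by rw [place_ge (by omega), place_ge (by omega), h5 j (by omega)])
  have hB : place (place (place s b m a) (b + m) m v) b m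
      (fun j => place (place s b m a) (b + m) m v (b + m + min j (m - 1))) =
      place (place s b m v) (b + m) m v := by
    funext i
    by_cases h : b + m ≤ i
    · rw [place_ge h]
      by_cases h' : i < b + m + m
      · obtain ⟨j, rfl⟩ := Nat.exists_eq_add_of_le h
        rw [place_add (by omega), place_add (by omega)]
      · rw [place_ge (by omega), place_ge (by omega), place_ge (by omega), place_ge (by omega)]
    · rw [place_lt (s := place s b m v) (by omega)]
      by_cases h' : b ≤ i
      · obtain ⟨j, rfl⟩ := Nat.exists_eq_add_of_le h'
        rw [place_add (by omega), place_add (by omega), place_add (by omega)]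
        congr 1
        omega
      · rw [place_lt (by omega), place_lt (by omega), place_lt (by omega), place_lt (by omega)]
  rw [hB] at B
  have C := hr N e (place (place s b m v) (b + m) m v) h1
    (fun j hj => by rw [place_add hj]; exact hvl j)
    (fun j hj => by rw [place_ge (by omega), place_ge (by omega), h5 j (by omega)])
  refine (A.seq (B.seq C)).congr ?_ (hd N)
  congr 1
  funext i
  by_cases h : i < b + m
  · rw [place_lt h, place_lt h]
  · rw [place_ge (s := s) (by omega), h5 i (by omega)]
    by_cases h' : i < b + m + m
    · obtain ⟨j, rfl⟩ := Nat.exists_eq_add_of_le (not_lt.mp h)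
      rw [place_add (by omega)]
    · rw [place_ge (by omega), place_ge (by omega), place_ge (by omega), h5 i (by omega)]

end Compiles

end Host

end PolylogTM

namespace PolylogTM

/-! ### Compilation of bounded recursion -/

namespace Host

open Function

variable {E : Type} {H : Host E} {size : E → ℕ} {ι : Type}

theorem update_place_lt {s : ℕ → List Bool} {b m i : ℕ} {v : ℕ → List Bool} {x : List Bool}
    (h : i < b) : update (place s b m v) i x = place (update s i x) b m v := by
  funext j
  by_cases hj : j = i
  · subst hj
    rw [place_lt h, update_self, update_self]
  · rw [update_of_ne hj]
    simp only [place, update_of_ne hj]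

namespace Compiles

/-- The string that controls the recursion lies on `base` and is consumed by popping, which meets
its bits in the order of `foldl`. The accumulators follow from `base + 1` on, and `dst` is written
only when the arguments are no longer needed. -/
theorem fold {κ : Type} [Finite κ] {X : Fn E ι} {I : κ → Fn E ι} (G : Bool → κ → Fn E (κ ⊕ ι))
    (k : κ) (hX : Compiles H size X) (hXl : ∃ d, LenBdd size X d)
    (hI : ∀ j, Compiles H size (I j)) (hIl : ∃ d, ∀ j, LenBdd size (I j) d)
    (hG : ∀ b j, Compiles H size (G b j))
    (hgrow : ∃ d, ∀ N e s, size e ≤ N → (∀ i, (s i).length ≤ N) → ∀ b M a,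
      (∀ j, (a j).length ≤ M) → ∀ j, (G b j e (Sum.elim a s)).length ≤ M + (N + 2) ^ d) :
    Compiles H size fun e s =>
      (X e s).foldl (fun a b j => G b j e (Sum.elim a s)) (fun j => I j e s) k := by
  obtain ⟨m, ⟨f⟩⟩ := Finite.exists_equiv_fin κ
  obtain ⟨dX, hX⟩ := hX
  obtain ⟨dXl, hXl⟩ := hXl
  obtain ⟨dI, hI⟩ := many (G := extend f (fun _ _ => []) I) (extend_induction f nil hI) m
  obtain ⟨dIl, hIl⟩ := hIl
  obtain ⟨dG, hG⟩ := exists_uniform_pow (κ := Bool)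
    (P := fun c d => ∀ (loc : ι → ℕ) (b : ℕ), (∀ i, loc i < b) →
      ∃ p : H.Prog, ∀ N e (s : ℕ → List Bool) (a : ℕ → List Bool), size e ≤ N →
        (∀ i, (s (loc i)).length ≤ N) → (∀ j < m, (a j).length ≤ N) →
        (∀ k, (G c k e (Sum.elim (fun k => a (f k)) fun i => s (loc i))).length ≤ N) →
        (∀ j ≥ b, s j = []) →
        Runs e p (work (place s b m a)) (work (place s b m
          (extend f [] fun k => G c k e (Sum.elim (fun k => a (f k)) fun i => s (loc i)))))
          ((N + 2) ^ d))
    (fun c d d' h H loc b hl => (H loc b hl).imp fun p hp N e s a h1 h2 h3 h4 h5 =>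
      (hp N e s a h1 h2 h3 h4 h5).mono (PolyBdd.pow_le h N)) fun c => body f (hG c)
  obtain ⟨dg, hgrow⟩ := hgrow
  obtain ⟨dv, hv⟩ := var (H := H) (size := size) (ι := Unit) ()
  obtain ⟨dc, hc⟩ := exists_clearMany H size m
  -- A bound for all lengths throughout the loop: the parameters, the initial accumulators, and the
  -- number of rounds times the growth per round.
  let B : ℕ → ℕ := fun N => N + (N + 2) ^ dIl + (N + 2) ^ dXl * (N + 2) ^ dg
  obtain ⟨d, hd⟩ : ∃ d, ∀ N, (N + 2) ^ dX + ((N + 2) ^ dI + (((N + 2) ^ dXl * ((B N + 2) ^ dG + 2) + 2)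
      + ((B N + 2) ^ dv + (B N + 2) ^ dc + 1) + 1) + 1) + 1 ≤ (N + 2) ^ d :=
    have hB : PolyBdd B := (PolyBdd.id.add (.pow_self dIl)).add ((PolyBdd.pow_self dXl).mul
      (.pow_self dg))
    ((PolyBdd.pow_self dX).add (((PolyBdd.pow_self dI).add (((((PolyBdd.pow_self dXl).mul
      ((hB.comp_pow dG).add (.const 2))).add (.const 2)).add (((hB.comp_pow dv).add
      (hB.comp_pow dc)).add (.const 1))).add (.const 1))).add (.const 1))).add (.const 1)
  refine ⟨d, fun loc dst base hloc hdst => ?_⟩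
  obtain ⟨pX, hpX⟩ := hX loc base (base + 1) (fun i => (hloc i).trans (by omega)) (by omega)
  obtain ⟨pI, hpI⟩ := hI loc (base + 1) (base + 1 + m) (fun i => (hloc i).trans (by omega))
    (fun i => .inl ((hloc i).trans (by omega))) le_rfl
  choose pG hpG using fun c => hG c loc (base + 1) fun i => (hloc i).trans (by omega)
  have hfk := (f k).2
  obtain ⟨pv, hpv⟩ := hv (fun _ => base + 1 + f k) dst (base + 1 + m) (fun _ => by omega) (by omega)
  obtain ⟨pc, hpc⟩ := hc (base + 1) (base + 1 + m) le_rfl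
  refine ⟨.seq pX (.seq pI (.seq (.loop (.pop (.inr base)) pG) (.seq pv pc))),
    fun N e s h1 h2 h3 h4 => ?_⟩
  set c : ι → List Bool := fun i => s (loc i) with hc'
  have hs : ∀ (l : List Bool) i, update s base l (loc i) = s (loc i) := fun l i =>
    update_of_ne (hloc i).ne _ _
  have hsb : update s base [] = s := by rw [← h4 base le_rfl, update_eq_self]
  have hNB : N ≤ B N := by simp only [B]; omega
  -- The invariant says that the current lengths plus the growth still to come stay below `B N`, so
  -- each round has the same cost bound.
  have iter : ∀ (l : List Bool) (a : κ → List Bool) (M : ℕ), (∀ j, (a j).length ≤ M) →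
      M + l.length * (N + 2) ^ dg ≤ B N →
      Runs e (.loop (.pop (.inr base)) pG)
        (work (place (update s base l) (base + 1) m (extend f [] a)))
        (work (place s (base + 1) m
          (extend f [] (l.foldl (fun a b j => G b j e (Sum.elim a c)) a))))
        (l.length * ((B N + 2) ^ dG + 2) + 2) := by
    intro l
    induction l with
    | nil =>
      intro a M ha hM
      refine (Runs.exit (s' := work (place s (base + 1) m (extend f [] a))) ?_).mono (by simp)
      rw [exec_work_pop, place_lt (by omega), update_self, update_place_lt (by omega), update_idem]
      simp [hsb]
    | cons b l ih =>
      intro a M ha hM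
      rw [List.length_cons, Nat.succ_mul] at hM
      have hg := hgrow N e c h1 h2 b M a ha
      have hpop : H.exec e (.pop (.inr base))
          (work (place (update s base (b :: l)) (base + 1) m (extend f [] a))) =
          (some b, work (place (update s base l) (base + 1) m (extend f [] a))) := by
        rw [exec_work_pop, place_lt (by omega), update_self, update_place_lt (by omega),
          update_idem]
        rfl
      have hbody := hpG b (B N) e (update s base l) (extend f [] a) (h1.trans hNB)
        (fun i => by rw [hs]; exact (h2 i).trans hNB)
        (fun j _ => extend_induction (P := fun l : List Bool => l.length ≤ B N) f (Nat.zero_le _)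
          (fun k => (ha k).trans (by omega)) j)
        (fun k => by
          simp only [extend_apply, hs]
          exact (hg k).trans (by omega))
        (fun j hj => by rw [update_of_ne (by omega), h4 j (by omega)])
      simp only [extend_apply, hs] at hbody
      refine (Runs.iter hpop hbody (ih _ (M + (N + 2) ^ dg) hg (by omega))).congr rfl ?_
      rw [List.length_cons]
      ring_nf
      omega
  have a := hpX N e s h1 h2 (by rw [h4 base le_rfl]; exact Nat.zero_le _)
    fun j hj => h4 j (by omega)
  have b := hpI N e (update s base (X e c)) h1 (fun i => by rw [hs]; exact h2 i)
    (fun j hj => by rw [update_of_ne (by omega), h4 _ (by omega)]; exact Nat.zero_le _)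
    (fun j hj => by rw [update_of_ne (by omega), h4 _ (by omega)])
  simp only [extend_fn, hs] at b
  have hxl : (X e c).length ≤ (N + 2) ^ dXl := hXl N e c h1 h2
  have hIc : ∀ j, (I j e c).length ≤ (N + 2) ^ dIl := fun j => hIl j N e c h1 h2
  have hBM : (N + 2) ^ dIl + (X e c).length * (N + 2) ^ dg ≤ B N := by
    have := Nat.mul_le_mul_right ((N + 2) ^ dg) hxl
    simp only [B]
    omega
  have l := iter (X e c) (fun j => I j e c) ((N + 2) ^ dIl) hIc hBM
  set r := (X e c).foldl (fun a b j => G b j e (Sum.elim a c)) (fun j => I j e c) with hr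
  have hrl : ∀ j, (r j).length ≤ B N := fun j =>
    (foldl_length_le (fun b a j => G b j e (Sum.elim a c)) _ (fun b M a => hgrow N e c h1 h2 b M a)
      (X e c) _ _ hIc j).trans hBM
  have hel : ∀ j, (extend f [] r j).length ≤ B N := extend_induction
    (P := fun l : List Bool => l.length ≤ B N) f (Nat.zero_le _) hrl
  have v := hpv (B N) e (place s (base + 1) m (extend f [] r)) (h1.trans hNB)
    (fun _ => by rw [place_add (f k).2]; exact hel _)
    (by rw [place_lt (by omega)]; exact h3.trans hNB)
    (fun j hj => by rw [place_ge (by omega), h4 j (by omega)])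
  simp only [place_add (f k).2, extend_apply] at v
  rw [update_place_lt (by omega)] at v
  have w := hpc (B N) e (place (update s dst (r k)) (base + 1) m (extend f [] r)) (h1.trans hNB)
    (fun j hj => by rw [place_add hj]; exact hel _)
    (fun j hj => by rw [place_ge (by omega), update_of_ne (by omega), h4 j (by omega)])
  refine (a.seq (b.seq (l.seq (v.seq w)))).congr ?_ (le_trans ?_ (hd N))
  · congr 1
    funext i
    by_cases h : i < base + 1
    · rw [place_lt h, place_lt h]
    · rw [update_of_ne (by omega), h4 i (by omega)]
      by_cases h' : i < base + 1 + m
      · obtain ⟨j, rfl⟩ := Nat.exists_eq_add_of_le (not_lt.mp h)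
        rw [place_add (by omega)]
      · rw [place_ge (by omega), place_ge (by omega), update_of_ne (by omega), h4 i (by omega)]
  · have := Nat.mul_le_mul_right ((B N + 2) ^ dG + 2) hxl
    omega

end Compiles

/-- Functions that are generated from oracles which can be compiled can be compiled. -/
theorem compiles_of_cob {O : Oracles E} (hO : O.Short size) (h : ∀ o, Compiles H size (O.val o))
    {F : Fn E ι} (hF : Cob size O F) : Compiles H size F := by
  induction hF with
  | var i => exact .var i
  | nil => exact .nil
  | cons b _ ih => exact ih.cons b
  | tail _ ih => exact ih.tail
  | case G hF _ ih ih' => exact .case G ih (hF.len hO) ih'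
  | oracle o => exact h o
  | comp _ hG ih ih' => exact .comp ih ih' (LenBdd.uniform fun j => (hG j).len hO)
  | fold G k hX hI _ hg ihX ihI ihG =>
    exact .fold G k ihX (hX.len hO) ihI (LenBdd.uniform fun j => (hI j).len hO) ihG hg

end Host

end PolylogTM

namespace PolylogTM

/-! ## Numbers in binary -/

/-- The number with the given binary digits, least significant digit first. -/
def num : List Bool → ℕ
  | [] => 0
  | b :: l => b.toNat + 2 * num l

section Computation

variable {Γ : Type} {step : Γ → Option Γ} {c₀ : Γ} {acc : Set Γ}

theorem configAt_add (m n : ℕ) :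
    configAt step c₀ (m + n) = (configAt step c₀ m).bind fun c => configAt step c n := by
  induction n with
  | zero => cases configAt step c₀ m <;> simp [configAt]
  | succ n ih =>
    rw [← Nat.add_assoc, configAt, ih]
    cases configAt step c₀ m <;> simp [configAt]

theorem configAt_trans {c c' : Γ} {m n : ℕ} (h : configAt step c₀ m = some c)
    (h' : configAt step c n = some c') : configAt step c₀ (m + n) = some c' := by
  rw [configAt_add, h, Option.bind_some, h']

theorem configAt_one : configAt step c₀ 1 = step c₀ := rfl

theorem configAt_of_lt {c : Γ} {t t' : ℕ} (h : configAt step c₀ t = some c) (hc : step c = none)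
    (ht : t < t') : configAt step c₀ t' = none := by
  obtain ⟨k, rfl⟩ := Nat.exists_eq_add_of_lt ht
  rw [Nat.add_assoc, configAt_add, h, Option.bind_some, Nat.add_comm k, configAt_add, configAt_one,
    hc, Option.bind_none]

/-- A machine that stops as soon as it accepts accepts iff it stops in an accepting
configuration. -/
theorem reachesAccepting_iff (hacc : ∀ c ∈ acc, step c = none) {c : Γ} {t : ℕ}
    (h : configAt step c₀ t = some c) (hc : step c = none) :
    ReachesAccepting step c₀ acc ↔ c ∈ acc := by
  refine ⟨fun ⟨t', c', h', hc'⟩ => ?_, fun hc' => ⟨t, c, h, hc'⟩⟩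
  rw [Option.mem_def] at h'
  rcases lt_trichotomy t t' with ht | rfl | ht
  · rw [configAt_of_lt h hc ht] at h'
    cases h'
  · rw [h, Option.some_inj] at h'
    rwa [h']
  · rw [configAt_of_lt h' (hacc c' hc') ht] at h
    cases h

end Computation

/-! ### Execution of a program by a finite control -/

namespace Host

variable {E : Type} {H : Host E}

namespace Prog

variable (H) in
/-- What to do next when a list of programs is to be executed. -/
inductive View
  | halt
  | acc
  | jump (k : List H.Prog)
  | op (a : H.Op) (next : Option Bool → List H.Prog)

/-- The first step in the execution of a list of programs. -/
def view : List H.Prog → View H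
  | [] => .halt
  | .skip :: k => .jump k
  | .acc :: _ => .acc
  | .case a f :: k => .op a fun o => f o :: k
  | .seq p q :: k => .jump (p :: q :: k)
  | .loop a f :: k => .op a fun o => o.elim k fun b => f b :: .loop a f :: k

/-- The lists of programs that can remain after one step. -/
def succs (c : List H.Prog) : Set (List H.Prog) :=
  match view c with
  | .halt => ∅
  | .acc => ∅
  | .jump k => {k}
  | .op _ next => Set.range next

/-- The lists of programs that occur in the execution of `p` followed by `k`, up to the end of `p`.
-/
def conts : H.Prog → List H.Prog → Set (List H.Prog)
  | .skip, k => {.skip :: k}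
  | .acc, k => {.acc :: k}
  | .case a f, k => {.case a f :: k} ∪ ⋃ o, conts (f o) k
  | .seq p q, k => {.seq p q :: k} ∪ (conts p (q :: k) ∪ conts q k)
  | .loop a f, k => {.loop a f :: k} ∪ ⋃ b, conts (f b) (.loop a f :: k)

/-- A loop reappears unchanged below its body instead of being unfolded, so structural recursion
collects all remainders. Their finiteness makes them usable as states of a machine. -/
theorem finite_conts (p : H.Prog) (k : List H.Prog) : (conts p k).Finite := by
  induction p generalizing k with
  | skip => exact Set.finite_singleton _
  | acc => exact Set.finite_singleton _
  | case a f ih => exact (Set.finite_singleton _).union (Set.finite_iUnion fun o => ih o k)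
  | seq p q ih ih' => exact (Set.finite_singleton _).union ((ih _).union (ih' k))
  | loop a f ih => exact (Set.finite_singleton _).union (Set.finite_iUnion fun b => ih b _)

theorem self_mem_conts (p : H.Prog) (k : List H.Prog) : p :: k ∈ conts p k := by
  cases p <;> simp [conts]

/-- Execution never leaves the finite set of remainders of `p` except by reaching what comes after
`p`. -/
theorem succs_conts (p : H.Prog) (k : List H.Prog) {c c' : List H.Prog} (hc : c ∈ conts p k)
    (hc' : c' ∈ succs c) : c' ∈ conts p k ∨ c' = k := by
  induction p generalizing k with
  | skip =>
    rw [conts, Set.mem_singleton_iff] at hc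
    subst hc
    exact .inr hc'
  | acc =>
    rw [conts, Set.mem_singleton_iff] at hc
    subst hc
    exact hc'.elim
  | case a f ih =>
    rcases hc with hc | hc
    · rw [Set.mem_singleton_iff] at hc
      subst hc
      obtain ⟨o, rfl⟩ := hc'
      exact .inl (.inr (Set.mem_iUnion.mpr ⟨o, self_mem_conts _ _⟩))
    · obtain ⟨o, ho⟩ := Set.mem_iUnion.mp hc
      exact (ih o k ho).imp_left fun h => .inr (Set.mem_iUnion.mpr ⟨o, h⟩)
  | seq p q ih ih' =>
    rcases hc with hc | hc | hc
    · rw [Set.mem_singleton_iff] at hc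
      subst hc
      rw [show c' = p :: q :: k from hc']
      exact .inl (.inr (.inl (self_mem_conts _ _)))
    · rcases ih _ hc with h | rfl
      · exact .inl (.inr (.inl h))
      · exact .inl (.inr (.inr (self_mem_conts _ _)))
    · exact (ih' _ hc).imp_left fun h => .inr (.inr h)
  | loop a f ih =>
    rcases hc with hc | hc
    · rw [Set.mem_singleton_iff] at hc
      subst hc
      obtain ⟨o, rfl⟩ := hc'
      rcases o with _ | b
      · exact .inr rfl
      · exact .inl (.inr (Set.mem_iUnion.mpr ⟨b, self_mem_conts _ _⟩))
    · obtain ⟨b, hb⟩ := Set.mem_iUnion.mp hc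
      rcases ih b _ hb with h | rfl
      · exact .inl (.inr (Set.mem_iUnion.mpr ⟨b, h⟩))
      · exact .inl (self_mem_conts _ _)

/-- The lists of programs that occur in the execution of `p`. -/
def reach (p : H.Prog) : Set (List H.Prog) := insert [] (conts p [])

theorem finite_reach (p : H.Prog) : (reach p).Finite := (finite_conts p []).insert _

theorem self_mem_reach (p : H.Prog) : [p] ∈ reach p := .inr (self_mem_conts p [])

theorem succs_reach (p : H.Prog) {c c' : List H.Prog} (hc : c ∈ reach p) (hc' : c' ∈ succs c) :
    c' ∈ reach p := by
  rcases hc with rfl | hc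
  · exact hc'.elim
  · exact (succs_conts p [] hc hc').elim .inr fun h => .inl h

theorem jump_mem_reach {p : H.Prog} {c k : List H.Prog} (hc : c ∈ reach p)
    (h : view c = .jump k) : k ∈ reach p :=
  succs_reach p hc (by rw [succs, h]; rfl)

theorem next_mem_reach {p : H.Prog} {c : List H.Prog} {a : H.Op}
    {next : Option Bool → List H.Prog} (hc : c ∈ reach p) (h : view c = .op a next)
    (o : Option Bool) : next o ∈ reach p :=
  succs_reach p hc (by rw [succs, h]; exact ⟨o, rfl⟩)

/-- The program that runs `p` and accepts iff there is a `true` on top of the first work stack. -/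
def decider (p : H.Prog) : H.Prog :=
  .seq p (.case (.pop (.inr 0)) fun o => if o = some true then .acc else .skip)

/-- The work stacks that occur in the execution of a program are among finitely many. -/
theorem exists_stack_bound (p : H.Prog) : ∃ K, ∀ c ∈ reach p, ∀ a next, view c = .op a next →
    (∀ i b, a = .push (.inr i) b → i ≤ K) ∧ ∀ i, a = .pop (.inr i) → i ≤ K := by
  let g : List H.Prog → ℕ := fun c => match view c with
    | .op (.push (.inr i) _) _ => i
    | .op (.pop (.inr i)) _ => i
    | _ => 0
  obtain ⟨K, hK⟩ := ((finite_reach p).image g).bddAbove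
  refine ⟨K, fun c hc a next h => ⟨?_, ?_⟩⟩
  · rintro i b rfl
    have := hK ⟨c, hc, rfl⟩
    simpa only [g, h] using this
  · rintro i rfl
    have := hK ⟨c, hc, rfl⟩
    simpa only [g, h] using this

end Prog

open Prog

/-- The machine with transition function `step` executes the program `p`. -/
structure Implements (e : E) (p : H.Prog) {Γ : Type} (step : Γ → Option Γ) (c₀ : Γ) (acc : Set Γ)
    (enc : List H.Prog → H.State → Γ) : Prop where
  init : step c₀ = some (enc [p] (work fun _ => []))
  jump {c k s} : c ∈ reach p → view c = .jump k → step (enc c s) = some (enc k s)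
  op {c a next s} : c ∈ reach p → view c = .op a next →
    configAt step (enc c s) 2 = some (enc (next (H.exec e a s).1) (H.exec e a s).2)
  halt {s} : step (enc [] s) = none
  mem_acc {c s} : c ∈ reach p → (enc c s ∈ acc ↔ view c = .acc)
  acc_halts : ∀ c ∈ acc, step c = none

namespace Implements

variable {e : E} {p q : H.Prog} {Γ : Type} {step : Γ → Option Γ} {c₀ : Γ} {acc : Set Γ}
  {enc : List H.Prog → H.State → Γ}

/-- The costs in `Exec` are exact step counts: two steps for an instruction, one for a jump. -/
theorem run (h : Implements e p step c₀ acc enc) {s s' : H.State} {t : ℕ}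
    (hr : Exec e q s s' t) (k : List H.Prog) (hk : q :: k ∈ reach p) :
    configAt step (enc (q :: k) s) t = some (enc k s') ∧ k ∈ reach p := by
  induction hr generalizing k with
  | skip => exact ⟨h.jump hk rfl, jump_mem_reach hk rfl⟩
  | case _ ih =>
    obtain ⟨h1, h2⟩ := ih k (next_mem_reach hk rfl _)
    refine ⟨?_, h2⟩
    rw [Nat.add_comm]
    exact configAt_trans (h.op hk rfl) h1
  | seq _ _ ih ih' =>
    obtain ⟨h1, h2⟩ := ih _ (jump_mem_reach hk rfl)
    obtain ⟨h3, h4⟩ := ih' _ h2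
    refine ⟨?_, h4⟩
    rw [Nat.add_comm]
    exact configAt_trans (h.jump hk rfl) (configAt_trans h1 h3)
  | @exit a f s ha =>
    have h1 := h.op (s := s) hk rfl
    have h2 := next_mem_reach hk rfl none
    rw [ha] at h1
    exact ⟨h1, h2⟩
  | @iter a f s b s' s'' t t' ha _ _ ih ih' =>
    have h0 := h.op (s := s) hk rfl
    rw [ha] at h0
    obtain ⟨h1, h2⟩ := ih _ (next_mem_reach hk rfl (some b))
    obtain ⟨h3, h4⟩ := ih' _ h2
    refine ⟨?_, h4⟩
    rw [Nat.add_comm]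
    exact configAt_trans h0 (configAt_trans h1 h3)

/-- Besides the run of `p` there are at most five steps: the initial one, the entry into the
sequence, two for the final pop, and one more to stop when the answer is negative. -/
theorem decides (h : Implements e (decider p) step c₀ acc enc) {s : ℕ → List Bool} {T : ℕ}
    (hr : Runs e p (work fun _ => []) (work s) T) :
    (ReachesAccepting step c₀ acc ↔ (s 0).head? = some true) ∧
      FinishesWithin step c₀ acc (T + 5) := by
  obtain ⟨t, ht, hr⟩ := hr
  have m0 := self_mem_reach (decider p)
  have h0 : configAt step c₀ 1 = _ := h.init
  have h1 : configAt step _ 1 = _ := h.jump (s := work fun _ => []) m0 rfl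
  obtain ⟨h2, m2⟩ := h.run hr _ (jump_mem_reach m0 rfl)
  have h3 := h.op (s := work s) m2 rfl
  have m3 := next_mem_reach m2 rfl (s 0).head?
  rw [exec_work_pop] at h3
  have h4 := configAt_trans h0 (configAt_trans h1 (configAt_trans h2 h3))
  by_cases hs : (s 0).head? = some true
  · simp only [hs, if_true] at h4 m3
    have hacc := (h.mem_acc (s := work (Function.update s 0 (s 0).tail)) m3).mpr rfl
    refine ⟨?_, _, ?_, _, h4, .inl hacc⟩
    · rw [reachesAccepting_iff h.acc_halts h4 (h.acc_halts _ hacc)]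
      simp [hs, hacc]
    · omega
  · simp only [hs, if_false] at h4 m3
    have h5 : configAt step _ 1 = _ := h.jump (s := work (Function.update s 0 (s 0).tail)) m3 rfl
    have h6 := configAt_trans h4 h5
    refine ⟨?_, _, ?_, _, h6, .inr h.halt⟩
    · rw [reachesAccepting_iff h.acc_halts h6 h.halt, h.mem_acc (jump_mem_reach m3 rfl)]
      simp [hs, view]
    · omega

end Implements

end Host

/-! ## Stacks on tapes -/

/-- The bit that a symbol stands for. -/
def Sym.toBit : Sym → Option Bool
  | .zero => some false
  | .one => some true
  | .blank => none

@[simp]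
theorem Sym.toBit_ofBool (b : Bool) : (Sym.ofBool b).toBit = some b := by cases b <;> rfl

namespace Tape

theorem write_read (t : Tape) : t.write t.read = t := by
  cases t
  simp [write, read]

theorem contents_length (l : List Bool) : contents l l.length = .blank := by simp [contents]

theorem contents_lt {l : List Bool} {i : ℕ} (h : i < l.length) :
    contents l i = Sym.ofBool l[i] := by simp [contents, h]

theorem num_foldl (l : List Bool) (v : List Bool) :
    (l.map Sym.ofBool).foldl (fun v a => 2 * v + if a = Sym.one then 1 else 0) (num v) =
      num (l.reverse ++ v) := by
  induction l generalizing v with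
  | nil => rfl
  | cons b l ih =>
    rw [List.map_cons, List.foldl_cons, List.reverse_cons, List.append_assoc,
      List.singleton_append, ← ih (b :: v)]
    congr 1
    cases b <;> simp [num, Sym.ofBool, Nat.add_comm]

theorem number_eq {t : Tape} {l : List Bool}
    (h : ∀ (i : ℕ) (hi : i < l.length), t.cells i = Sym.ofBool l[i])
    (hl : t.cells l.length = .blank) : t.number = num l.reverse := by
  have hf : t.firstBlank = l.length := by
    refine le_antisymm (Nat.sInf_le hl) (le_csInf ⟨_, hl⟩ fun i hi => ?_)
    by_contra hlt
    have := h i (not_le.mp hlt)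
    rw [show t.cells i = .blank from hi] at this
    cases hb : l[i]'(not_le.mp hlt) <;> rw [hb] at this <;> cases this
  have hm : (List.range t.firstBlank).map t.cells = l.map Sym.ofBool := by
    rw [hf]
    refine List.ext_getElem (by simp) fun i h1 h2 => ?_
    simp only [List.length_map] at h2
    simp [h i h2]
  have := num_foldl l []
  rw [List.append_nil] at this
  rw [number, hm, ← this]
  rfl

/-- The tape that holds a stack, with the head on the cell behind the top of the stack. -/
def stack (l : List Bool) : Tape := ⟨contents l.reverse, l.length⟩

/-- The bottom of the stack is in the leftmost cell, which is the most significant digit; hence the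
top of the stack is the least significant one, the order of `num`. -/
theorem number_of_cells {t : Tape} {l : List Bool} (h : t.cells = contents l.reverse) :
    t.number = num l := by
  rw [number_eq (l := l.reverse) (fun i hi => by rw [h, contents_lt hi])
    (by rw [h, contents_length]), List.reverse_reverse]

theorem contents_append_singleton (l : List Bool) (b : Bool) :
    contents (l ++ [b]) = Function.update (contents l) l.length (Sym.ofBool b) := by
  funext i
  rcases lt_trichotomy i l.length with h | rfl | h
  · rw [Function.update_of_ne h.ne, contents_lt h, contents_lt (by simp; omega)]
    simp [List.getElem_append_left h]
  · simp [contents]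
  · rw [Function.update_of_ne h.ne']
    simp only [contents]
    rw [List.getElem?_eq_none (by simp; omega), List.getElem?_eq_none h.le]

theorem stack_push (l : List Bool) (b : Bool) :
    ((stack l).write (Sym.ofBool b)).move .right = stack (b :: l) := by
  simp [write, move, stack, contents_append_singleton]

theorem stack_pop_read (l : List Bool) : ((stack l).move .left).read.toBit = l.head? := by
  cases l with
  | nil => rfl
  | cons b l => simp [read, move, stack, contents]

theorem stack_pop (l : List Bool) :
    (((stack l).move .left).write .blank).move .stay = stack l.tail := by
  cases l with
  -- On an empty stack the head cannot move left, and a blank is written over a blank: popping has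
  -- no effect.
  | nil => simpa [read, stack, contents, move] using write_read (stack [])
  | cons b l =>
    simp only [write, move, stack, List.reverse_cons, contents_append_singleton,
      List.length_cons, List.tail_cons, Nat.add_sub_cancel, List.length_reverse]
    rw [Function.update_idem]
    congr 1
    refine Function.update_eq_iff.mpr ⟨?_, fun _ _ => rfl⟩
    rw [← List.length_reverse, contents_length]

end Tape

/-! ### Instructions as pairs of machine steps -/

namespace Host

variable {E : Type} {H : Host E}

open Classical in
/-- The symbol to write and the move on the tape that holds the stack `k` when the instruction `a`
is executed in two steps, the first one of which prepares the head. -/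
noncomputable def Op.act : H.Op → Bool → H.Stack → Sym → Sym × Dir
  | .push k' b, true, k, r => if k = k' then (.ofBool b, .right) else (r, .stay)
  | .pop k', false, k, r => if k = k' then (r, .left) else (r, .stay)
  | .pop k', true, k, r => if k = k' then (.blank, .stay) else (r, .stay)
  | _, _, _, r => (r, .stay)

/-- A tape after a symbol has been written and the head has moved. -/
def _root_.PolylogTM.Tape.put (t : Tape) (a : Sym × Dir) : Tape := (t.write a.1).move a.2

theorem _root_.PolylogTM.Tape.put_read (t : Tape) (d : Dir) : t.put (t.read, d) = t.move d := by
  rw [Tape.put, Tape.write_read]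

/-- The preparing step moves heads but changes no contents, so the numbers on the address-tapes, and
with them the answers seen in the second step, are those of the state before the instruction. -/
theorem Op.act_cells (a : H.Op) (k : H.Stack) (t : Tape) :
    (t.put (a.act false k t.read)).cells = t.cells := by
  rcases a with ⟨k', b⟩ | k' | h | h | a <;> simp only [act, Tape.put_read, Tape.move]
  split <;> simp only [Tape.put_read, Tape.move]

theorem Op.act_act (e : E) (a : H.Op) (s : H.State) (k : H.Stack) :
    ((Tape.stack (s.stk k)).put (a.act false k (Tape.stack (s.stk k)).read)).put
      (a.act true k ((Tape.stack (s.stk k)).put (a.act false k (Tape.stack (s.stk k)).read)).read) =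
      Tape.stack ((H.exec e a s).2.stk k) := by
  rcases a with ⟨k', b⟩ | k' | h | h | a
  · by_cases hk : k = k'
    · subst hk
      simp only [act, exec, Tape.put_read, Tape.move, if_pos, Function.update_self]
      exact Tape.stack_push _ _
    · simp only [act, exec, Tape.put_read, Tape.move, if_false, ne_eq, hk, not_false_eq_true,
        Function.update_of_ne]
  · by_cases hk : k = k'
    · subst hk
      simp only [act, exec, Tape.put_read, if_pos, Function.update_self]
      exact Tape.stack_pop _
    · simp only [act, exec, Tape.put_read, Tape.move, if_false, ne_eq, hk, not_false_eq_true,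
        Function.update_of_ne]
  all_goals simp only [act, exec, Tape.put_read, Tape.move]

theorem Op.act_pop (s : H.State) (k : H.Stack) :
    ((Tape.stack (s.stk k)).put ((Op.pop k).act false k (Tape.stack (s.stk k)).read)).read.toBit =
      (s.stk k).head? := by
  simp only [act, if_pos, Tape.put_read]
  exact Tape.stack_pop_read _

end Host

end PolylogTM

namespace PolylogTM

open Host Host.Prog

/-! ## Programs on random-access machines -/

section RandomAccess

variable {σ : Vocabulary}

/-- The resources of a random-access machine: the address stack is the only special stack. -/
noncomputable def raHost (σ : Vocabulary) : Host (OrderedStructure σ) where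
  Addr := Unit
  Head := Empty
  Ask := Unit
  answer A addr _ _ := A.bin[num (addr ())]?

/-- The state with a given list of programs. -/
noncomputable def toReach {E : Type} {H : Host E} (p : H.Prog) (c : List H.Prog) :
    {c // c ∈ reach p} :=
  open Classical in if h : c ∈ reach p then ⟨c, h⟩ else ⟨[p], self_mem_reach p⟩

theorem toReach_val {E : Type} {H : Host E} {p : H.Prog} {c : List H.Prog} (h : c ∈ reach p) :
    (toReach p c).1 = c := by rw [toReach, dif_pos h]

instance {E : Type} {H : Host E} (p : H.Prog) : Finite {c // c ∈ reach p} :=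
  (finite_reach p).to_subtype

/-- The stack that is held on a tape of a random-access machine. -/
def raStack {m : ℕ} (l : Fin (m + 1)) : (raHost σ).Stack :=
  Fin.cases (.inl ()) (fun i => .inr (i : ℕ)) l

/-- The tape of a random-access machine that holds a stack. -/
def raTape (m : ℕ) : (raHost σ).Stack → Fin (m + 1)
  | .inl _ => 0
  | .inr i => Fin.ofNat (m + 1) (i + 1)

/-- The result of an instruction in terms of the scanned symbols. -/
def raResult {m : ℕ} (o : Option Sym) (r : Fin (m + 1) → Sym) : (raHost σ).Op → Option Bool
  | .pop k => (r (raTape m k)).toBit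
  | .ask _ => o.bind Sym.toBit
  | _ => none

/-- The random-access machine that executes the program `p` with `K + 1` work-tapes. In a state
`some (c, b)` the list of programs `c` remains to be executed, and `b` tells whether the first of
the two steps of an instruction is done; the state `none` is used in the first step only. -/
noncomputable def raMachine (p : (raHost σ).Prog) (K : ℕ) : RandomAccessTM where
  Q := Option ({c // c ∈ reach p} × Bool)
  k := K + 1
  k_pos := K.succ_pos
  start := none
  accept := {q | ∃ c, q = some c ∧ view c.1.1 = .acc}
  δ
    | none, _, r => some (some (toReach p [p], false),
        fun l => if l = 0 then (.blank, .stay) else (r l, .stay))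
    | some (c, late), o, r =>
      match view c.1 with
      | .halt => none
      | .acc => none
      | .jump k => some (some (toReach p k, false), fun l => (r l, .stay))
      | .op a next =>
        some (bif late then some (toReach p (next (raResult o r a)), false) else some (c, true),
          fun l => a.act late (raStack l) (r l))

variable (p : (raHost σ).Prog) (K : ℕ)

/-- The configuration with a list of programs and a state of the stacks. -/
noncomputable def raConfig (c : List (raHost σ).Prog) (s : (raHost σ).State) :
    (raMachine p K).Config :=
  ⟨some (toReach p c, false), fun l => Tape.stack (s.stk (raStack l))⟩

/-- The numbering of tapes wraps around at the number of work-tapes, so the round trip is correct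
only for the stacks that really occur. -/
theorem raStack_raTape {m : ℕ} {k : (raHost σ).Stack} (h : ∀ i, k = .inr i → i < m) :
    raStack (raTape m k) = k := by
  rcases k with k | i
  · rfl
  · have hi := h i rfl
    have : Fin.ofNat (m + 1) (i + 1) = Fin.succ ⟨i, hi⟩ := by
      ext
      simp [Nat.mod_eq_of_lt (show i + 1 < m + 1 by omega)]
    simp only [raTape, this, raStack, Fin.cases_succ]

/-- The address-tape of a random-access machine starts with a written 0; the extra starting state
erases it to obtain an empty stack. -/
theorem Tape.init_put_blank (b : Bool) : (Tape.init [b]).put (.blank, .stay) = Tape.stack [] := by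
  simp only [Tape.put, Tape.write, Tape.move, Tape.stack, Tape.init]
  congr 1
  funext i
  rcases i with _ | i <;> simp [Tape.contents]

theorem Sym.ofBool_bind_toBit (o : Option Bool) : (o.map Sym.ofBool).bind Sym.toBit = o := by
  cases o <;> simp

theorem raMachine_implements (hK : ∀ c ∈ reach p, ∀ a next, view c = .op a next →
    (∀ i b, a = .push (.inr i) b → i ≤ K) ∧ ∀ i, a = .pop (.inr i) → i ≤ K)
    (A : OrderedStructure σ) :
    Implements A p ((raMachine p K).step A.bin) (raMachine p K).initial
      (raMachine p K).accepting (raConfig p K) where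
  init := by
    simp only [RandomAccessTM.step, raMachine, RandomAccessTM.initial, Option.map_some,
      Option.some_inj, raConfig]
    congr 1
    funext l
    refine Fin.cases ?_ (fun i => ?_) l
    · exact Tape.init_put_blank false
    · simp only [Fin.succ_ne_zero, if_false, raStack, Fin.cases_succ, work, Sum.elim_inr]
      rw [Tape.write_read]
      rfl
  jump {c k s} hc h := by
    simp only [RandomAccessTM.step, raMachine, raConfig, toReach_val hc, h, Option.map_some,
      Option.some_inj]
    congr 1
    funext l
    rw [Tape.write_read]
    rfl
  op {c a next s} hc h := by
    have h1 : (raMachine p K).step A.bin (raConfig p K c s) = some ⟨some (toReach p c, true),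
        fun l => (Tape.stack (s.stk (raStack l))).put
          (a.act false (raStack l) (Tape.stack (s.stk (raStack l))).read)⟩ := by
      simp only [RandomAccessTM.step, raMachine, raConfig, toReach_val hc, h, Option.map_some,
        cond_false]
      rfl
    have hnum : ((Tape.stack (s.stk (raStack (0 : Fin (K + 2))))).put
        (a.act false (raStack (0 : Fin (K + 2)))
          (Tape.stack (s.stk (raStack (0 : Fin (K + 2))))).read)).number = num (s.stk (.inl ())) :=
      Tape.number_of_cells (Op.act_cells a _ _)
    have hres : raResult (σ := σ) (m := K + 1) (A.bin[num (s.stk (.inl ()))]?.map Sym.ofBool)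
        (fun l => ((Tape.stack (s.stk (raStack l))).put
          (a.act false (raStack l) (Tape.stack (s.stk (raStack l))).read)).read) a =
        ((raHost σ).exec A a s).1 := by
      rcases a with ⟨k, b⟩ | k | h' | h' | q
      · rfl
      · simp only [raResult]
        rw [raStack_raTape (fun i hi => by
          have := (hK c hc _ _ h).2 i (by rw [hi])
          omega), Op.act_pop]
        rfl
      · exact h'.elim
      · exact h'.elim
      · exact Sym.ofBool_bind_toBit _
    rw [show (2 : ℕ) = 1 + 1 from rfl, configAt_add, configAt_one, h1, Option.bind_some,
      configAt_one]
    simp only [RandomAccessTM.step, raMachine, toReach_val hc, h, Option.map_some, cond_true,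
      Option.some_inj, raConfig]
    congr 1
    · rw [← hres, ← hnum]
      rfl
    · funext l
      exact Op.act_act A a s (raStack l)
  halt {s} := by
    simp only [RandomAccessTM.step, raMachine, raConfig,
      toReach_val (show [] ∈ reach p from .inl rfl), view, Option.map_none]
  mem_acc {c s} hc := by
    refine ⟨fun ⟨c', h1, h2⟩ => ?_, fun h => ⟨_, rfl, by rw [toReach_val hc]; exact h⟩⟩
    obtain rfl := Option.some.inj h1
    rwa [toReach_val hc] at h2
  acc_halts := by
    rintro ⟨q, tapes⟩ ⟨c, rfl, h⟩
    simp only [RandomAccessTM.step, raMachine, h, Option.map_none]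

end RandomAccess

/-! ## Programs on direct-access machines -/

section DirectAccess

variable (σ : Vocabulary)

/-- The address-tapes of a direct-access machine. -/
abbrev AddressTape := (Σ i : Fin σ.p, Fin (σ.relArity i)) ⊕ Σ i : Fin σ.s, Fin (σ.funArity i)

variable {σ}

/-- The string on a read-only tape, where `addr` gives the numbers on the address-tapes of the
functions. -/
def OrderedStructure.roString (A : OrderedStructure σ)
    (addr : (i : Fin σ.s) → Fin (σ.funArity i) → ℕ) : ReadOnlyTape σ → List Bool
  | .value i => A.funQuery i (addr i)
  | .const i => A.binConst i
  | .size => toBin A.n.size A.n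

variable (σ) in
/-- The resources of a direct-access machine. -/
noncomputable def daHost : Host (OrderedStructure σ) where
  Addr := AddressTape σ
  Head := ReadOnlyTape σ
  Ask := Fin σ.p ⊕ ReadOnlyTape σ
  answer A addr pos
    | .inl i => some (A.relQuery i fun j => num (addr (.inl ⟨i, j⟩)))
    | .inr l => (A.roString (fun i j => num (addr (.inr ⟨i, j⟩))) l)[pos l]?

/-- The stack that is held on a tape of a direct-access machine. -/
def daStack {m : ℕ} : WritableTape σ m → (daHost σ).Stack
  | .relAddr i j => .inl (.inl ⟨i, j⟩)
  | .funAddr i j => .inl (.inr ⟨i, j⟩)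
  | .work i => .inr i

/-- The tape of a direct-access machine that holds a stack. -/
def daTape (m : ℕ) : (daHost σ).Stack → WritableTape σ (m + 1)
  | .inl (.inl x) => .relAddr x.1 x.2
  | .inl (.inr x) => .funAddr x.1 x.2
  | .inr i => .work (Fin.ofNat (m + 1) i)

/-- The result of an instruction in terms of the scanned symbols and of the answers to the queries
to the relations. -/
def daResult {m : ℕ} (r : WritableTape σ (m + 1) → Sym) (r' : ReadOnlyTape σ → Sym)
    (q : Fin σ.p → Bool) : (daHost σ).Op → Option Bool
  | .pop k => (r (daTape m k)).toBit
  | .ask (.inl i) => some (q i)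
  | .ask (.inr l) => (r' l).toBit
  | _ => none

open Classical in
/-- The move of the head on a read-only tape when the instruction `a` is executed in two steps. -/
noncomputable def daMove : (daHost σ).Op → Bool → ReadOnlyTape σ → Dir
  | .right h, true, l => if l = h then .right else .stay
  | .left h, true, l => if l = h then .left else .stay
  | _, _, _ => .stay

/-- The direct-access machine that executes the program `p` with `K + 1` work-tapes. Its states are
those of the corresponding random-access machine. -/
noncomputable def daMachine (p : (daHost σ).Prog) (K : ℕ) : DirectAccessTM σ where
  Q := Option ({c // c ∈ reach p} × Bool)
  k := K + 1
  k_pos := K.succ_pos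
  start := none
  accept := {q | ∃ c, q = some c ∧ view c.1.1 = .acc}
  δ
    | none, r, _, _ => some (some (toReach p [p], false), fun l => (r l, .stay), fun _ => .stay)
    | some (c, late), r, r', q =>
      match view c.1 with
      | .halt => none
      | .acc => none
      | .jump k => some (some (toReach p k, false), fun l => (r l, .stay), fun _ => .stay)
      | .op a next =>
        some (bif late then some (toReach p (next (daResult r r' q a)), false) else some (c, true),
          fun l => a.act late (daStack l) (r l), fun l => daMove a late l)

variable (p : (daHost σ).Prog) (K : ℕ) (A : OrderedStructure σ)

/-- The configuration with a list of programs and a state of the stacks. -/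
noncomputable def daConfig (c : List (daHost σ).Prog) (s : (daHost σ).State) :
    (daMachine p K).Config :=
  ⟨some (toReach p c, false), fun l => Tape.stack (s.stk (daStack l)),
    fun l => ⟨Tape.contents (A.roString (fun i j => num (s.stk (.inl (.inr ⟨i, j⟩)))) l), s.pos l⟩⟩

theorem daStack_daTape {m : ℕ} {k : (daHost σ).Stack} (h : ∀ i, k = .inr i → i ≤ m) :
    daStack (daTape m k) = k := by
  rcases k with (k | k) | i
  · rfl
  · rfl
  · have hi := h i rfl
    simp [daTape, daStack, Nat.mod_eq_of_lt (show i < m + 1 by omega)]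

/-- Value-tapes are recomputed from the new addresses, whatever they held. Only the other tapes need
to be correct beforehand, and their strings do not depend on the addresses. -/
theorem newContents_eq {k : ℕ} {wr : WritableTape σ k → Tape} {old : ReadOnlyTape σ → ℕ → Sym}
    {a a' : (i : Fin σ.s) → Fin (σ.funArity i) → ℕ} (ha : ∀ i j, (wr (.funAddr i j)).number = a i j)
    (l : ReadOnlyTape σ)
    (hold : (∀ i, l ≠ .value i) → old l = Tape.contents (A.roString a' l)) :
    DirectAccessTM.newContents A wr l (old l) = Tape.contents (A.roString a l) := by
  rcases l with i | i | _
  · simp only [DirectAccessTM.newContents, OrderedStructure.roString, ha]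
  · exact hold (by simp)
  · exact hold (by simp)

theorem Tape.contents_toBit (l : List Bool) (i : ℕ) : (Tape.contents l i).toBit = l[i]? := by
  rw [Tape.contents]
  cases l[i]?
  · rfl
  · exact Sym.toBit_ofBool _

theorem daMachine_implements (hK : ∀ c ∈ reach p, ∀ a next, view c = .op a next →
    (∀ i b, a = .push (.inr i) b → i ≤ K) ∧ ∀ i, a = .pop (.inr i) → i ≤ K) :
    Implements A p ((daMachine p K).step A) ((daMachine p K).initial A)
      (daMachine p K).accepting (daConfig p K A) where
  init := by
    simp only [DirectAccessTM.step, daMachine, DirectAccessTM.initial, Option.map_some,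
      Option.some_inj, daConfig, DirectAccessTM.next]
    congr 1
    · funext l
      rw [Tape.write_read]
      cases l <;> rfl
    · funext l
      -- Blank addresses denote 0, but value-tapes are blank until the first step. The idle initial
      -- step brings them in line with the addresses.
      rw [newContents_eq A (a := fun i j => 0) (a' := fun i j => 0)
        (old := fun l => Tape.cells _) (fun i j => ?_) l fun h => ?_]
      · cases l <;> rfl
      · rw [Tape.write_read]
        exact Tape.number_of_cells (l := []) rfl
      · rcases l with i | i | _
        · exact absurd rfl (h i)
        · rfl
        · rfl
  jump {c k s} hc h := by
    simp only [DirectAccessTM.step, daMachine, daConfig, toReach_val hc, h, Option.map_some,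
      Option.some_inj, DirectAccessTM.next]
    congr 1
    · funext l
      rw [Tape.write_read]
      rfl
    · funext l
      rw [newContents_eq A (a := fun i j => num (s.stk (.inl (.inr ⟨i, j⟩))))
        (a' := fun i j => num (s.stk (.inl (.inr ⟨i, j⟩)))) (old := fun l => Tape.contents _)
        (fun i j => ?_) l fun h => rfl]
      · rfl
      · rw [Tape.write_read]
        exact Tape.number_of_cells rfl
  op {c a next s} hc h := by
    have hnum : ∀ l : WritableTape σ (K + 1), ((Tape.stack (s.stk (daStack l))).put
        (a.act false (daStack l) (Tape.stack (s.stk (daStack l))).read)).number =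
          num (s.stk (daStack l)) := fun l =>
      Tape.number_of_cells (Op.act_cells a _ _)
    have h1 : (daMachine p K).step A (daConfig p K A c s) = some ⟨some (toReach p c, true),
        fun l => (Tape.stack (s.stk (daStack l))).put
          (a.act false (daStack l) (Tape.stack (s.stk (daStack l))).read),
        fun l => ⟨Tape.contents (A.roString (fun i j => num (s.stk (.inl (.inr ⟨i, j⟩)))) l),
          s.pos l⟩⟩ := by
      simp only [DirectAccessTM.step, daMachine, daConfig, toReach_val hc, h, Option.map_some,
        cond_false, DirectAccessTM.next, Option.some_inj]
      congr 1
      funext l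
      rw [newContents_eq A (a := fun i j => num (s.stk (.inl (.inr ⟨i, j⟩))))
        (a' := fun i j => num (s.stk (.inl (.inr ⟨i, j⟩)))) (old := fun l => Tape.contents _)
        (fun i j => hnum (.funAddr i j)) l fun h => rfl]
      congr 1
      rcases a with ⟨k, b⟩ | k | h' | h' | q <;> rfl
    have hres : daResult (σ := σ) (m := K)
        (fun l => ((Tape.stack (s.stk (daStack l))).put
          (a.act false (daStack l) (Tape.stack (s.stk (daStack l))).read)).read)
        (fun l => (⟨Tape.contents (A.roString (fun i j => num (s.stk (.inl (.inr ⟨i, j⟩)))) l),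
          s.pos l⟩ : Tape).read)
        (fun i => A.relQuery i fun j => num (s.stk (.inl (.inl ⟨i, j⟩)))) a =
        ((daHost σ).exec A a s).1 := by
      rcases a with ⟨k, b⟩ | k | h' | h' | i | l
      · rfl
      · simp only [daResult]
        rw [daStack_daTape (fun i hi => (hK c hc _ _ h).2 i (by rw [hi])), Op.act_pop]
        rfl
      · rfl
      · rfl
      · rfl
      · exact Tape.contents_toBit _ _
    rw [show (2 : ℕ) = 1 + 1 from rfl, configAt_add, configAt_one, h1, Option.bind_some,
      configAt_one]
    simp only [DirectAccessTM.step, daMachine, toReach_val hc, h, Option.map_some, cond_true,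
      Option.some_inj, hnum, daConfig, DirectAccessTM.next]
    have hact : ∀ l : WritableTape σ (K + 1), _ := fun l => Op.act_act A a s (daStack l)
    congr 1
    · rw [← hres]
      rfl
    · funext l
      exact hact l
    · funext l
      rw [newContents_eq A
        (a := fun i j => num (((daHost σ).exec A a s).2.stk (.inl (.inr ⟨i, j⟩))))
        (a' := fun i j => num (s.stk (.inl (.inr ⟨i, j⟩)))) (old := fun l => Tape.contents _)
        (fun i j => ?_) l fun h => rfl]
      · congr 1
        rcases a with ⟨k, b⟩ | k | h' | h' | q
        · rfl
        · rfl
        · by_cases hl : l = h'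
          · subst hl
            simp only [daMove, exec, Tape.move, if_true]
            classical exact (@Function.update_self (daHost σ).Head (fun _ => ℕ) _ _ _ _).symm
          · simp only [daMove, exec, Tape.move, if_neg hl]
            classical exact (@Function.update_of_ne (daHost σ).Head (fun _ => ℕ) _ _ _ hl _ _).symm
        · by_cases hl : l = h'
          · subst hl
            simp only [daMove, exec, Tape.move, if_true]
            classical exact (@Function.update_self (daHost σ).Head (fun _ => ℕ) _ _ _ _).symm
          · simp only [daMove, exec, Tape.move, if_neg hl]
            classical exact (@Function.update_of_ne (daHost σ).Head (fun _ => ℕ) _ _ _ hl _ _).symm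
        · rfl
      · exact Tape.number_of_cells (congrArg Tape.cells (hact (.funAddr i j)))
  halt {s} := by
    simp only [DirectAccessTM.step, daMachine, daConfig,
      toReach_val (show [] ∈ reach p from .inl rfl), view, Option.map_none]
  mem_acc {c s} hc := by
    refine ⟨fun ⟨c', h1, h2⟩ => ?_, fun h => ⟨_, rfl, by rw [toReach_val hc]; exact h⟩⟩
    obtain rfl := Option.some.inj h1
    rwa [toReach_val hc] at h2
  acc_halts := by
    rintro ⟨q, wr, ro⟩ ⟨c, rfl, h⟩
    simp only [DirectAccessTM.step, daMachine, h, Option.map_none]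

end DirectAccess

end PolylogTM

namespace PolylogTM

/-! ## Implementation of the oracles -/

namespace Host

open Function

variable {E : Type} {H : Host E} {size : E → ℕ} {ι : Type} {e : E}

/-- The state with the given special stacks, work stacks and positions of the heads. -/
def full (addr : H.Addr → List Bool) (s : ℕ → List Bool) (pos : H.Head → ℕ) : H.State :=
  ⟨Sum.elim addr s, pos⟩

section

variable (addr : H.Addr → List Bool) (s : ℕ → List Bool) (pos : H.Head → ℕ)

theorem full_push (i : ℕ) (b : Bool) : Runs e (Prog.op (.push (.inr i) b)) (full addr s pos)
    (full addr (update s i (b :: s i)) pos) 3 :=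
  runs_push.congr (by simp only [full, Sum.update_elim_inr, Sum.elim_inr]) le_rfl

open Classical in
theorem full_push_inl (a : H.Addr) (b : Bool) :
    Runs e (Prog.op (.push (.inl a) b)) (full addr s pos)
      (full (update addr a (b :: addr a)) s pos) 3 :=
  runs_push.congr (by simp only [full, Sum.update_elim_inl, Sum.elim_inl]) le_rfl

theorem full_clear (i : ℕ) : Runs e (Prog.clear (.inr i)) (full addr s pos)
    (full addr (update s i []) pos) (3 * (s i).length + 2) :=
  (runs_clear _).congr (by simp only [full, Sum.update_elim_inr]) le_rfl

open Classical in
theorem full_clear_inl (a : H.Addr) : Runs e (Prog.clear (.inl a)) (full addr s pos)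
    (full (update addr a []) s pos) (3 * (addr a).length + 2) :=
  (runs_clear _).congr (by simp only [full, Sum.update_elim_inl]) le_rfl

open Classical in
theorem full_copy (i t : ℕ) (a : H.Addr) (hti : t ≠ i) (ht : s t = []) :
    Runs e (Prog.copy (.inr i) (.inl a) (.inr t)) (full addr s pos)
      (full (update addr a (s i ++ addr a)) s pos) (14 * (s i).length + 5) :=
  (runs_copy (by simpa) (by simp) (by simp) _ ht).congr
    (by simp only [full, Sum.update_elim_inl, Sum.elim_inl, Sum.elim_inr]) le_rfl

end

/-- Assign the contents of work stacks to special stacks, one after the other. -/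
def Prog.load (f : ι → H.Addr) (loc : ι → ℕ) (t : ℕ) : List ι → H.Prog
  | [] => .skip
  | j :: l => .seq (.seq (.clear (.inl (f j))) (.copy (.inr (loc j)) (.inl (f j)) (.inr t)))
      (load f loc t l)

/-- Empty special stacks, one after the other. -/
def Prog.unload (f : ι → H.Addr) : List ι → H.Prog
  | [] => .skip
  | j :: l => .seq (.clear (.inl (f j))) (unload f l)

theorem runs_load {f : ι → H.Addr} (hf : Injective f) (loc : ι → ℕ) (t : ℕ)
    (ht : ∀ j, t ≠ loc j) (l : List ι) {N : ℕ} {s : ℕ → List Bool}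
    (hN : ∀ j, (s (loc j)).length ≤ N) (hs : s t = []) (addr : H.Addr → List Bool)
    (ha : ∀ a, (addr a).length ≤ N) :
    ∃ addr', Runs e (.load f loc t l) (full addr s fun _ => 0) (full addr' s fun _ => 0)
        (l.length * (17 * N + 9) + 1) ∧ (∀ j ∈ l, addr' (f j) = s (loc j)) ∧
      (∀ a, (∀ j ∈ l, a ≠ f j) → addr' a = addr a) ∧ ∀ a, (addr' a).length ≤ N := by
  classical
  induction l generalizing addr with
  | nil => exact ⟨addr, Runs.skip.mono (by simp), by simp, by simp, ha⟩
  | cons j l ih =>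
    have h1 := full_clear_inl (e := e) addr s (fun _ => 0) (f j)
    have h2 := full_copy (e := e) (update addr (f j) []) s (fun _ => 0) (loc j) t (f j) (ht j) hs
    simp only [update_self, List.append_nil, update_idem] at h2
    obtain ⟨addr', h3, h4, h5, h6⟩ := ih (update addr (f j) (s (loc j))) fun a => by
      by_cases h : a = f j
      · rw [h, update_self]
        exact hN j
      · rw [update_of_ne h]
        exact ha a
    refine ⟨addr', ((h1.seq h2).seq h3).mono ?_, fun k hk => ?_, fun a h => ?_, h6⟩
    · have := hN j
      have := ha (f j)
      rw [List.length_cons, Nat.succ_mul l.length]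
      omega
    -- If `k` occurs again later, the later load counts. Otherwise injectivity of `f` ensures that
    -- no later load overwrites it.
    · by_cases hkl : k ∈ l
      · exact h4 k hkl
      · obtain rfl : k = j := by simpa [hkl] using hk
        rw [h5 _ fun j hj h => hkl (by rwa [hf h]), update_self]
    · rw [h5 a fun k hk => h k (List.mem_cons_of_mem _ hk),
        update_of_ne (h j List.mem_cons_self)]

theorem runs_unload {f : ι → H.Addr} (l : List ι) {N : ℕ} (s : ℕ → List Bool)
    (addr : H.Addr → List Bool) (h : ∀ a, (∀ j ∈ l, a ≠ f j) → addr a = [])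
    (ha : ∀ a, (addr a).length ≤ N) :
    Runs e (.unload f l) (full addr s fun _ => 0) (work s) (l.length * (3 * N + 3) + 1) := by
  classical
  induction l generalizing addr with
  | nil =>
    obtain rfl : addr = fun _ => [] := funext fun a => h a (by simp)
    exact Runs.skip.mono (by simp)
  | cons j l ih =>
    have h1 := full_clear_inl (e := e) addr s (fun _ => 0) (f j)
    refine (h1.seq (ih (update addr (f j) []) (fun a h' => ?_) fun a => ?_)).mono ?_
    · by_cases hj : a = f j
      · rw [hj, update_self]
      · rw [update_of_ne hj]
        exact h a (by simpa [hj] using h')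
    · by_cases hj : a = f j
      · simp [hj]
      · rw [update_of_ne hj]
        exact ha a
    · have := ha (f j)
      rw [List.length_cons, Nat.succ_mul l.length]
      omega

/-- If `p` performs a computation with arguments on special stacks then it can be compiled. -/
theorem compiles_of_loaded [Finite ι] {f : ι → H.Addr} (hf : Injective f) {F : Fn E ι}
    (h : ∃ d, ∀ dst base, dst < base → ∃ p : H.Prog, ∀ N e s addr, size e ≤ N →
      (∀ j, (addr (f j)).length ≤ N) → (∀ j ≥ base, s j = []) → s dst = [] →
      Runs e p (full addr s fun _ => 0)
        (full addr (update s dst (F e fun j => addr (f j))) fun _ => 0) ((N + 2) ^ d)) :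
    Compiles H size F := by
  obtain ⟨n, ⟨g⟩⟩ := Finite.exists_equiv_fin ι
  set l : List ι := (List.finRange n).map g.symm with hl
  have hmem : ∀ j, j ∈ l := fun j => List.mem_map.mpr ⟨g j, List.mem_finRange _, by simp⟩
  obtain ⟨d₀, h⟩ := h
  obtain ⟨d, hd⟩ : ∃ d, ∀ N, l.length * (17 * N + 9) + 1 + (3 * N + 2 + ((N + 2) ^ d₀ +
      (l.length * (3 * N + 3) + 1) + 1) + 1) + 1 ≤ (N + 2) ^ d :=
    (((PolyBdd.const l.length).mul (((PolyBdd.const 17).mul .id).add (.const 9))).add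
      (.const 1)).add (((((PolyBdd.const 3).mul .id).add (.const 2)).add
      (((PolyBdd.pow_self d₀).add (((PolyBdd.const l.length).mul
      (((PolyBdd.const 3).mul .id).add (.const 3))).add (.const 1))).add (.const 1))).add
      (.const 1)) |>.add (.const 1)
  refine ⟨d, fun loc dst base hloc hdst => ?_⟩
  obtain ⟨p, hp⟩ := h dst base hdst
  refine ⟨.seq (.load f loc base l) (.seq (.clear (.inr dst)) (.seq p (.unload f l))),
    fun N e s h1 h2 h3 h4 => ?_⟩
  obtain ⟨addr, r1, r2, r3, r4⟩ := runs_load (e := e) hf loc base (fun j => (hloc j).ne') l h2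
    (h4 base le_rfl) (fun _ => []) (by simp)
  have c := full_clear (e := e) addr s (fun _ => 0) dst
  have a := hp N e (update s dst []) addr h1 (fun j => r4 _)
    (fun j hj => by rw [update_of_ne (by omega), h4 j hj]) (by simp)
  have hctx : (fun j => addr (f j)) = fun j => s (loc j) := funext fun j => r2 j (hmem j)
  rw [hctx, update_idem] at a
  refine (r1.seq (c.seq (a.seq (runs_unload l _ addr r3 r4)))).mono (le_trans ?_ (hd N))
  omega

theorem full_exec_ask (addr : H.Addr → List Bool) (s : ℕ → List Bool) (pos : H.Head → ℕ)
    (q : H.Ask) : H.exec e (.ask q) (full addr s pos) =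
      (H.answer e addr pos q, full addr s pos) := rfl

open Classical in
theorem full_exec_right (addr : H.Addr → List Bool) (s : ℕ → List Bool) (pos : H.Head → ℕ)
    (h : H.Head) : H.exec e (.right h) (full addr s pos) =
      (none, full addr s (update pos h (pos h + 1))) := rfl

open Classical in
theorem full_exec_left (addr : H.Addr → List Bool) (s : ℕ → List Bool) (pos : H.Head → ℕ)
    (h : H.Head) : H.exec e (.left h) (full addr s pos) =
      (none, full addr s (update pos h (pos h - 1))) := rfl

theorem full_exec_pop (addr : H.Addr → List Bool) (s : ℕ → List Bool) (pos : H.Head → ℕ)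
    (i : ℕ) : H.exec e (.pop (.inr i)) (full addr s pos) =
      ((s i).head?, full addr (update s i (s i).tail) pos) := by
  simp only [exec, full, Sum.elim_inr, Sum.update_elim_inr]

/-- The answer to a question. -/
theorem compiles_ask [Finite ι] {f : ι → H.Addr} (hf : Injective f) (q : H.Ask)
    (g : E → (ι → List Bool) → Option Bool)
    (hg : ∀ e addr pos, H.answer e addr pos q = g e fun j => addr (f j)) :
    Compiles H size fun e s => (g e s).toList := by
  refine compiles_of_loaded hf ⟨3, fun dst base hdst => ?_⟩
  refine ⟨.case (.ask q) fun o => o.elim .skip fun b => .op (.push (.inr dst) b),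
    fun N e s addr h1 h2 h3 h4 => ?_⟩
  have ha := full_exec_ask (e := e) addr s (fun _ => 0) q
  rw [hg] at ha
  have hN : 5 ≤ (N + 2) ^ 3 := le_trans (by norm_num) (Nat.pow_le_pow_left (Nat.le_add_left 2 N) 3)
  cases ho : g e fun j => addr (f j) with
  | none =>
    rw [ho] at ha
    refine (Runs.case ha Runs.skip).congr ?_ (by omega)
    rw [Option.toList_none, ← h4, update_eq_self]
  | some b =>
    rw [ho] at ha
    refine (Runs.case ha (full_push _ _ _ _ _)).congr ?_ (by omega)
    rw [h4, Option.toList_some]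

open Classical in
/-- The string on a read-only tape, in reverse order. -/
theorem compiles_read [Finite ι] {f : ι → H.Addr} (hf : Injective f) (q : H.Ask) (h : H.Head)
    (g : Fn E ι) (hg : ∀ e addr pos, H.answer e addr pos q = (g e fun j => addr (f j))[pos h]?)
    (hl : ∃ d, LenBdd size g d) : Compiles H size fun e s => (g e s).reverse := by
  obtain ⟨d₀, hl⟩ := hl
  obtain ⟨d, hd⟩ : ∃ d, ∀ N, (13 * (N + 2) ^ d₀ + 2) + (5 * (N + 2) ^ d₀ + 2) + 1 ≤ (N + 2) ^ d :=
    ((((PolyBdd.const 13).mul (.pow_self d₀)).add (.const 2)).add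
      (((PolyBdd.const 5).mul (.pow_self d₀)).add (.const 2))).add (.const 1)
  refine compiles_of_loaded hf ⟨d, fun dst base hdst => ?_⟩
  -- The bits are pushed as they are read, hence the reversal. One mark per bit on `base` counts how
  -- far the head has gone.
  let rd : Bool → H.Prog := fun b => .seq (.op (.push (.inr dst) b))
    (.seq (.op (.push (.inr base) true)) (.op (.right h)))
  let back : Bool → H.Prog := fun _ => .op (.left h)
  refine ⟨.seq (.loop (.ask q) rd) (.loop (.pop (.inr base)) back),
    fun N e s addr h1 h2 h3 h4 => ?_⟩
  set w := g e fun j => addr (f j) with hw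
  have hwl : w.length ≤ (N + 2) ^ d₀ := hl N e _ h1 h2
  let st : ℕ → List Bool → H.State := fun k l =>
    full addr (update (update s dst l) base (List.replicate k true)) (update (fun _ => 0) h k)
  have hask : ∀ k l, H.exec e (.ask q) (st k l) = (w[k]?, st k l) := fun k l => by
    simp only [st]
    rw [full_exec_ask, hg, update_self]
  have loop : ∀ n k, k + n = w.length →
      Runs e (.loop (.ask q) rd) (st k (w.take k).reverse) (st w.length w.reverse)
        (n * 13 + 2) := by
    intro n
    induction n with
    | zero =>
      rintro k rfl
      have := hask w.length (w.take w.length).reverse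
      rw [List.getElem?_eq_none le_rfl, List.take_length] at this
      rw [List.take_length]
      exact (Runs.exit this).mono (by simp)
    | succ n ih =>
      intro k hk
      have hlt : k < w.length := by omega
      have := hask k (w.take k).reverse
      rw [List.getElem?_eq_getElem hlt] at this
      have a1 := full_push (e := e) addr
        (update (update s dst (w.take k).reverse) base (List.replicate k true))
        (update (fun _ => 0) h k) dst w[k]
      have a2 := full_push (e := e) addr
        (update (update s dst (w[k] :: (w.take k).reverse)) base (List.replicate k true))
        (update (fun _ => 0) h k) base true
      rw [update_of_ne hdst.ne, update_self, update_comm hdst.ne', update_idem] at a1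
      rw [update_self, update_idem] at a2
      have hb : Runs e (rd w[k]) (st k (w.take k).reverse) (st (k + 1) (w.take (k + 1)).reverse)
          11 := by
        refine (a1.seq (a2.seq (Runs.case (f := fun _ => .skip) (full_exec_right _ _ _ _)
          Runs.skip))).congr ?_ le_rfl
        simp only [st]
        rw [update_self, update_idem, List.take_add_one, List.getElem?_eq_getElem hlt,
          Option.toList_some, List.reverse_append, List.reverse_singleton, List.singleton_append,
          List.replicate_succ]
      refine (Runs.iter this hb (ih (k + 1) (by omega))).mono ?_
      omega
  -- The marks bring the head back to cell 0, where every compiled program expects it.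
  have unwind : ∀ k, Runs e (.loop (.pop (.inr base)) back) (st k w.reverse) (st 0 w.reverse)
      (k * 5 + 2) := by
    intro k
    induction k with
    | zero =>
      refine (Runs.exit (s' := st 0 w.reverse) ?_).mono (by simp)
      simp only [st]
      rw [full_exec_pop, update_self, update_idem]
      rfl
    | succ k ih =>
      have hpop : H.exec e (.pop (.inr base)) (st (k + 1) w.reverse) = (some true,
          full addr (update (update s dst w.reverse) base (List.replicate k true))
            (update (fun _ => 0) h (k + 1))) := by
        simp only [st]
        rw [full_exec_pop, update_self, update_idem, List.replicate_succ]
        rfl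
      have hb : Runs e (back true) (full addr (update (update s dst w.reverse) base
          (List.replicate k true)) (update (fun _ => 0) h (k + 1))) (st k w.reverse) 3 := by
        refine (Runs.case (f := fun _ => .skip) (full_exec_left _ _ _ _) Runs.skip).congr ?_ le_rfl
        simp only [st]
        rw [update_self, update_idem, Nat.add_sub_cancel]
      refine (Runs.iter hpop hb ih).mono ?_
      omega
  have h0 : ∀ l, st 0 l = full addr (update s dst l) fun _ => 0 := fun l => by
    have hb : update s dst l base = List.replicate 0 true := by
      rw [update_of_ne hdst.ne', h3 base le_rfl, List.replicate_zero]
    simp only [st]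
    rw [← hb, update_eq_self, update_eq_self_iff.mpr rfl]
  have r := (loop w.length 0 (Nat.zero_add _)).seq (unwind w.length)
  rw [List.take_zero, List.reverse_nil, h0, h0, ← h4, update_eq_self] at r
  refine r.mono (le_trans ?_ (hd N))
  omega

end Host

/-! ## The oracles of random-access machines -/

section RandomAccess

variable (σ : Vocabulary)

/-- The oracles of a random-access machine. -/
inductive RAOracle
  | query
  | clock

/-- The arguments of the oracles of a random-access machine. -/
def RAOracle.Arg : RAOracle → Type
  | .query => Unit
  | .clock => Empty

instance (o : RAOracle) : Finite o.Arg := by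
  cases o
  · exact inferInstanceAs (Finite Unit)
  · exact inferInstanceAs (Finite Empty)

/-- The oracles of a random-access machine: a query to the input, and a string whose length is the
logarithm of the length of the input. -/
noncomputable def raOracles : Oracles (OrderedStructure σ) where
  Op := RAOracle
  Arg := RAOracle.Arg
  val
    | .query, A, s => (A.bin[num (s ())]?).toList
    | .clock, A, _ => List.replicate (Nat.clog 2 A.bin.length) true

variable {σ}

theorem compiles_ra_query : Host.Compiles (raHost σ) OrderedStructure.width
    ((raOracles σ).val .query) :=
  Host.compiles_ask (H := raHost σ) (ι := Unit) (f := fun _ => ()) (fun _ _ _ => rfl) ()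
    (fun A s => A.bin[num (s ())]?) fun _ _ _ => rfl

end RandomAccess

end PolylogTM

namespace PolylogTM

/-! ## Values of bit strings -/

theorem num_append (l l' : List Bool) : num (l ++ l') = num l + 2 ^ l.length * num l' := by
  induction l with
  | nil => simp [num]
  | cons b l ih =>
    rw [List.cons_append, num, num, ih, List.length_cons, pow_succ]
    ring

theorem num_lt (l : List Bool) : num l < 2 ^ l.length := by
  induction l with
  | nil => simp [num]
  | cons b l ih =>
    rw [num, List.length_cons, pow_succ]
    have := Bool.toNat_lt b
    omega

theorem num_replicate_false (k : ℕ) : num (List.replicate k false) = 0 := by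
  induction k with
  | zero => rfl
  | succ k ih => simp [List.replicate_succ, num, ih]

theorem num_pow (k : ℕ) : num (List.replicate k false ++ [true]) = 2 ^ k := by
  rw [num_append, num_replicate_false, List.length_replicate]
  simp [num]

/-! ## The length of the encoding -/

theorem length_tuples (n k : ℕ) : (tuples n k).length = n ^ k := by
  induction k with
  | zero => rfl
  | succ k ih => simp [tuples, List.length_flatMap, ih, pow_succ, Nat.mul_comm]

/-- The length of the encoding of a structure of cardinality `n`. -/
def encLen (σ : Vocabulary) (n : ℕ) : ℕ :=
  ∑ i, n ^ σ.relArity i + (σ.q * Nat.clog 2 n + ∑ i, Nat.clog 2 n * n ^ σ.funArity i)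

namespace OrderedStructure

variable {σ : Vocabulary} (A : OrderedStructure σ)

theorem length_binRel (i : Fin σ.p) : (A.binRel i).length = A.n ^ σ.relArity i := by
  simp [binRel, length_tuples]

theorem length_binConst (i : Fin σ.q) : (A.binConst i).length = A.width := by
  simp [binConst, toBin]

theorem length_binFun (i : Fin σ.s) :
    (A.binFun i).length = A.width * A.n ^ σ.funArity i := by
  simp [binFun, List.length_flatMap, length_tuples]

theorem sum_map_finRange {m : ℕ} (f : Fin m → ℕ) : ((List.finRange m).map f).sum = ∑ i, f i := by
  rw [← List.ofFn_eq_map, List.sum_ofFn]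

theorem length_bin : A.bin.length = encLen σ A.n := by
  rw [bin, List.length_append, List.length_append, List.length_flatMap, List.length_flatMap,
    List.length_flatMap, sum_map_finRange, sum_map_finRange, sum_map_finRange]
  simp only [length_binRel, length_binConst, length_binFun, encLen, Finset.sum_const,
    Finset.card_univ, Fintype.card_fin, smul_eq_mul, width]

theorem n_le : A.n ≤ 2 ^ A.width := Nat.le_pow_clog (by omega) _

end OrderedStructure

/-- The length of the encoding is polynomial in n, so its logarithm is linear in log n. Positive
arities play no role in this direction. -/
theorem exists_clog_encLen_le (σ : Vocabulary) :
    ∃ a b, ∀ n, Nat.clog 2 (encLen σ n) ≤ a * Nat.clog 2 n + b := by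
  obtain ⟨R, hR⟩ := (Set.finite_range σ.relArity).bddAbove
  obtain ⟨R', hR'⟩ := (Set.finite_range σ.funArity).bddAbove
  -- With w = ⌈log n⌉, powers of n are at most 2 ^ ((R + R') w), and the additional w in the
  -- exponent pays for the factor w of functions and constants. The number of symbols is below 2 to
  -- that number, which gives the additive constant.
  refine ⟨R + R' + 1, σ.p + σ.q + σ.s, fun n => Nat.clog_le_of_le_pow ?_⟩
  set w := Nat.clog 2 n
  have hn : n ≤ 2 ^ w := Nat.le_pow_clog (by omega) _
  have hw : w ≤ 2 ^ w := Nat.lt_two_pow_self.le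
  have hpow : ∀ r ≤ R + R', n ^ r ≤ 2 ^ ((R + R') * w) := fun r hr => by
    calc n ^ r ≤ (2 ^ w) ^ r := Nat.pow_le_pow_left hn r
      _ = 2 ^ (r * w) := by rw [← pow_mul, Nat.mul_comm]
      _ ≤ _ := Nat.pow_le_pow_right (by omega) (Nat.mul_le_mul_right _ hr)
  have h2 : (2 : ℕ) ^ ((R + R' + 1) * w) = 2 ^ w * 2 ^ ((R + R') * w) := by
    rw [← pow_add]
    ring_nf
  have h1 : 1 ≤ 2 ^ w := Nat.one_le_two_pow
  have h1' : 1 ≤ 2 ^ ((R + R') * w) := Nat.one_le_two_pow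
  have hrel : ∑ i, n ^ σ.relArity i ≤ σ.p * 2 ^ ((R + R' + 1) * w) := by
    refine (Finset.sum_le_card_nsmul _ _ (2 ^ ((R + R' + 1) * w)) fun i _ => ?_).trans (by simp)
    rw [h2]
    exact (hpow _ ((hR ⟨i, rfl⟩).trans (by omega))).trans (Nat.le_mul_of_pos_left _ h1)
  have hfun : ∑ i, w * n ^ σ.funArity i ≤ σ.s * 2 ^ ((R + R' + 1) * w) := by
    refine (Finset.sum_le_card_nsmul _ _ (2 ^ ((R + R' + 1) * w)) fun i _ => ?_).trans (by simp)
    rw [h2]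
    exact Nat.mul_le_mul hw (hpow _ ((hR' ⟨i, rfl⟩).trans (by omega)))
  have hconst : σ.q * w ≤ σ.q * 2 ^ ((R + R' + 1) * w) := by
    refine Nat.mul_le_mul_left _ ?_
    rw [h2]
    exact hw.trans (Nat.le_mul_of_pos_right _ h1')
  calc encLen σ n ≤ (σ.p + σ.q + σ.s) * 2 ^ ((R + R' + 1) * w) := by
        rw [encLen]
        nlinarith
    _ ≤ 2 ^ (σ.p + σ.q + σ.s) * 2 ^ ((R + R' + 1) * w) :=
        Nat.mul_le_mul_right _ Nat.lt_two_pow_self.le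
    _ = _ := by rw [← pow_add, Nat.add_comm]

/-! ### The clock of a random-access machine -/

section RandomAccess

variable {σ : Vocabulary}

open Host Function

/-- The input is probed at the positions 1, 2, 4, 8, … until the end-marker appears; the number of
successful probes is the logarithm of the length. Pushing a 0 on the address stack doubles the
address, because its top is the least significant digit. -/
theorem compiles_ra_clock : Host.Compiles (raHost σ) OrderedStructure.width
    ((raOracles σ).val .clock) := by
  classical
  obtain ⟨a, b, hab⟩ := exists_clog_encLen_le σ
  obtain ⟨d, hd⟩ : ∃ d, ∀ N, 3 * N + 2 + (3 + ((9 * (a * N + b) + 2) + (3 * (a * N + b) + 5) + 1) +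
      1) + 1 ≤ (N + 2) ^ d :=
    have h := ((PolyBdd.const a).mul .id).add (.const b)
    ((((PolyBdd.const 3).mul .id).add (.const 2)).add (((PolyBdd.const 3).add
      (((((PolyBdd.const 9).mul h).add (.const 2)).add
      (((PolyBdd.const 3).mul h).add (.const 5))).add (.const 1))).add (.const 1))).add (.const 1)
  refine ⟨d, fun loc dst base hloc hdst => ?_⟩
  let rd : Bool → (raHost σ).Prog := fun _ =>
    .seq (.op (.push (.inr dst) true)) (.op (.push (.inl ()) false))
  refine ⟨.seq (.clear (.inr dst)) (.seq (.op (.push (.inl ()) true))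
    (.seq (.loop (.ask ()) rd) (.clear (.inl ())))), fun N A s h1 h2 h3 h4 => ?_⟩
  let st : ℕ → (raHost σ).State := fun k =>
    full (fun _ => List.replicate k false ++ [true]) (update s dst (List.replicate k true)) fun _ => 0
  set c := Nat.clog 2 A.bin.length with hc
  have hcN : c ≤ a * N + b := by
    rw [hc, OrderedStructure.length_bin]
    exact (hab _).trans (Nat.add_le_add_right (Nat.mul_le_mul_left _ h1) _)
  have hupd : ∀ (f g : (raHost σ).Addr → List Bool) [DecidableEq (raHost σ).Addr],
      update f () (g ()) = g := fun f g _ => funext fun x => by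
    cases x
    exact update_self _ _ _
  have hask : ∀ k, (raHost σ).exec A (.ask ()) (st k) = (A.bin[2 ^ k]?, st k) := fun k => by
    rw [← num_pow k]
    exact full_exec_ask _ _ _ _
  have loop : ∀ n k, k + n = c → Runs A (.loop (.ask ()) rd) (st k) (st c) (n * 9 + 2) := by
    intro n
    induction n with
    | zero =>
      rintro k rfl
      have := hask c
      -- The first k with 2 ^ k not below the length is the rounded-up logarithm, also when the
      -- length is 0 or 1.
      rw [List.getElem?_eq_none (Nat.le_pow_clog (by omega) _)] at this
      exact (Runs.exit this).mono (by simp)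
    | succ n ih =>
      intro k hk
      have hlt : 2 ^ k < A.bin.length := (Nat.lt_clog_iff_pow_lt (by omega)).mp (by omega)
      have := hask k
      rw [List.getElem?_eq_getElem hlt] at this
      have a1 := full_push (H := raHost σ) (e := A) (fun _ => List.replicate k false ++ [true])
        (update s dst (List.replicate k true)) (fun _ => 0) dst true
      have a2 := full_push_inl (H := raHost σ) (e := A) (fun _ => List.replicate k false ++ [true])
        (update s dst (List.replicate (k + 1) true)) (fun _ => 0) () false
      rw [update_self, update_idem] at a1
      have hb : Runs A (rd A.bin[2 ^ k]) (st k) (st (k + 1)) 7 := by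
        refine (a1.seq a2).congr ?_ le_rfl
        simp only [st]
        rw [hupd _ fun _ => false :: (List.replicate k false ++ [true]), List.replicate_succ,
          List.replicate_succ, List.cons_append]
      refine (Runs.iter this hb (ih (k + 1) (by omega))).mono ?_
      omega
  have r1 := full_clear (H := raHost σ) (e := A) (fun _ => []) s (fun _ => 0) dst
  have r2 := full_push_inl (H := raHost σ) (e := A) (fun _ => []) (update s dst []) (fun _ => 0)
    () true
  rw [hupd _ fun _ => [true]] at r2
  have r3 := full_clear_inl (H := raHost σ) (e := A) (fun _ => List.replicate c false ++ [true])
    (update s dst (List.replicate c true)) (fun _ => 0) ()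
  rw [hupd _ fun _ => []] at r3
  refine (r1.seq (r2.seq ((loop c 0 (Nat.zero_add c)).seq r3))).mono (le_trans ?_ (hd N))
  rw [List.length_append, List.length_replicate, List.length_singleton]
  omega

theorem ra_oracles_short : (raOracles σ).Short OrderedStructure.width := by
  rintro (_ | _)
  · refine ⟨0, fun N A s _ _ => ?_⟩
    change (A.bin[num (s ())]?).toList.length ≤ 1
    cases A.bin[num (s ())]? <;> simp
  · obtain ⟨a, b, hab⟩ := exists_clog_encLen_le σ
    obtain ⟨d, hd⟩ := ((PolyBdd.const a).mul .id).add (.const b)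
    refine ⟨d, fun N A s h _ => le_trans ?_ (hd N)⟩
    change (List.replicate (Nat.clog 2 A.bin.length) true).length ≤ a * N + b
    rw [List.length_replicate, OrderedStructure.length_bin]
    exact (hab _).trans (Nat.add_le_add_right (Nat.mul_le_mul_left _ h) _)

theorem compiles_ra (o : RAOracle) : Host.Compiles (raHost σ) OrderedStructure.width
    ((raOracles σ).val o) := by
  cases o
  · exact compiles_ra_query
  · exact compiles_ra_clock

end RandomAccess

/-! ## The oracles of direct-access machines -/

section DirectAccess

variable (σ : Vocabulary)

/-- The oracles of a direct-access machine. -/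
inductive DAOracle
  | rel (i : Fin σ.p)
  | ro (l : ReadOnlyTape σ)

variable {σ}

/-- The address-tapes on which the content of a read-only tape depends. -/
def roArg : ReadOnlyTape σ → Type
  | .value i => Fin (σ.funArity i)
  | .const _ => Empty
  | .size => Empty

/-- The arguments of the oracles of a direct-access machine. -/
def DAOracle.Arg : DAOracle σ → Type
  | .rel i => Fin (σ.relArity i)
  | .ro l => roArg l

instance (l : ReadOnlyTape σ) : Finite (roArg l) := by
  cases l
  · exact inferInstanceAs (Finite (Fin _))
  · exact inferInstanceAs (Finite Empty)
  · exact inferInstanceAs (Finite Empty)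

instance (o : DAOracle σ) : Finite o.Arg := by
  cases o
  · exact inferInstanceAs (Finite (Fin _))
  · exact inferInstanceAs (Finite (roArg _))

/-- The string on a read-only tape in terms of the relevant address-tapes. -/
def roValue (A : OrderedStructure σ) : (l : ReadOnlyTape σ) → (roArg l → List Bool) → List Bool
  | .value i, s => A.funQuery i fun j => num (s j)
  | .const i, _ => A.binConst i
  | .size, _ => toBin A.n.size A.n

variable (σ) in
/-- The oracles of a direct-access machine: queries to the relations, and the strings on the
read-only tapes with the least significant bit first. -/
noncomputable def daOracles : Oracles (OrderedStructure σ) where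
  Op := DAOracle σ
  Arg := DAOracle.Arg
  val
    | .rel i, A, s => [A.relQuery i fun j => num (s j)]
    | .ro l, A, s => (roValue A l s).reverse

theorem length_toBin (w v : ℕ) : (toBin w v).length = w := by simp [toBin]

theorem length_funQuery_le (A : OrderedStructure σ) (i : Fin σ.s) (a : Fin (σ.funArity i) → ℕ) :
    (A.funQuery i a).length ≤ A.width := by
  unfold OrderedStructure.funQuery
  split <;> simp [length_toBin]

/-- A power of two 2 ^ w has w + 1 digits although its logarithm is w. -/
theorem OrderedStructure.size_le (A : OrderedStructure σ) : A.n.size ≤ A.width + 1 :=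
  Nat.size_le.mpr (A.n_le.trans_lt (Nat.pow_lt_pow_right (by omega) (Nat.lt_succ_self _)))

theorem length_roValue_le (A : OrderedStructure σ) (l : ReadOnlyTape σ)
    (s : roArg l → List Bool) : (roValue A l s).length ≤ A.width + 1 := by
  cases l
  · exact (length_funQuery_le A _ _).trans (Nat.le_succ _)
  · exact (A.length_binConst _).le.trans (Nat.le_succ _)
  · exact (length_toBin _ _).le.trans A.size_le

theorem da_oracles_short : (daOracles σ).Short OrderedStructure.width := by
  rintro (i | l)
  · exact ⟨0, fun N A s _ _ => le_rfl⟩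
  · refine ⟨1, fun N A s h _ => ?_⟩
    change (roValue A l s).reverse.length ≤ _
    rw [List.length_reverse, pow_one]
    exact (length_roValue_le A l s).trans (by omega)

/-- The address-tape for an argument of a read-only tape. -/
def roAddr : (l : ReadOnlyTape σ) → roArg l → (daHost σ).Addr
  | .value i, j => .inr ⟨i, j⟩
  | .const _, j => nomatch j
  | .size, j => nomatch j

theorem roAddr_injective (l : ReadOnlyTape σ) : Function.Injective (roAddr l) := by
  rcases l with i | i | _
  · intro j j' h
    exact eq_of_heq (Sigma.mk.inj (Sum.inr.inj h)).2
  · exact fun j => nomatch j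
  · exact fun j => nomatch j

theorem compiles_da (o : DAOracle σ) : Host.Compiles (daHost σ) OrderedStructure.width
    ((daOracles σ).val o) := by
  rcases o with i | l
  · refine Host.compiles_ask (H := daHost σ) (ι := Fin (σ.relArity i)) (f := fun j => .inl ⟨i, j⟩)
      (fun j j' h => eq_of_heq (Sigma.mk.inj (Sum.inl.inj h)).2) (.inl i)
      (fun A s => some (A.relQuery i fun j => num (s j))) fun _ _ _ => rfl
  · refine Host.compiles_read (H := daHost σ) (ι := roArg l) (roAddr_injective l) (.inr l) l
      (fun A s => roValue A l s) (fun A addr pos => ?_) ⟨1, fun N A s h _ => ?_⟩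
    · cases l <;> rfl
    · rw [pow_one]
      exact (length_roValue_le A l s).trans (by omega)

end DirectAccess

/-! ## From recursive functions to machines -/

section

variable {σ : Vocabulary} {C : Set (OrderedStructure σ)}

open Host

theorem runs_of_cob {H : Host (OrderedStructure σ)} {O : Oracles (OrderedStructure σ)}
    (hO : O.Short OrderedStructure.width)
    (h : ∀ o, Compiles H OrderedStructure.width (O.val o)) {F : Fn (OrderedStructure σ) Empty}
    (hF : Cob OrderedStructure.width O F) : ∃ (p : H.Prog) (d : ℕ), ∀ A,
      ∃ s : ℕ → List Bool, s 0 = F A (fun i => i.elim) ∧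
        Runs A p (work fun _ => []) (work s) ((A.width + 2) ^ d) := by
  obtain ⟨d, hd⟩ := compiles_of_cob hO h hF
  obtain ⟨p, hp⟩ := hd (fun i => i.elim) 0 1 (fun i => i.elim) (by omega)
  refine ⟨p, d, fun A => ⟨_, ?_, hp A.width A (fun _ => []) le_rfl (fun i => i.elim) (by simp)
    (by simp)⟩⟩
  rw [Function.update_self]
  congr 1
  exact funext fun i => i.elim

/-- A class that is decided by a function in the algebra is decided by a random-access machine. -/
theorem exists_raMachine {F : Fn (OrderedStructure σ) Empty}
    (hF : Cob OrderedStructure.width (raOracles σ) F)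
    (hC : ∀ A, A ∈ C ↔ (F A fun i => i.elim).head? = some true) :
    ∃ (M : RandomAccessTM) (d : ℕ), ∀ A : OrderedStructure σ,
      (A ∈ C ↔ ReachesAccepting (M.step A.bin) M.initial M.accepting) ∧
        FinishesWithin (M.step A.bin) M.initial M.accepting ((A.width + 2) ^ d + 5) := by
  obtain ⟨p, d, hp⟩ := runs_of_cob ra_oracles_short compiles_ra hF
  obtain ⟨K, hK⟩ := Prog.exists_stack_bound (Prog.decider p)
  refine ⟨raMachine (Prog.decider p) K, d, fun A => ?_⟩
  obtain ⟨s, hs, hr⟩ := hp A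
  rw [hC, ← hs]
  have := (raMachine_implements (Prog.decider p) K hK A).decides hr
  exact ⟨this.1.symm, this.2⟩

/-- A class that is decided by a function in the algebra is decided by a direct-access machine. -/
theorem exists_daMachine {F : Fn (OrderedStructure σ) Empty}
    (hF : Cob OrderedStructure.width (daOracles σ) F)
    (hC : ∀ A, A ∈ C ↔ (F A fun i => i.elim).head? = some true) :
    ∃ (M : DirectAccessTM σ) (d : ℕ), ∀ A : OrderedStructure σ,
      (A ∈ C ↔ ReachesAccepting (M.step A) (M.initial A) M.accepting) ∧
        FinishesWithin (M.step A) (M.initial A) M.accepting ((A.width + 2) ^ d + 5) := by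
  obtain ⟨p, d, hp⟩ := runs_of_cob da_oracles_short compiles_da hF
  obtain ⟨K, hK⟩ := Prog.exists_stack_bound (Prog.decider p)
  refine ⟨daMachine (Prog.decider p) K, d, fun A => ?_⟩
  obtain ⟨s, hs, hr⟩ := hp A
  rw [hC, ← hs]
  have := (daMachine_implements (Prog.decider p) K A hK).decides hr
  exact ⟨this.1.symm, this.2⟩

end

end PolylogTM

namespace PolylogTM

/-! ## Basic functions on bit strings -/

namespace Cob

variable {E : Type} {size : E → ℕ} {O : Oracles E} {ι : Type}

theorem reverse_append {X Y : Fn E ι} (hX : Cob size O X) (hY : Cob size O Y) :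
    Cob size O fun e s => (X e s).reverse ++ Y e s := by
  have := fold₁ (fun b _ _ a => b :: a) hX hY (fun b => (var _).cons b)
    ⟨0, fun N e s _ _ b a => by simp⟩
  convert this using 3
  simp

theorem reverse {X : Fn E ι} (hX : Cob size O X) : Cob size O fun e s => (X e s).reverse := by
  simpa using reverse_append hX nil

theorem append {X Y : Fn E ι} (hX : Cob size O X) (hY : Cob size O Y) :
    Cob size O fun e s => X e s ++ Y e s := by
  simpa using reverse_append hX.reverse hY

theorem drop_length {X Y : Fn E ι} (hX : Cob size O X) (hY : Cob size O Y) :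
    Cob size O fun e s => (Y e s).drop (X e s).length := by
  have := fold₁ (fun _ _ _ a => a.tail) hX hY (fun _ => (var _).tail)
    ⟨0, fun N e s _ _ b a => by simp; omega⟩
  convert this using 3 with e s
  generalize Y e s = y
  induction X e s generalizing y with
  | nil => rfl
  | cons b x ih => rw [List.foldl_cons, ← ih, List.length_cons, List.drop_tail]

end Cob

/-! ## Tapes as pairs of stacks -/

/-- The symbol that is coded by a bit that tells whether it is not blank, and a bit for its value. -/
def codedSym : Option Bool → Option Bool → Sym
  | some true, d => .ofBool (d.getD false)
  | _, _ => .blank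

/-- The bit that tells whether a symbol is not blank. -/
def Sym.mask : Sym → Bool
  | .blank => false
  | _ => true

/-- The bit for the value of a symbol. -/
def Sym.value : Sym → Bool
  | .one => true
  | _ => false

theorem codedSym_code (a : Sym) : codedSym (some a.mask) (some a.value) = a := by
  cases a <;> rfl

/-- The stack on the left of the head after writing `b` and moving. -/
def zipLeft (l : List Bool) (b : Bool) : Dir → List Bool
  | .left => l.tail
  | .right => b :: l
  | .stay => l

/-- The stack on the right of the head (with the scanned cell) after writing `b` and moving. -/
def zipRight (l r : List Bool) (b : Bool) : Dir → List Bool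
  | .left => l.head?.toList ++ b :: r.tail
  | .right => r.tail
  | .stay => b :: r.tail

/-- The new position of a head after a move. -/
def Dir.apply : Dir → ℕ → ℕ
  | .left, h => h - 1
  | .right, h => h + 1
  | .stay, h => h

/-- A move only shifts the cut between the two stacks. At the leftmost cell nothing is transferred,
so the head stays there. -/
theorem zip_append (l r : List Bool) (b : Bool) (d : Dir) :
    (zipLeft l b d).reverse ++ zipRight l r b d = l.reverse ++ b :: r.tail := by
  cases d
  · cases l <;> simp [zipLeft, zipRight]
  · simp [zipLeft, zipRight]
  · rfl

theorem zip_getElem? (l r : List Bool) (b : Bool) (d : Dir) (i : ℕ) :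
    ((zipLeft l b d).reverse ++ zipRight l r b d)[i]? =
      if i = l.length then some b else (l.reverse ++ r)[i]? := by
  rw [zip_append]
  rcases lt_trichotomy i l.length with h | rfl | h
  · rw [if_neg h.ne, List.getElem?_append_left (by simpa), List.getElem?_append_left (by simpa)]
  · simp
  · rw [if_neg h.ne', List.getElem?_append_right (by simpa using h.le),
      List.getElem?_append_right (by simpa using h.le)]
    obtain ⟨k, hk⟩ : ∃ k, i - l.reverse.length = k + 1 :=
      ⟨i - l.length - 1, by rw [List.length_reverse]; omega⟩
    rw [hk]
    cases r <;> simp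

theorem length_zipLeft (l : List Bool) (b : Bool) (d : Dir) :
    (zipLeft l b d).length = d.apply l.length := by
  cases d <;> simp [zipLeft, Dir.apply]

/-- The stacks `lm, rm` for the masks and `ld, rd` for the values represent a tape. -/
structure ZipRep (t : Tape) (lm ld rm rd : List Bool) : Prop where
  lm_length : lm.length = t.head
  ld_length : ld.length = t.head
  cells i : t.cells i = codedSym (lm.reverse ++ rm)[i]? (ld.reverse ++ rd)[i]?

namespace ZipRep

variable {t : Tape} {lm ld rm rd : List Bool}

theorem read (h : ZipRep t lm ld rm rd) : t.read = codedSym rm.head? rd.head? := by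
  rw [Tape.read, h.cells, List.getElem?_append_right (by simp [h.lm_length]),
    List.getElem?_append_right (by simp [h.ld_length])]
  simp [h.lm_length, h.ld_length, List.head?_eq_getElem?]

theorem put (h : ZipRep t lm ld rm rd) (a : Sym) (d : Dir) :
    ZipRep (t.put (a, d)) (zipLeft lm a.mask d) (zipLeft ld a.value d)
      (zipRight lm rm a.mask d) (zipRight ld rd a.value d) := by
  have hh : (t.put (a, d)).head = d.apply t.head := by cases d <;> rfl
  have hc : (t.put (a, d)).cells = Function.update t.cells t.head a := by cases d <;> rfl
  refine ⟨by rw [length_zipLeft, h.lm_length, hh], by rw [length_zipLeft, h.ld_length, hh],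
    fun i => ?_⟩
  rw [hc, zip_getElem?, zip_getElem?, h.lm_length, h.ld_length]
  by_cases hi : i = t.head
  · rw [hi, Function.update_self, if_pos rfl, if_pos rfl, codedSym_code]
  · rw [Function.update_of_ne hi, if_neg hi, if_neg hi, h.cells]

theorem init (l : List Bool) : ZipRep (Tape.init l) [] [] (List.replicate l.length true) l := by
  refine ⟨rfl, rfl, fun i => ?_⟩
  simp only [Tape.init, Tape.contents, List.reverse_nil, List.nil_append]
  by_cases h : i < l.length
  · simp [h, codedSym]
  · simp [h, codedSym]

end ZipRep

/-- The bits coded by a string of masks and a string of values, up to the first blank. -/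
def codedBits : List Bool → List Bool → List Bool
  | true :: m, d => d.headD false :: codedBits m d.tail
  | _, _ => []

theorem codedBits_spec (m d : List Bool) :
    (∀ (i : ℕ) (hi : i < (codedBits m d).length),
      codedSym m[i]? d[i]? = Sym.ofBool (codedBits m d)[i]) ∧
    codedSym m[(codedBits m d).length]? d[(codedBits m d).length]? = .blank := by
  induction m generalizing d with
  | nil => simp [codedBits, codedSym]
  | cons b m ih =>
    cases b with
    | false => simp [codedBits, codedSym]
    | true =>
      obtain ⟨h1, h2⟩ := ih d.tail
      have hd : ∀ i, d[i + 1]? = d.tail[i]? := fun i => by cases d <;> simp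
      refine ⟨fun i hi => ?_, ?_⟩
      · rcases i with _ | i
        · cases d <;> simp [codedBits, codedSym]
        · simp only [codedBits, List.getElem?_cons_succ, List.getElem_cons_succ, hd]
          exact h1 i (by simpa [codedBits] using hi)
      · simpa only [codedBits, List.length_cons, List.getElem?_cons_succ, hd] using h2

theorem ZipRep.number {t : Tape} {lm ld rm rd : List Bool} (h : ZipRep t lm ld rm rd) :
    t.number = num (codedBits (lm.reverse ++ rm) (ld.reverse ++ rd)).reverse := by
  obtain ⟨h1, h2⟩ := codedBits_spec (lm.reverse ++ rm) (ld.reverse ++ rd)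
  exact Tape.number_eq (fun i hi => (h.cells i).trans (h1 i hi)) ((h.cells _).trans h2)

/-- One pass along the masks, with a third accumulator as a flag that becomes nonempty at the first
blank and stops the output. The bits are collected by pushing, which yields the order of `num`. -/
theorem Cob.codedBits_reverse {E : Type} {size : E → ℕ} {O : Oracles E} {ι : Type} {X Y : Fn E ι}
    (hX : Cob size O X) (hY : Cob size O Y) :
    Cob size O fun e s => (codedBits (X e s) (Y e s)).reverse := by
  have h0 : FinCob size O fun e (s : Fin 3 ⊕ ι → List Bool) => (s (.inl 2)).isEmpty :=
    FinCob.isNil (var _)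
  have h1 : FinCob size O fun e (s : Fin 3 ⊕ ι → List Bool) => (s (.inl 0)).headD false :=
    FinCob.headD (var _) false
  have key := foldAcc (size := size) (O := O) (κ := Fin 3) (A := List Bool × List Bool × List Bool)
    (X := X) (fun a => (a 0, a 1, a 2)) (fun a => ![a.1, a.2.1, a.2.2]) (fun _ => rfl)
    (I := fun e s => (Y e s, [], []))
    (fun b _ _ a => (a.1.tail,
      if (b && a.2.2.isEmpty) then a.1.headD false :: a.2.1 else a.2.1,
      if b then a.2.2 else [true])) 1 hX
    (fun j => by
      fin_cases j
      · exact hY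
      · exact nil
      · exact nil)
    (fun b j => by
      fin_cases j
      · exact (var _).tail
      · exact ite (h0.map fun c => b && c) (consBit h1 (var _)) (var _)
      · cases b
        · exact const [true]
        · exact var _)
    (fun j => ⟨1, fun N e s _ _ b M a ha => by
      have a0 := ha 0
      have a1 := ha 1
      have a2 := ha 2
      fin_cases j
      · simp
        omega
      · simp
        split
        · rw [List.length_cons]
          omega
        · omega
      · cases b <;> simp <;> omega⟩)
  convert key using 3 with e s
  have done_eq : ∀ (m d o : List Bool), ((m.foldl (fun (a : List Bool × List Bool × List Bool) b =>
      (a.1.tail, if (b && a.2.2.isEmpty) then a.1.headD false :: a.2.1 else a.2.1,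
        if b then a.2.2 else [true])) (d, o, [true])).2.1) = o := by
    intro m
    induction m with
    | nil => intros; rfl
    | cons b m ih =>
      intro d o
      cases b <;> simpa using ih _ _
  have main : ∀ (m d o : List Bool), ((m.foldl (fun (a : List Bool × List Bool × List Bool) b =>
      (a.1.tail, if (b && a.2.2.isEmpty) then a.1.headD false :: a.2.1 else a.2.1,
        if b then a.2.2 else [true])) (d, o, [])).2.1) = (codedBits m d).reverse ++ o := by
    intro m
    induction m with
    | nil => intros; rfl
    | cons b m ih =>
      intro d o
      cases b
      · simpa [codedBits] using done_eq m d.tail o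
      · simpa [codedBits] using ih _ _
  simpa using (main (X e s) (Y e s) []).symm

/-! ## Simulation of machines -/

section Total

variable {Γ : Type} (step : Γ → Option Γ) (acc : Set Γ)

open Classical in
/-- One step, where a configuration that accepts or stops is repeated. -/
noncomputable def totalStep (c : Γ) : Γ := if c ∈ acc then c else (step c).getD c

variable {step acc} {c₀ : Γ}

theorem exists_configAt_iterate (n : ℕ) : ∃ t, configAt step c₀ t = some ((totalStep step acc)^[n] c₀)
    := by
  induction n with
  | zero => exact ⟨0, rfl⟩
  | succ n ih =>
    obtain ⟨t, ht⟩ := ih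
    rw [Function.iterate_succ_apply', totalStep]
    split
    · exact ⟨t, ht⟩
    · cases h : step ((totalStep step acc)^[n] c₀) with
      | none => exact ⟨t, ht⟩
      | some c => exact ⟨t + 1, by rw [configAt, ht]; exact h⟩

/-- Freezing has no influence before the first acceptance. -/
theorem iterate_eq (n : ℕ) (hn : ∀ m < n, ∀ c, configAt step c₀ m = some c → c ∉ acc) {c : Γ}
    (hc : configAt step c₀ n = some c) : (totalStep step acc)^[n] c₀ = c := by
  induction n generalizing c with
  | zero => exact Option.some_inj.mp hc
  | succ n ih =>
    rw [configAt] at hc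
    obtain ⟨c', h1, h2⟩ := Option.bind_eq_some_iff.mp hc
    rw [Function.iterate_succ_apply', ih (fun m hm => hn m (by omega)) h1, totalStep,
      if_neg (hn n (by omega) _ h1), h2]
    rfl

/-- A machine may pass through an accepting state and go on, but the frozen dynamics stay at the
first acceptance, which happens within the time bound if at all. So it suffices to look at the
configuration after any sufficient number of steps. -/
theorem reachesAccepting_iff_iterate {T n : ℕ} (h : FinishesWithin step c₀ acc T) (hn : T ≤ n) :
    ReachesAccepting step c₀ acc ↔ (totalStep step acc)^[n] c₀ ∈ acc := by
  classical
  refine ⟨fun hr => ?_, fun hm => ?_⟩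
  · let P : ℕ → Prop := fun t => ∃ c, configAt step c₀ t = some c ∧ c ∈ acc
    have hP : ∃ t, P t := hr
    obtain ⟨c, h1, h2⟩ := Nat.find_spec hP
    -- Either an acceptance by time `T` is given, or the computation has stopped and nothing can be
    -- accepted afterwards.
    have hle : Nat.find hP ≤ T := by
      obtain ⟨t, ht, c', hc', hs⟩ := h
      rw [Option.mem_def] at hc'
      rcases hs with hs | hs
      · exact (Nat.find_min' hP ⟨c', hc', hs⟩).trans ht
      · by_contra hlt
        rw [configAt_of_lt hc' hs (by omega)] at h1
        cases h1
    have h3 := iterate_eq (acc := acc) (Nat.find hP)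
      (fun m hm c hc hcm => Nat.find_min hP hm ⟨c, hc, hcm⟩) h1
    obtain ⟨k, hk⟩ := Nat.exists_eq_add_of_le (hle.trans hn)
    have hfix : Function.IsFixedPt (totalStep step acc) c := by
      rw [Function.IsFixedPt, totalStep, if_pos h2]
    rw [hk, Nat.add_comm, Function.iterate_add_apply, h3, hfix.iterate k]
    exact h2
  · obtain ⟨t, ht⟩ := exists_configAt_iterate (step := step) (acc := acc) (c₀ := c₀) n
    exact ⟨t, _, ht, hm⟩

theorem configAt_map {Γ' : Type} {step' : Γ' → Option Γ'} {c₀' : Γ'} (φ : Γ' → Γ) (h0 : φ c₀' = c₀)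
    (h : ∀ c, step (φ c) = (step' c).map φ) (t : ℕ) :
    configAt step c₀ t = (configAt step' c₀' t).map φ := by
  induction t with
  | zero => simp [configAt, h0]
  | succ t ih =>
    rw [configAt, configAt, ih]
    cases configAt step' c₀' t <;> simp [h]

theorem reachesAccepting_map {Γ' : Type} {step' : Γ' → Option Γ'} {c₀' : Γ'} (φ : Γ' → Γ)
    (h0 : φ c₀' = c₀) (h : ∀ c, step (φ c) = (step' c).map φ) :
    ReachesAccepting step c₀ acc ↔ ReachesAccepting step' c₀' (φ ⁻¹' acc) := by
  simp [ReachesAccepting, configAt_map φ h0 h]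

theorem finishesWithin_map {Γ' : Type} {step' : Γ' → Option Γ'} {c₀' : Γ'} (φ : Γ' → Γ)
    (h0 : φ c₀' = c₀) (h : ∀ c, step (φ c) = (step' c).map φ) (T : ℕ) :
    FinishesWithin step c₀ acc T ↔ FinishesWithin step' c₀' (φ ⁻¹' acc) T := by
  simp [FinishesWithin, configAt_map φ h0 h, h]

end Total

/-- A machine with tapes and heads on read-only tapes that observes its environment. -/
structure Guest (E : Type) where
  Q : Type
  Wr : Type
  Ro : Type
  Obs : Type
  [finite_Q : Finite Q]
  [finite_Wr : Finite Wr]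
  [finite_Ro : Finite Ro]
  start : Q
  accept : Set Q
  δ : Q → (Wr → Sym) → Obs → Option (Q × (Wr → Sym × Dir) × (Ro → Dir))
  /-- The observation, which depends on the environment, on whether there was a step before, on the
  numbers on the tapes, and on the positions of the heads. -/
  obs : E → Bool → (Wr → ℕ) → (Ro → ℕ) → Obs
  input : Wr → List Bool

namespace Guest

attribute [instance] Guest.finite_Q Guest.finite_Wr Guest.finite_Ro

variable {E : Type} (G : Guest E)

/-- The configurations. -/
structure Config where
  state : G.Q
  started : Bool
  wr : G.Wr → Tape
  pos : G.Ro → ℕ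

/-- The initial configuration. -/
def initial : G.Config := ⟨G.start, false, fun l => Tape.init (G.input l), fun _ => 0⟩

/-- The configuration that results from an action. -/
def next (c : G.Config) (r : G.Q × (G.Wr → Sym × Dir) × (G.Ro → Dir)) : G.Config :=
  ⟨r.1, true, fun l => (c.wr l).put (r.2.1 l), fun l => (r.2.2 l).apply (c.pos l)⟩

/-- One step. -/
noncomputable def step (e : E) (c : G.Config) : Option G.Config :=
  (G.δ c.state (fun l => (c.wr l).read) (G.obs e c.started (fun l => (c.wr l).number) c.pos)).map
    (G.next c)

/-- The accepting configurations. -/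
def accepting : Set G.Config := {c | c.state ∈ G.accept}

/-- The registers of the simulation: the state, a mark that there was a step, four strings for each
tape, and the position of each head. -/
abbrev Reg := Fin 2 ⊕ (G.Wr × Fin 4) ⊕ G.Ro

variable {m : ℕ} (f : G.Q ≃ Fin m)

/-- The state that is coded by a number. -/
def decode (k : ℕ) : G.Q := if h : k < m then f.symm ⟨k, h⟩ else G.start

/-- The observation in terms of the registers. -/
noncomputable def regObs (e : E) (a : G.Reg → List Bool) : G.Obs :=
  G.obs e (!(a (.inl 1)).isEmpty) (fun l => num (codedBits
    ((a (.inr (.inl (l, 0)))).reverse ++ a (.inr (.inl (l, 2))))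
    ((a (.inr (.inl (l, 1)))).reverse ++ a (.inr (.inl (l, 3))))).reverse)
    fun l => (a (.inr (.inr l))).length

open Classical in
/-- The action in terms of the registers, if the configuration does not accept. -/
noncomputable def regAction (e : E) (a : G.Reg → List Bool) :
    Option (G.Q × (G.Wr → Sym × Dir) × (G.Ro → Dir)) :=
  if G.decode f (a (.inl 0)).length ∈ G.accept then none else
    G.δ (G.decode f (a (.inl 0)).length)
      (fun l => codedSym (a (.inr (.inl (l, 2)))).head? (a (.inr (.inl (l, 3)))).head?)
      (G.regObs e a)

/-- The content of the registers after an action. -/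
def regNext (a : G.Reg → List Bool) (r : G.Q × (G.Wr → Sym × Dir) × (G.Ro → Dir)) :
    G.Reg → List Bool
  | .inl 0 => List.replicate (f r.1) true
  | .inl 1 => [true]
  | .inr (.inl (l, 0)) => zipLeft (a (.inr (.inl (l, 0)))) (r.2.1 l).1.mask (r.2.1 l).2
  | .inr (.inl (l, 1)) => zipLeft (a (.inr (.inl (l, 1)))) (r.2.1 l).1.value (r.2.1 l).2
  | .inr (.inl (l, 2)) => zipRight (a (.inr (.inl (l, 0)))) (a (.inr (.inl (l, 2))))
      (r.2.1 l).1.mask (r.2.1 l).2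
  | .inr (.inl (l, 3)) => zipRight (a (.inr (.inl (l, 1)))) (a (.inr (.inl (l, 3))))
      (r.2.1 l).1.value (r.2.1 l).2
  | .inr (.inr l) => zipLeft (a (.inr (.inr l))) true (r.2.2 l)

/-- The content of the registers after one step. -/
noncomputable def regStep (e : E) (a : G.Reg → List Bool) : G.Reg → List Bool :=
  (G.regAction f e a).elim a (G.regNext f a)

/-- The initial content of the registers. -/
def regInit : G.Reg → List Bool
  | .inl 0 => List.replicate (f G.start) true
  | .inr (.inl (l, 2)) => List.replicate (G.input l).length true
  | .inr (.inl (l, 3)) => G.input l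
  | _ => []

/-- The registers represent a configuration. -/
structure Rep (c : G.Config) (a : G.Reg → List Bool) : Prop where
  state : G.decode f (a (.inl 0)).length = c.state
  started : (!(a (.inl 1)).isEmpty) = c.started
  wr l : ZipRep (c.wr l) (a (.inr (.inl (l, 0)))) (a (.inr (.inl (l, 1))))
    (a (.inr (.inl (l, 2)))) (a (.inr (.inl (l, 3))))
  pos l : (a (.inr (.inr l))).length = c.pos l

variable {G f}

theorem Rep.init : G.Rep f G.initial (G.regInit f) where
  state := by simp [regInit, initial, decode]
  started := rfl
  wr l := ZipRep.init _
  pos l := rfl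

/-- The machine and the registers choose the same action, as scanned symbols, numbers on tapes and
head positions can be read off the registers; both stand still when there is none. -/
theorem Rep.step {c : G.Config} {a : G.Reg → List Bool} (h : G.Rep f c a) (e : E) :
    G.Rep f (totalStep (G.step e) G.accepting c) (G.regStep f e a) := by
  have hobs : G.regObs e a = G.obs e c.started (fun l => (c.wr l).number) c.pos := by
    rw [regObs, h.started]
    congr 1
    · exact funext fun l => (h.wr l).number.symm
    · exact funext h.pos
  have hread : (fun l => codedSym (a (.inr (.inl (l, 2)))).head? (a (.inr (.inl (l, 3)))).head?) =
      fun l => (c.wr l).read := funext fun l => (h.wr l).read.symm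
  rw [totalStep, regStep, regAction, hobs, hread, h.state]
  by_cases hacc : c.state ∈ G.accept
  · rw [if_pos hacc, if_pos (show c ∈ G.accepting from hacc)]
    exact h
  rw [if_neg hacc, if_neg (show c ∉ G.accepting from hacc), Guest.step]
  cases G.δ c.state (fun l => (c.wr l).read)
    (G.obs e c.started (fun l => (c.wr l).number) c.pos) with
  | none => exact h
  | some r =>
    exact {
      state := by simp [regNext, next, decode]
      started := rfl
      wr := fun l => (h.wr l).put _ _
      pos := fun l => by
        simp only [Option.elim_some, regNext, length_zipLeft, h.pos]
        rfl }

theorem Rep.iterate (e : E) (n : ℕ) :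
    G.Rep f ((totalStep (G.step e) G.accepting)^[n] G.initial)
      ((G.regStep f e)^[n] (G.regInit f)) := by
  induction n with
  | zero => exact Rep.init
  | succ n ih =>
    rw [Function.iterate_succ_apply', Function.iterate_succ_apply']
    exact ih.step e

/-! ### The simulation inside the algebra -/

section Cob

variable {size : E → ℕ} {O : Oracles E}

variable (G size O) in
/-- The observations can be computed from the numbers on the tapes in binary, and from the positions
of the heads in unary. -/
def Observable : Prop :=
  ∀ {ι : Type} (b : Bool) (X : G.Wr → Fn E ι) (Y : G.Ro → Fn E ι), (∀ l, Cob size O (X l)) →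
    (∀ l, Cob size O (Y l)) →
    FinCob size O fun e s => G.obs e b (fun l => num (X l e s)) fun l => (Y l e s).length

theorem cob_zipLeft {ι : Type} {X : Fn E ι} (hX : Cob size O X) (b : Bool) (d : Dir) :
    Cob size O fun e s => zipLeft (X e s) b d := by
  cases d
  · exact hX.tail
  · exact hX.cons b
  · exact hX

theorem cob_zipRight {ι : Type} {X Y : Fn E ι} (hX : Cob size O X) (hY : Cob size O Y) (b : Bool)
    (d : Dir) : Cob size O fun e s => zipRight (X e s) (Y e s) b d := by
  cases d
  · exact Cob.case (fun o e s => o.toList ++ b :: (Y e s).tail) hX fun o =>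
      (Cob.const o.toList).append (hY.tail.cons b)
  · exact hY.tail
  · exact hY.tail.cons b

/-- State, scanned symbols and observation can each be distinguished by cases, and the action
depends on them alone. So the transition function enters as a finite table and needs no coding. -/
theorem finCob_regAction (hobs : G.Observable size O) {ι : Type} {A : G.Reg → Fn E ι}
    (hA : ∀ k, Cob size O (A k)) :
    FinCob size O fun e s => G.regAction f e fun k => A k e s := by
  classical
  have hq : FinCob size O fun e s => G.decode f (A (.inl 0) e s).length := by
    -- All lengths from `m` on decode to the same default state, so truncating the length at `m`
    -- loses nothing.
    convert (FinCob.length_min (hA (.inl 0)) m).map (G.decode f) using 3 with e s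
    rcases le_or_gt (A (.inl 0) e s).length m with h | h
    · rw [min_eq_left h]
    · rw [min_eq_right h.le, decode, decode, dif_neg (by omega), dif_neg (by omega)]
  have hr : FinCob size O fun e s l => codedSym (A (.inr (.inl (l, 2))) e s).head?
      (A (.inr (.inl (l, 3))) e s).head? :=
    FinCob.pi fun l => (FinCob.head? (hA _)).map₂ (FinCob.head? (hA _)) codedSym
  have ho : FinCob size O fun e s => G.regObs e fun k => A k e s := by
    intro F hF
    have hb := (FinCob.isNil (hA (.inl 1))).map not
    exact hb (fun b e s => F (G.obs e b _ _) e s) fun b =>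
      hobs b (fun l e s => (codedBits
        ((A (.inr (.inl (l, 0))) e s).reverse ++ A (.inr (.inl (l, 2))) e s)
        ((A (.inr (.inl (l, 1))) e s).reverse ++ A (.inr (.inl (l, 3))) e s)).reverse)
        (fun l e s => A (.inr (.inr l)) e s)
        (fun l => Cob.codedBits_reverse (Cob.reverse_append (hA _) (hA _))
          (Cob.reverse_append (hA _) (hA _))) (fun l => hA _) F hF
  exact hq.map₂ (hr.pair ho) fun q p => if q ∈ G.accept then none else G.δ q p.1 p.2

theorem cob_regNext {ι : Type} {A : G.Reg → Fn E ι} (hA : ∀ k, Cob size O (A k))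
    (r : G.Q × (G.Wr → Sym × Dir) × (G.Ro → Dir)) (k : G.Reg) :
    Cob size O fun e s => G.regNext f (fun k => A k e s) r k := by
  rcases k with k | ⟨l, k⟩ | l
  · fin_cases k
    · exact Cob.const _
    · exact Cob.const [true]
  · fin_cases k
    · exact cob_zipLeft (hA _) _ _
    · exact cob_zipLeft (hA _) _ _
    · exact cob_zipRight (hA _) (hA _) _ _
    · exact cob_zipRight (hA _) (hA _) _ _
  · exact cob_zipLeft (hA _) _ _

theorem length_zipLeft_le (l : List Bool) (b : Bool) (d : Dir) :
    (zipLeft l b d).length ≤ l.length + 1 := by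
  cases d <;> simp [zipLeft]
  omega

theorem length_zipRight_le (l r : List Bool) (b : Bool) (d : Dir) :
    (zipRight l r b d).length ≤ r.length + 2 := by
  have : l.head?.toList.length ≤ 1 := by cases l <;> simp
  cases d <;> simp [zipRight] <;> omega

/-- A step of a machine lengthens its registers by a constant only, which is the growth condition
for recursion. -/
theorem length_regStep_le (e : E) (a : G.Reg → List Bool) (M : ℕ) (ha : ∀ k, (a k).length ≤ M)
    (k : G.Reg) : (G.regStep f e a k).length ≤ M + (m + 2) := by
  rw [regStep]
  cases G.regAction f e a with
  | none => exact (ha k).trans (by omega)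
  | some r =>
    rcases k with k | ⟨l, k⟩ | l
    · fin_cases k
      · simp only [Option.elim_some, regNext, Fin.zero_eta, List.length_replicate]
        have := (f r.1).2
        omega
      · simp [regNext]
        omega
    · fin_cases k
      · exact (length_zipLeft_le _ _ _).trans (by have := ha (Sum.inr (Sum.inl (l, 0))); omega)
      · exact (length_zipLeft_le _ _ _).trans (by have := ha (Sum.inr (Sum.inl (l, 1))); omega)
      · exact (length_zipRight_le _ _ _ _).trans (by have := ha (Sum.inr (Sum.inl (l, 2))); omega)
      · exact (length_zipRight_le _ _ _ _).trans (by have := ha (Sum.inr (Sum.inl (l, 3))); omega)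
    · exact (length_zipLeft_le _ _ _).trans (by have := ha (Sum.inr (Sum.inr l)); omega)

/-- The bits of `X` are ignored: the string serves as a clock, one simulated step per bit. -/
theorem cob_iterate (hobs : G.Observable size O) {X : Fn E Empty} (hX : Cob size O X)
    (k : G.Reg) : Cob size O fun e s => (G.regStep f e)^[(X e s).length] (G.regInit f) k := by
  have hg : ∀ j, Cob size O fun e (s : G.Reg ⊕ Empty → List Bool) =>
      G.regStep f e (fun k => s (.inl k)) j := fun j => by
    have h := finCob_regAction (f := f) hobs
      (A := fun k _ (s : G.Reg ⊕ Empty → List Bool) => s (.inl k)) (fun k => .var _)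
      (fun r _ s => r.elim (fun k => s (.inl k)) (G.regNext f fun k => s (.inl k)) j) fun r => by
        cases r with
        | none => exact .var _
        | some r => exact cob_regNext (fun k => .var _) r j
    exact h
  have key := Cob.fold (size := size) (O := O) (X := X) (I := fun k _ _ => G.regInit f k)
    (fun _ k e (s : G.Reg ⊕ Empty → List Bool) => G.regStep f e (fun k => s (.inl k)) k) k hX
    (fun j => Cob.const _) (fun _ => hg) ?_
  · convert key using 3 with e s
    generalize X e s = x
    generalize G.regInit f = a
    induction x generalizing a with
    | nil => rfl
    | cons b x ih => exact ih (G.regStep f e a)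
  · obtain ⟨d, hd⟩ := PolyBdd.const (m + 2)
    exact ⟨d, fun N e s _ _ b M a ha j => (length_regStep_le e a M ha j).trans
      (Nat.add_le_add_left (hd N) M)⟩

/-- The class that is decided by a machine within a time for which there is a clock is decided by a
function in the algebra. -/
theorem exists_cob (G : Guest E) (hobs : G.Observable size O) {X : Fn E Empty} (hX : Cob size O X)
    (hfin : ∀ e, FinishesWithin (G.step e) G.initial G.accepting
      (X e fun i => i.elim).length) :
    ∃ F : Fn E Empty, Cob size O F ∧ ∀ e,
      (ReachesAccepting (G.step e) G.initial G.accepting ↔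
        (F e fun i => i.elim).head? = some true) := by
  classical
  obtain ⟨m, ⟨f⟩⟩ := Finite.exists_equiv_fin G.Q
  have hk := cob_iterate (f := f) hobs hX (.inl 0)
  refine ⟨fun e s => if decide (G.decode f (min
    ((G.regStep f e)^[(X e s).length] (G.regInit f) (.inl 0)).length m) ∈ G.accept) then [true]
      else [], Cob.ite ((FinCob.length_min hk m).map fun k => decide (G.decode f k ∈ G.accept))
        (Cob.const _) (Cob.const _), fun e => ?_⟩
  have hrep := Rep.iterate (G := G) (f := f) e (X e fun i => i.elim).length
  have hmin : ∀ k, G.decode f (min k m) = G.decode f k := fun k => by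
    rcases le_or_gt k m with h | h
    · rw [min_eq_left h]
    · rw [min_eq_right h.le, decode, decode, dif_neg (by omega), dif_neg (by omega)]
  rw [reachesAccepting_iff_iterate (hfin e) le_rfl]
  beta_reduce
  rw [hmin, hrep.state]
  change _ ∈ G.accept ↔ _
  split <;> simp_all

end Cob

end Guest

end PolylogTM

namespace PolylogTM

/-! ## Arithmetic on bit strings -/

theorem num_eq_head_tail (x : List Bool) : num x = (x.headD false).toNat + 2 * num x.tail := by
  cases x <;> simp [num]

/-- The bits and the carry that result from `k` steps of a transducer that reads two strings. -/
def ripple (f : Bool → Bool → Bool → Bool × Bool) :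
    ℕ → List Bool → List Bool → Bool → List Bool × Bool
  | 0, _, _, c => ([], c)
  | k + 1, x, y, c =>
    ((f (x.headD false) (y.headD false) c).1 ::
      (ripple f k x.tail y.tail (f (x.headD false) (y.headD false) c).2).1,
      (ripple f k x.tail y.tail (f (x.headD false) (y.headD false) c).2).2)

theorem length_ripple (f : Bool → Bool → Bool → Bool × Bool) (k : ℕ) (x y : List Bool) (c : Bool) :
    (ripple f k x y c).1.length = k := by
  induction k generalizing x y c with
  | zero => rfl
  | succ k ih => simp [ripple, ih]

/-- One step of the addition. -/
def addBit (a b c : Bool) : Bool × Bool := (a ^^ b ^^ c, (a && b) || (a && c) || (b && c))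

/-- One step of the subtraction. -/
def subBit (a b c : Bool) : Bool × Bool := (a ^^ b ^^ c, (!a && b) || (!a && c) || (b && c))

theorem num_ripple_addBit (k : ℕ) (x y : List Bool) (c : Bool) (hx : x.length ≤ k)
    (hy : y.length ≤ k) :
    num (ripple addBit k x y c).1 + 2 ^ k * (ripple addBit k x y c).2.toNat =
      num x + num y + c.toNat := by
  induction k generalizing x y c with
  | zero =>
    obtain rfl := List.length_eq_zero_iff.mp (Nat.le_zero.mp hx)
    obtain rfl := List.length_eq_zero_iff.mp (Nat.le_zero.mp hy)
    simp [ripple, num]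
  | succ k ih =>
    have := ih x.tail y.tail (addBit (x.headD false) (y.headD false) c).2 (by simpa) (by simpa)
    rw [num_eq_head_tail x, num_eq_head_tail y, ripple, num, pow_succ]
    generalize x.headD false = a at *
    generalize y.headD false = b at *
    dsimp only
    have h : (addBit a b c).1.toNat + 2 * (addBit a b c).2.toNat = a.toNat + b.toNat + c.toNat := by
      cases a <;> cases b <;> cases c <;> rfl
    linarith

/-- The borrow is accounted for on the side of the minuend, so no truncated subtraction occurs. The
final borrow is the comparison of the two numbers. -/
theorem num_ripple_subBit (k : ℕ) (x y : List Bool) (c : Bool) (hx : x.length ≤ k)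
    (hy : y.length ≤ k) :
    num (ripple subBit k x y c).1 + num y + c.toNat =
      num x + 2 ^ k * (ripple subBit k x y c).2.toNat := by
  induction k generalizing x y c with
  | zero =>
    obtain rfl := List.length_eq_zero_iff.mp (Nat.le_zero.mp hx)
    obtain rfl := List.length_eq_zero_iff.mp (Nat.le_zero.mp hy)
    simp [ripple, num]
  | succ k ih =>
    have := ih x.tail y.tail (subBit (x.headD false) (y.headD false) c).2 (by simpa) (by simpa)
    rw [num_eq_head_tail x, num_eq_head_tail y, ripple, num, pow_succ]
    generalize x.headD false = a at *
    generalize y.headD false = b at *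
    dsimp only
    have h : (subBit a b c).1.toNat + b.toNat + c.toNat = a.toNat + 2 * (subBit a b c).2.toNat := by
      cases a <;> cases b <;> cases c <;> rfl
    linarith

/-- The sum of two bit strings. -/
def addBits (x y : List Bool) : List Bool :=
  (ripple addBit (true :: (x ++ y)).length x y false).1

/-- The difference of two bit strings, if the first one is not smaller. -/
def subBits (x y : List Bool) : List Bool :=
  (ripple subBit (true :: (x ++ y)).length x y false).1

/-- The comparison of two bit strings. -/
def ltBits (x y : List Bool) : Bool :=
  (ripple subBit (true :: (x ++ y)).length x y false).2

theorem length_addBits (x y : List Bool) : (addBits x y).length = x.length + y.length + 1 := by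
  simp [addBits, length_ripple]

theorem length_subBits (x y : List Bool) : (subBits x y).length = x.length + y.length + 1 := by
  simp [subBits, length_ripple]

theorem num_addBits (x y : List Bool) : num (addBits x y) = num x + num y := by
  have := num_ripple_addBit (true :: (x ++ y)).length x y false (by simp; omega) (by simp; omega)
  have hx := num_lt x
  have hy := num_lt y
  -- One digit more than both strings together leaves room for the sum, so the last carry is 0.
  have h : num x + num y < 2 ^ (true :: (x ++ y)).length := by
    have h1 : 2 ^ x.length ≤ 2 ^ (x ++ y).length := Nat.pow_le_pow_right (by omega) (by simp)
    have h2 : 2 ^ y.length ≤ 2 ^ (x ++ y).length := Nat.pow_le_pow_right (by omega) (by simp)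
    rw [List.length_cons, pow_succ]
    omega
  rw [addBits]
  generalize (ripple addBit (true :: (x ++ y)).length x y false).2 = c at this
  cases c
  · simpa using this
  · rw [Bool.toNat_true, Bool.toNat_false] at this
    omega

theorem ltBits_eq (x y : List Bool) : ltBits x y = decide (num x < num y) := by
  have := num_ripple_subBit (true :: (x ++ y)).length x y false (by simp; omega) (by simp; omega)
  have h := num_lt (ripple subBit (true :: (x ++ y)).length x y false).1
  rw [length_ripple] at h
  rw [ltBits]
  generalize (ripple subBit (true :: (x ++ y)).length x y false).2 = c at this
  cases c
  · rw [Bool.toNat_false] at this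
    symm
    rw [decide_eq_false_iff_not]
    omega
  · rw [Bool.toNat_true, Bool.toNat_false] at this
    symm
    rw [decide_eq_true_iff]
    omega

theorem num_subBits {x y : List Bool} (hxy : num y ≤ num x) :
    num (subBits x y) = num x - num y := by
  have := num_ripple_subBit (true :: (x ++ y)).length x y false (by simp; omega) (by simp; omega)
  have h := ltBits_eq x y
  rw [decide_eq_false (by omega), ltBits] at h
  rw [h, Bool.toNat_false] at this
  rw [subBits]
  omega

namespace Cob

variable {E : Type} {size : E → ℕ} {O : Oracles E} {ι : Type}

theorem ripple_fold (f : Bool → Bool → Bool → Bool × Bool) {X Y Z : Fn E ι} (hX : Cob size O X)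
    (hY : Cob size O Y) (hZ : Cob size O Z) :
    (Cob size O fun e s => (ripple f (Z e s).length (X e s) (Y e s) false).1) ∧
      FinCob size O fun e s => (ripple f (Z e s).length (X e s) (Y e s) false).2 := by
  have hf : FinCob size O fun e (s : Fin 4 ⊕ ι → List Bool) =>
      f ((s (.inl 0)).headD false) ((s (.inl 1)).headD false) ((s (.inl 2)).headD false) :=
    (((FinCob.headD (var _) false).pair (FinCob.headD (var _) false)).map₂
      (FinCob.headD (var _) false) fun p c => f p.1 p.2 c)
  have key := fun k => foldAcc (size := size) (O := O) (κ := Fin 4)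
    (A := List Bool × List Bool × Bool × List Bool)
    (X := Z) (fun a => (a 0, a 1, (a 2).headD false, a 3))
    (fun a => ![a.1, a.2.1, [a.2.2.1], a.2.2.2]) (fun _ => rfl)
    (I := fun e s => (X e s, Y e s, false, []))
    (fun _ _ _ a => (a.1.tail, a.2.1.tail,
      (f (a.1.headD false) (a.2.1.headD false) a.2.2.1).2,
      (f (a.1.headD false) (a.2.1.headD false) a.2.2.1).1 :: a.2.2.2)) k hZ
    (fun j => by
      fin_cases j
      · exact hX
      · exact hY
      · exact const [false]
      · exact nil)
    (fun b j => by
      fin_cases j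
      · exact (var _).tail
      · exact (var _).tail
      · exact consBit (hf.map Prod.snd) nil
      · exact consBit (hf.map Prod.fst) (var _))
    (fun j => ⟨1, fun N e s _ _ b M a ha => by
      have a0 := ha 0
      have a1 := ha 1
      have a3 := ha 3
      fin_cases j <;> simp <;> omega⟩)
  have main : ∀ (z x y : List Bool) (c : Bool) (o : List Bool),
      (z.foldl (fun (a : List Bool × List Bool × Bool × List Bool) _ => (a.1.tail, a.2.1.tail,
        (f (a.1.headD false) (a.2.1.headD false) a.2.2.1).2,
        (f (a.1.headD false) (a.2.1.headD false) a.2.2.1).1 :: a.2.2.2)) (x, y, c, o)).2.2 =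
      ((ripple f z.length x y c).2, (ripple f z.length x y c).1.reverse ++ o) := by
    intro z
    induction z with
    | nil => intros; rfl
    | cons b z ih =>
      intro x y c o
      rw [List.foldl_cons, ih]
      simp [ripple]
  refine ⟨?_, ?_⟩
  · convert (key 3).reverse using 3 with e s
    have := congrArg Prod.snd (main (Z e s) (X e s) (Y e s) false [])
    rw [List.append_nil] at this
    exact List.reverse_eq_iff.mp this.symm |>.trans (by rfl)
  · convert FinCob.headD (key 2) false using 3 with e s
    exact (congrArg Prod.fst (main (Z e s) (X e s) (Y e s) false [])).symm

theorem addBits {X Y : Fn E ι} (hX : Cob size O X) (hY : Cob size O Y) :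
    Cob size O fun e s => addBits (X e s) (Y e s) :=
  (ripple_fold addBit hX hY ((hX.append hY).cons true)).1

theorem subBits {X Y : Fn E ι} (hX : Cob size O X) (hY : Cob size O Y) :
    Cob size O fun e s => subBits (X e s) (Y e s) :=
  (ripple_fold subBit hX hY ((hX.append hY).cons true)).1

theorem ltBits {X Y : Fn E ι} (hX : Cob size O X) (hY : Cob size O Y) :
    FinCob size O fun e s => ltBits (X e s) (Y e s) :=
  (ripple_fold subBit hX hY ((hX.append hY).cons true)).2

end Cob

/-- Functions with values in the natural numbers that can be computed in binary. -/
def NumCob {E : Type} (size : E → ℕ) (O : Oracles E) {ι : Type} (φ : E → (ι → List Bool) → ℕ) :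
    Prop :=
  ∃ F : Fn E ι, Cob size O F ∧ ∀ e s, num (F e s) = φ e s

/-! ### Arithmetic with numbers in binary -/

section NumCob

variable {E : Type} {size : E → ℕ} {O : Oracles E} {ι : Type} {φ ψ : E → (ι → List Bool) → ℕ}

theorem Cob.numCob {X : Fn E ι} (hX : Cob size O X) : NumCob size O fun e s => num (X e s) :=
  ⟨X, hX, fun _ _ => rfl⟩

namespace NumCob

theorem zero : NumCob (ι := ι) size O fun _ _ => 0 := ⟨_, .nil, fun _ _ => rfl⟩

theorem one : NumCob (ι := ι) size O fun _ _ => 1 := ⟨_, .const [true], fun _ _ => rfl⟩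

theorem add (hφ : NumCob size O φ) (hψ : NumCob size O ψ) :
    NumCob size O fun e s => φ e s + ψ e s := by
  obtain ⟨X, hX, hX'⟩ := hφ
  obtain ⟨Y, hY, hY'⟩ := hψ
  exact ⟨_, hX.addBits hY, fun e s => by rw [num_addBits, hX', hY']⟩

theorem lt (hφ : NumCob size O φ) (hψ : NumCob size O ψ) :
    FinCob size O fun e s => decide (φ e s < ψ e s) := by
  obtain ⟨X, hX, hX'⟩ := hφ
  obtain ⟨Y, hY, hY'⟩ := hψ
  convert hX.ltBits hY using 3
  rw [ltBits_eq, hX', hY']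

theorem sub (hφ : NumCob size O φ) (hψ : NumCob size O ψ) :
    NumCob size O fun e s => φ e s - ψ e s := by
  have hlt := hφ.lt hψ
  obtain ⟨X, hX, hX'⟩ := hφ
  obtain ⟨Y, hY, hY'⟩ := hψ
  refine ⟨_, Cob.ite hlt .nil (hX.subBits hY), fun e s => ?_⟩
  simp only [decide_eq_true_eq]
  split
  · simp [num]
    omega
  · rw [num_subBits (by rw [hX', hY']; omega), hX', hY']

/-- Horner's scheme along the digits of one factor, most significant first. Each round doubles the
accumulator by one new digit and adds the other factor, so the growth is additive. -/
theorem mul (hφ : NumCob size O φ) (hψ : NumCob size O ψ) :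
    NumCob size O fun e s => φ e s * ψ e s := by
  obtain ⟨X, hX, hX'⟩ := hφ
  obtain ⟨Y, hY, hY'⟩ := hψ
  -- The recursion is set up with the factors as plain arguments, whose lengths the growth condition
  -- bounds by N; the actual factors are composed in afterwards.
  have key := Cob.fold₁ (size := size) (O := O) (ι := Fin 1 ⊕ Fin 1)
    (X := fun _ s => s (.inl 0)) (I := fun _ _ => [])
    (fun b _ s a => addBits (false :: a) (if b then s (.inr 0) else [])) (.var _) .nil
    (fun b => Cob.addBits ((Cob.var _).cons false) (by
      cases b
      · exact .nil
      · exact .var _)) ⟨2, fun N e s _ h b a => by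
        have := h (.inr 0)
        rw [length_addBits, List.length_cons]
        have : (if b then s (.inr 0) else []).length ≤ N := by cases b <;> simp [this]
        nlinarith⟩
  have key' := key.comp (G := Sum.elim (fun _ e s => (X e s).reverse) fun _ => Y) fun j => by
    rcases j with j | j
    · exact hX.reverse
    · exact hY
  refine ⟨_, key', fun e s => ?_⟩
  simp only [Sum.elim_inl, Sum.elim_inr]
  rw [← hX', ← hY', List.foldl_reverse]
  induction X e s with
  | nil => simp [num]
  | cons b x ih =>
    rw [List.foldr_cons, num_addBits, num, ih, num]
    cases b
    · simp [num]
      ring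
    · simp
      ring

theorem pow (hφ : NumCob size O φ) (k : ℕ) : NumCob size O fun e s => φ e s ^ k := by
  induction k with
  | zero => simpa using one
  | succ k ih => simpa only [pow_succ] using ih.mul hφ

theorem const_mul (hφ : NumCob size O φ) (k : ℕ) : NumCob size O fun e s => k * φ e s := by
  induction k with
  | zero => simpa using zero
  | succ k ih => simpa only [Nat.succ_mul] using ih.add hφ

theorem sum {κ : Type} [Fintype κ] {φ : κ → E → (ι → List Bool) → ℕ}
    (hφ : ∀ j, NumCob size O (φ j)) : NumCob size O fun e s => ∑ j, φ j e s := by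
  classical
  have : ∀ t : Finset κ, NumCob size O fun e s => ∑ j ∈ t, φ j e s := fun t => by
    induction t using Finset.induction_on with
    | empty => simpa using zero
    | insert j t hj ih => simpa only [Finset.sum_insert hj] using (hφ j).add ih
  exact this _

theorem comp {κ : Type} [Finite κ] {φ : E → (κ → List Bool) → ℕ} (hφ : NumCob size O φ)
    {G : κ → Fn E ι} (hG : ∀ j, Cob size O (G j)) :
    NumCob size O fun e s => φ e fun j => G j e s := by
  obtain ⟨X, hX, hX'⟩ := hφ
  exact ⟨_, hX.comp hG, fun e s => hX' e _⟩

theorem of_empty {f : E → ℕ} (h : NumCob (ι := Empty) size O fun e _ => f e) :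
    NumCob (ι := ι) size O fun e _ => f e :=
  h.comp (G := fun j => j.elim) fun j => j.elim

end NumCob

/-- Long division of bit strings, most significant bit first: the quotient and the remainder. -/
def divStep (y : List Bool) (a : List Bool × List Bool) (b : Bool) : List Bool × List Bool :=
  ((!ltBits (b :: a.2) y) :: a.1, if ltBits (b :: a.2) y then b :: a.2 else subBits (b :: a.2) y)

/-- School division: a remainder r < y becomes 2r + b < 2y after the next digit, so the next digit
of the quotient is 0 or 1 and one subtraction suffices. -/
theorem divStep_spec (y : List Bool) (hy : 0 < num y) (x : List Bool) :
    num (x.foldr (fun b a => divStep y a b) ([], [])).1 = num x / num y ∧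
      num (x.foldr (fun b a => divStep y a b) ([], [])).2 = num x % num y := by
  induction x with
  | nil => simp [num]
  | cons b x ih =>
    obtain ⟨h1, h2⟩ := ih
    rw [List.foldr_cons]
    set a := x.foldr (fun b a => divStep y a b) ([], [])
    rw [divStep, ltBits_eq]
    have hlt := Nat.mod_lt (num x) hy
    have hb := Bool.toNat_lt b
    have hdiv := Nat.div_add_mod (num x) (num y)
    have hn : num (b :: a.2) = b.toNat + 2 * (num x % num y) := by rw [num, h2]
    have hx : num (b :: x) = b.toNat + 2 * num x := num.eq_2 ..
    rw [hx]
    by_cases h : num (b :: a.2) < num y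
    · rw [decide_eq_true h, if_pos rfl, num, h1]
      dsimp only
      rw [hn] at h ⊢
      rw [Bool.not_true, Bool.toNat_false, Nat.zero_add, eq_comm, @eq_comm _ _ (_ % _)]
      refine (Nat.div_mod_unique hy).mpr ⟨?_, h⟩
      linarith
    · rw [decide_eq_false h, if_neg (by simp), num, h1]
      dsimp only
      rw [num_subBits (by omega)]
      rw [hn] at h ⊢
      rw [Bool.not_false, Bool.toNat_true, eq_comm, @eq_comm _ _ (_ % _)]
      refine (Nat.div_mod_unique hy).mpr ⟨?_, by omega⟩
      have : num y * (1 + 2 * (num x / num y)) = num y + 2 * (num y * (num x / num y)) := by ring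
      omega

/-- Leading zeros of the remainder are never removed. This is harmless, as a round adds at most the
length of the divisor and two digits. -/
theorem Cob.div_mod {X Y : Fn E ι} (hX : Cob size O X) (hY : Cob size O Y) :
    (Cob size O fun e s => ((X e s).foldr (fun b a => divStep (Y e s) a b) ([], [])).1) ∧
    (Cob size O fun e s => ((X e s).foldr (fun b a => divStep (Y e s) a b) ([], [])).2) := by
  have hlt : ∀ b, FinCob size O fun e (s : Fin 2 ⊕ Fin 1 ⊕ Fin 1 → List Bool) =>
      PolylogTM.ltBits (b :: s (.inl 1)) (s (.inr (.inr 0))) := fun b =>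
    Cob.ltBits ((var _).cons b) (var _)
  have key := fold₂ (size := size) (O := O) (ι := Fin 1 ⊕ Fin 1)
    (X := fun _ s => s (.inl 0)) (I₁ := fun _ _ => []) (I₂ := fun _ _ => [])
    (fun b _ s a => (divStep (s (.inr 0)) a b).1) (fun b _ s a => (divStep (s (.inr 0)) a b).2)
    (var _) nil nil (fun b => consBit ((hlt b).map not) (var _))
    (fun b => ite (hlt b) ((var _).cons b) (((var _).cons b).subBits (var _)))
    ⟨0, fun N e s _ h b a => by simp [divStep]⟩
    ⟨2, fun N e s _ h b a => by
      have := h (.inr 0)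
      have h2 := le_max_right a.1.length a.2.length
      simp only [divStep, len₂]
      split
      · rw [List.length_cons]
        nlinarith
      · rw [length_subBits, List.length_cons]
        nlinarith⟩
  have hG : ∀ j, Cob size O (Sum.elim (fun (_ : Fin 1) e s => (X e s).reverse)
      (fun (_ : Fin 1) => Y) j) := fun j => by
    rcases j with j | j
    · exact hX.reverse
    · exact hY
  have k1 := key.1.comp hG
  have k2 := key.2.comp hG
  simp only [Sum.elim_inl, Sum.elim_inr, List.foldl_reverse] at k1 k2
  exact ⟨k1, k2⟩

theorem NumCob.div (hφ : NumCob size O φ) (hψ : NumCob size O ψ) (h : ∀ e s, 0 < ψ e s) :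
    NumCob size O fun e s => φ e s / ψ e s := by
  obtain ⟨X, hX, hX'⟩ := hφ
  obtain ⟨Y, hY, hY'⟩ := hψ
  exact ⟨_, (hX.div_mod hY).1, fun e s => by
    rw [(divStep_spec _ (by rw [hY']; exact h e s) _).1, hX', hY']⟩

theorem NumCob.mod (hφ : NumCob size O φ) (hψ : NumCob size O ψ) (h : ∀ e s, 0 < ψ e s) :
    NumCob size O fun e s => φ e s % ψ e s := by
  obtain ⟨X, hX, hX'⟩ := hφ
  obtain ⟨Y, hY, hY'⟩ := hψ
  exact ⟨_, (hX.div_mod hY).2, fun e s => by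
    rw [(divStep_spec _ (by rw [hY']; exact h e s) _).2, hX', hY']⟩

/-! ## Lengths and positions -/

theorem Cob.length {X : Fn E ι} (hX : Cob size O X) : NumCob size O fun e s => (X e s).length := by
  have := fold₁ (fun _ _ _ a => PolylogTM.addBits a [true]) hX nil
    (fun _ => (var _).addBits (const [true]))
    ⟨1, fun N e s _ _ b a => by rw [length_addBits, List.length_singleton, pow_one]; omega⟩
  refine ⟨_, this, fun e s => ?_⟩
  have : ∀ (x a : List Bool), num (x.foldl (fun a _ => PolylogTM.addBits a [true]) a) =
      num a + x.length := by
    intro x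
    induction x with
    | nil => simp
    | cons b x ih =>
      intro a
      rw [List.foldl_cons, ih, num_addBits, List.length_cons]
      simp [PolylogTM.num]
      omega
  rw [this]
  simp [PolylogTM.num]

theorem Cob.unary {X : Fn E ι} (hX : Cob size O X) (c : Bool) :
    Cob size O fun e s => List.replicate (X e s).length c := by
  have := fold₁ (fun _ _ _ a => c :: a) hX nil (fun _ => (var _).cons c)
    ⟨0, fun N e s _ _ b a => by simp⟩
  convert this using 3 with e s
  have : ∀ (x a : List Bool), x.foldl (fun a _ => c :: a) a = List.replicate x.length c ++ a := by
    intro x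
    induction x with
    | nil => simp
    | cons b x ih =>
      intro a
      rw [List.foldl_cons, ih, List.length_cons, List.replicate_succ']
      simp
  rw [this, List.append_nil]

/-- The binary logarithm in unary. -/
theorem NumCob.clog (hφ : NumCob size O φ) :
    Cob size O fun e s => List.replicate (Nat.clog 2 (φ e s)) true := by
  obtain ⟨X, hX, hX'⟩ := hφ
  -- The accumulator is the power 2 ^ j, that is `j` zeros before a one, doubled as long as it is
  -- smaller than the number.
  have key := Cob.fold₁ (size := size) (O := O) (ι := Fin 1)
    (X := fun _ s => s 0) (I := fun _ _ => [true])
    (fun _ _ s a => if ltBits a (s 0) then false :: a else a) (.var _) (.const _)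
    (fun b => Cob.ite (Cob.ltBits (.var _) (.var _)) ((Cob.var _).cons _) (.var _))
    ⟨0, fun N e s _ h b a => by dsimp only; split <;> simp⟩
  -- Without one of its `j + 1` digits the power of two has length `j`. The digits of the number
  -- provide enough rounds.
  have key' := ((key.comp (G := fun _ => X) fun _ => hX).tail).unary true
  convert key' using 3 with e s
  rw [← hX']
  generalize X e s = x
  have : ∀ (z : List Bool) (j : ℕ), j ≤ Nat.clog 2 (num x) →
      z.foldl (fun a _ => if ltBits a x then false :: a else a) (List.replicate j false ++ [true]) =
        List.replicate (min (j + z.length) (Nat.clog 2 (num x))) false ++ [true] := by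
    intro z
    induction z with
    | nil => intro j hj; simp [hj]
    | cons b z ih =>
      intro j hj
      rw [List.foldl_cons, ltBits_eq, num_pow]
      by_cases h : 2 ^ j < num x
      · have h' : j + 1 ≤ Nat.clog 2 (num x) := (Nat.lt_clog_iff_pow_lt (by omega)).mpr h
        rw [decide_eq_true h, if_pos rfl, ← List.cons_append, ← List.replicate_succ, ih _ h',
          List.length_cons]
        congr 3
        omega
      · have h' : Nat.clog 2 (num x) ≤ j := Nat.clog_le_of_le_pow (by omega)
        rw [decide_eq_false h, if_neg (by simp), ih _ hj]
        congr 2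
        omega
  have h0 := this x 0 (Nat.zero_le _)
  have hle : Nat.clog 2 (num x) ≤ x.length := Nat.clog_le_of_le_pow (num_lt x).le
  rw [List.replicate_zero, List.nil_append] at h0
  rw [h0]
  simp [hle]

/-- Dropping a number of bits that is given in binary. -/
theorem NumCob.drop (hφ : NumCob size O φ) {Y : Fn E ι} (hY : Cob size O Y) :
    Cob size O fun e s => (Y e s).drop (φ e s) := by
  obtain ⟨X, hX, hX'⟩ := hφ
  have hc : FinCob size O fun e (s : Fin 2 ⊕ ι → List Bool) => ltBits [] (s (.inl 0)) :=
    Cob.ltBits .nil (.var _)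
  -- The number may be exponential in the lengths, so the recursion counts it down along `Y`, beyond
  -- whose length nothing remains to be dropped.
  have key := (Cob.fold₂ (size := size) (O := O)
    (fun _ _ _ a => if ltBits [] a.1 then subBits a.1 [true] else a.1)
    (fun _ _ _ a => if ltBits [] a.1 then a.2.tail else a.2) hY hX hY
    (fun b => Cob.ite hc ((Cob.var _).subBits (.const _)) (.var _))
    (fun b => Cob.ite hc (Cob.var _).tail (.var _))
    ⟨1, fun N e s _ _ b a => by
      have := le_max_left a.1.length a.2.length
      rw [Cob.len₂, pow_one]
      dsimp only
      split
      · rw [length_subBits, List.length_singleton]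
        omega
      · omega⟩
    ⟨1, fun N e s _ _ b a => by
      have := le_max_right a.1.length a.2.length
      rw [Cob.len₂, pow_one]
      dsimp only
      split
      · rw [List.length_tail]
        omega
      · omega⟩).2
  convert key using 3 with e s
  rw [← hX']
  generalize X e s = x
  have : ∀ (z x y : List Bool), (z.foldl (fun (a : List Bool × List Bool) _ =>
      (if ltBits [] a.1 then subBits a.1 [true] else a.1,
        if ltBits [] a.1 then a.2.tail else a.2)) (x, y)).2 = y.drop (min (num x) z.length) := by
    intro z
    induction z with
    | nil => simp
    | cons b z ih =>
      intro x y
      rw [List.foldl_cons, ih]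
      dsimp only
      rw [ltBits_eq]
      have h0 : num [] = 0 := rfl
      have h1 : num [true] = 1 := rfl
      by_cases h : num [] < num x
      · rw [decide_eq_true h, if_pos rfl, if_pos rfl, num_subBits (by omega), List.length_cons,
          ← List.drop_one, List.drop_drop]
        congr 1
        omega
      · rw [decide_eq_false h, if_neg (by simp), if_neg (by simp)]
        congr 1
        omega
  rw [this]
  rcases le_total (num x) (Y e s).length with h | h
  · rw [min_eq_left h]
  · rw [min_eq_right h, List.drop_of_length_le h, List.drop_length]

theorem toBin_succ (k v : ℕ) : toBin (k + 1) v = toBin k (v / 2) ++ [v.testBit 0] := by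
  rw [toBin, List.range_succ, List.map_append, toBin]
  congr 1
  · refine List.map_congr_left fun i hi => ?_
    rw [List.mem_range] at hi
    rw [show k + 1 - 1 - i = k - 1 - i + 1 by omega, Nat.testBit_succ]
  · simp

/-- The bits of a number, least significant bit first. -/
theorem NumCob.bits (hφ : NumCob size O φ) {X : Fn E ι} (hX : Cob size O X) :
    Cob size O fun e s => (toBin (X e s).length (φ e s)).reverse := by
  obtain ⟨Y, hY, hY'⟩ := hφ
  have hh : FinCob size O fun e (s : Fin 2 ⊕ ι → List Bool) => (s (.inl 0)).headD false :=
    FinCob.headD (.var _) _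
  have key := (Cob.fold₂ (size := size) (O := O) (fun _ _ _ a => a.1.tail)
    (fun _ _ _ a => a.1.headD false :: a.2) hX hY .nil
    (fun b => (Cob.var _).tail) (fun b => Cob.consBit hh (.var _))
    ⟨0, fun N e s _ _ b a => by
      have := le_max_left a.1.length a.2.length
      simp only [Cob.len₂, List.length_tail]
      omega⟩
    ⟨0, fun N e s _ _ b a => by simp [Cob.len₂]⟩).2
  convert key.reverse using 3 with e s
  rw [← hY']
  generalize Y e s = y
  have : ∀ (z y o : List Bool), (z.foldl (fun (a : List Bool × List Bool) _ =>
      (a.1.tail, a.1.headD false :: a.2)) (y, o)).2 = toBin z.length (num y) ++ o := by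
    intro z
    induction z with
    | nil => simp [toBin]
    | cons b z ih =>
      intro y o
      rw [List.foldl_cons, ih, List.length_cons, toBin_succ, num_eq_head_tail y]
      have hb := Bool.toNat_lt (y.headD false)
      have h1 : ((y.headD false).toNat + 2 * num y.tail) / 2 = num y.tail := by omega
      have h2 : ((y.headD false).toNat + 2 * num y.tail).testBit 0 = y.headD false := by
        rw [Nat.testBit_zero, Nat.add_mul_mod_self_left]
        cases y.headD false <;> rfl
      rw [h1, h2, List.append_assoc, List.singleton_append]
  rw [this, List.append_nil]

end NumCob

end PolylogTM

namespace PolylogTM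

/-! ## Positions in the encoding -/

theorem getElem?_flatMap {α β : Type} {f : α → List β} {m : ℕ} (hf : ∀ a, (f a).length = m)
    (l : List α) (i : ℕ) {j : ℕ} (hj : j < m) :
    (l.flatMap f)[i * m + j]? = l[i]?.bind fun a => (f a)[j]? := by
  induction l generalizing i with
  | nil => simp
  | cons a l ih =>
    rw [List.flatMap_cons]
    rcases i with _ | i
    · rw [List.getElem?_append_left (by rw [hf]; omega)]
      simp
    · rw [List.getElem?_append_right (by rw [hf, Nat.succ_mul]; omega), hf,
        show (i + 1) * m + j - m = i * m + j by rw [Nat.succ_mul]; omega, ih]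
      simp

/-- The components of the tuple at a position in the lexicographic order. -/
def tupleDigits (n : ℕ) : (k : ℕ) → ℕ → Fin k → ℕ
  | 0, _ => Fin.elim0
  | k + 1, t => Fin.cons (t / n ^ k) (tupleDigits n k (t % n ^ k))

/-- The position of a tuple in the lexicographic order. -/
def tuplePos (n : ℕ) : (k : ℕ) → (Fin k → ℕ) → ℕ
  | 0, _ => 0
  | k + 1, a => a 0 * n ^ k + tuplePos n k fun j => a j.succ

theorem tuples_succ_getElem? {n k i j : ℕ} (hi : i < n) {a : Fin k → Fin n}
    (h : (tuples n k)[j]? = some a) :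
    (tuples n (k + 1))[i * n ^ k + j]? = some (Fin.cons ⟨i, hi⟩ a) := by
  have hj : j < n ^ k := by
    rw [← length_tuples]
    exact (List.getElem?_eq_some_iff.mp h).1
  rw [tuples, getElem?_flatMap (fun a => by rw [List.length_map, length_tuples]) _ _ hj]
  simp [hi, h]

/-- Lexicographic order of tuples is numerical order of base n numerals, so the components are
digits, found by division with remainder. -/
theorem exists_tuples_getElem?_eq {n : ℕ} (hn : 0 < n) (k t : ℕ) (ht : t < n ^ k) :
    ∃ a, (tuples n k)[t]? = some a ∧ (fun j => (a j : ℕ)) = tupleDigits n k t := by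
  induction k generalizing t with
  | zero =>
    obtain rfl : t = 0 := by simpa using ht
    exact ⟨Fin.elim0, rfl, funext fun j => j.elim0⟩
  | succ k ih =>
    have hk : 0 < n ^ k := Nat.pow_pos hn
    obtain ⟨a, h1, h2⟩ := ih (t % n ^ k) (Nat.mod_lt _ hk)
    have hi : t / n ^ k < n := Nat.div_lt_of_lt_mul (by rwa [← pow_succ])
    refine ⟨Fin.cons ⟨t / n ^ k, hi⟩ a, ?_, ?_⟩
    · rw [← tuples_succ_getElem? hi h1, Nat.div_add_mod']
    · rw [tupleDigits, ← h2]
      funext j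
      refine Fin.cases ?_ (fun j => ?_) j <;> simp

theorem tuples_getElem?_tuplePos {n k : ℕ} (a : Fin k → Fin n) :
    (tuples n k)[tuplePos n k fun j => a j]? = some a := by
  induction k with
  | zero => simpa [tuplePos, tuples] using funext fun j => j.elim0
  | succ k ih =>
    rw [tuplePos, tuples_succ_getElem? (a 0).2 (ih fun j => a j.succ)]
    congr 1
    exact Fin.cons_self_tail a

theorem toBin_getElem? {w m : ℕ} (v : ℕ) (h : m < w) :
    (toBin w v)[m]? = some (v.testBit (w - 1 - m)) := by
  simp [toBin, h]

namespace OrderedStructure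

variable {σ : Vocabulary} (A : OrderedStructure σ)

open Classical in
theorem binRel_getElem? (i : Fin σ.p) {j : ℕ} {a : Fin (σ.relArity i) → Fin A.n}
    (h : (tuples A.n (σ.relArity i))[j]? = some a) :
    (A.binRel i)[j]? = some (decide (a ∈ A.rel i)) := by
  simp [binRel, h]

theorem binFun_getElem? (i : Fin σ.s) {j m : ℕ} {a : Fin (σ.funArity i) → Fin A.n}
    (hm : m < A.width) (h : (tuples A.n (σ.funArity i))[j]? = some a) :
    (A.binFun i)[m * A.n ^ σ.funArity i + j]? =
      some ((A.fn i a : ℕ).testBit (A.width - 1 - m)) := by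
  have hj : j < A.n ^ σ.funArity i := by
    rw [← length_tuples]
    exact (List.getElem?_eq_some_iff.mp h).1
  rw [binFun, getElem?_flatMap (fun a => by rw [List.length_map, length_tuples]) _ _ hj]
  simp [hm, h]

open Classical in
theorem relQuery_coe (i : Fin σ.p) (a : Fin (σ.relArity i) → Fin A.n) :
    (A.relQuery i fun j => a j) = decide (a ∈ A.rel i) := by
  simp [relQuery]

theorem funQuery_coe (i : Fin σ.s) (a : Fin (σ.funArity i) → Fin A.n) :
    (A.funQuery i fun j => a j) = toBin A.width (A.fn i a) := by
  simp [funQuery]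

end OrderedStructure

theorem num_reverse_toBin (k v : ℕ) : num (toBin k v).reverse = v % 2 ^ k := by
  induction k generalizing v with
  | zero => simp [toBin, num, Nat.mod_one]
  | succ k ih =>
    rw [toBin_succ, List.reverse_append, List.reverse_singleton, List.singleton_append, num, ih,
      pow_succ', Nat.mod_mul, Nat.testBit_zero]
    congr 1
    rcases Nat.mod_two_eq_zero_or_one v with h | h <;> simp [h]

/-! ### Computing positions and lengths of blocks -/

section

variable {σ : Vocabulary} {O : Oracles (OrderedStructure σ)} {ι : Type}

/-- The size of the domain can be computed. -/
abbrev NumCard (O : Oracles (OrderedStructure σ)) : Prop :=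
  NumCob (ι := Empty) OrderedStructure.width O fun A _ => A.n

theorem NumCob.tupleDigits (hn : NumCard O) {φ : OrderedStructure σ → (ι → List Bool) → ℕ}
    (hφ : NumCob OrderedStructure.width O φ) (k : ℕ) (j : Fin k) :
    NumCob OrderedStructure.width O fun A s => tupleDigits A.n k (φ A s) j := by
  induction k generalizing φ with
  | zero => exact j.elim0
  | succ k ih =>
    refine Fin.cases ?_ (fun j => ?_) j
    · exact hφ.div (hn.of_empty.pow k) fun A s => Nat.pow_pos A.n_pos
    · exact ih (hφ.mod (hn.of_empty.pow k) fun A s => Nat.pow_pos A.n_pos) j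

theorem NumCob.tuplePos (hn : NumCard O) {k : ℕ}
    {φ : Fin k → OrderedStructure σ → (ι → List Bool) → ℕ}
    (hφ : ∀ j, NumCob OrderedStructure.width O (φ j)) :
    NumCob OrderedStructure.width O fun A s => tuplePos A.n k fun j => φ j A s := by
  induction k with
  | zero => exact zero
  | succ k ih => exact ((hφ 0).mul (hn.of_empty.pow k)).add (ih fun j => hφ j.succ)

theorem NumCob.clog_length {φ : OrderedStructure σ → (ι → List Bool) → ℕ}
    (hφ : NumCob OrderedStructure.width O φ) :
    NumCob OrderedStructure.width O fun A s => Nat.clog 2 (φ A s) := by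
  simpa using hφ.clog.length

theorem NumCob.encLen {φ : OrderedStructure σ → (ι → List Bool) → ℕ}
    (hφ : NumCob OrderedStructure.width O φ) :
    NumCob OrderedStructure.width O fun A s => encLen σ (φ A s) :=
  (sum fun _ => hφ.pow _).add ((hφ.clog_length.const_mul _).add
    (sum fun _ => hφ.clog_length.mul (hφ.pow _)))

theorem numCob_length_binRel (hn : NumCard O) (i : Fin σ.p) :
    NumCob OrderedStructure.width O fun A (_ : ι → List Bool) => (A.binRel i).length := by
  simpa only [OrderedStructure.length_binRel] using hn.of_empty.pow _

theorem numCob_width (hn : NumCard O) :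
    NumCob OrderedStructure.width O fun A (_ : ι → List Bool) => A.width :=
  hn.of_empty.clog_length

theorem numCob_length_binConst (hn : NumCard O) (i : Fin σ.q) :
    NumCob OrderedStructure.width O fun A (_ : ι → List Bool) => (A.binConst i).length := by
  simpa only [OrderedStructure.length_binConst] using numCob_width hn

theorem numCob_length_binFun (hn : NumCard O) (i : Fin σ.s) :
    NumCob OrderedStructure.width O fun A (_ : ι → List Bool) => (A.binFun i).length := by
  simpa only [OrderedStructure.length_binFun] using (numCob_width hn).mul (hn.of_empty.pow _)

theorem numCob_length_flatMap {κ : Type} {f : κ → OrderedStructure σ → List Bool}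
    (h : ∀ k, NumCob OrderedStructure.width O fun A (_ : ι → List Bool) => (f k A).length)
    (l : List κ) : NumCob OrderedStructure.width O fun A (_ : ι → List Bool) =>
      (l.flatMap fun k => f k A).length := by
  induction l with
  | nil => exact NumCob.zero
  | cons k l ih => simpa only [List.flatMap_cons, List.length_append] using (h k).add ih

end

/-! ## Access to the encoding by queries to the structure -/

section DirectAccess

variable {σ : Vocabulary} {ι : Type}

theorem Cob.oracle_comp {E : Type} {size : E → ℕ} {O : Oracles E} (o : O.Op)
    {G : O.Arg o → Fn E ι} (hG : ∀ j, Cob size O (G j)) :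
    Cob size O fun e s => O.val o e fun j => G j e s :=
  (Cob.oracle o).comp hG

theorem numCard_daOracles : NumCard (daOracles σ) := by
  have h := Cob.oracle_comp (ι := Empty) (size := OrderedStructure.width) (O := daOracles σ)
    (.ro .size) (G := fun j => nomatch j) fun j => nomatch j
  refine ⟨_, h, fun A s => ?_⟩
  change num (toBin A.n.size A.n).reverse = A.n
  rw [num_reverse_toBin, Nat.mod_eq_of_lt (Nat.lt_size_self _)]

/-- The bits of a part of the encoding can be computed. -/
structure Indexable (O : Oracles (OrderedStructure σ)) (L : OrderedStructure σ → List Bool) :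
    Prop where
  length {ι : Type} : NumCob OrderedStructure.width O fun A (_ : ι → List Bool) => (L A).length
  get {ι : Type} {φ : OrderedStructure σ → (ι → List Bool) → ℕ} :
    NumCob OrderedStructure.width O φ →
      Cob OrderedStructure.width O fun A s => (L A)[φ A s]?.toList

namespace Indexable

variable {O : Oracles (OrderedStructure σ)}

theorem append {L L' : OrderedStructure σ → List Bool} (h : Indexable O L) (h' : Indexable O L') :
    Indexable O fun A => L A ++ L' A where
  length {_} := by simpa only [List.length_append] using h.length.add h'.length
  get hφ := by
    convert Cob.ite (hφ.lt h.length) (h.get hφ) (h'.get (hφ.sub h.length)) using 3 with A s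
    rw [List.getElem?_append]
    simp only [decide_eq_true_eq]
    split <;> rfl

theorem flatMap {κ : Type} {f : κ → OrderedStructure σ → List Bool} (h : ∀ k, Indexable O (f k))
    (l : List κ) : Indexable O fun A => l.flatMap fun k => f k A := by
  induction l with
  | nil => exact ⟨NumCob.zero, fun _ => Cob.nil⟩
  | cons k l ih => simpa only [List.flatMap_cons] using (h k).append ih

end Indexable

/-- The base n digits of the position form the tuple to be queried. Positions behind the block need
a separate case, because the query would still give an answer there. -/
theorem indexable_binRel (i : Fin σ.p) : Indexable (daOracles σ) fun A => A.binRel i where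
  length := numCob_length_binRel numCard_daOracles i
  get {ι φ} hφ := by
    choose F hF hF' using fun j =>
      NumCob.tupleDigits numCard_daOracles hφ (σ.relArity i) j
    have h := Cob.oracle_comp (size := OrderedStructure.width) (O := daOracles σ) (.rel i) hF
    convert Cob.ite (hφ.lt (numCob_length_binRel numCard_daOracles i)) h .nil using 3 with A s
    simp only [decide_eq_true_eq]
    split
    · rename_i hlt
      rw [OrderedStructure.length_binRel] at hlt
      obtain ⟨a, h1, h2⟩ := exists_tuples_getElem?_eq A.n_pos _ _ hlt
      change _ = [A.relQuery i fun j => num (F j A s)]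
      simp only [hF']
      rw [A.binRel_getElem? i h1, ← h2, A.relQuery_coe]
      rfl
    · rw [List.getElem?_eq_none (by omega)]
      rfl

theorem cob_getElem?_reverse {O : Oracles (OrderedStructure σ)} {X : Fn (OrderedStructure σ) ι}
    {φ : OrderedStructure σ → (ι → List Bool) → ℕ} (hX : Cob OrderedStructure.width O fun A s =>
      (X A s).reverse) (hφ : NumCob OrderedStructure.width O φ) :
    Cob OrderedStructure.width O fun A s => (X A s)[φ A s]?.toList := by
  convert Cob.case (fun o _ _ => o.toList) (hφ.drop hX.reverse) fun o => .const _ using 3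
  simp [List.head?_drop]

theorem indexable_binConst (i : Fin σ.q) : Indexable (daOracles σ) fun A => A.binConst i where
  length := numCob_length_binConst numCard_daOracles i
  get {ι φ} hφ := by
    have h := Cob.oracle_comp (ι := ι) (size := OrderedStructure.width) (O := daOracles σ)
      (.ro (.const i)) (G := fun j => nomatch j) fun j => nomatch j
    exact cob_getElem?_reverse h hφ

/-- The block consists of `width` relations of n ^ k bits each: the quotient of the position by n ^
k selects the bit of the value, the remainder the tuple. -/
theorem indexable_binFun (i : Fin σ.s) : Indexable (daOracles σ) fun A => A.binFun i where
  length := numCob_length_binFun numCard_daOracles i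
  get {ι φ} hφ := by
    have hk : NumCob OrderedStructure.width (daOracles σ) fun A (_ : ι → List Bool) =>
      A.n ^ σ.funArity i := numCard_daOracles.of_empty.pow _
    have hpos : ∀ (A : OrderedStructure σ) (_ : ι → List Bool), 0 < A.n ^ σ.funArity i := fun A _ => Nat.pow_pos A.n_pos
    choose F hF hF' using fun j =>
      NumCob.tupleDigits numCard_daOracles (hφ.mod hk hpos) (σ.funArity i) j
    have h := cob_getElem?_reverse (X := fun A s => A.funQuery i fun j => num (F j A s))
      (Cob.oracle_comp (size := OrderedStructure.width) (O := daOracles σ) (.ro (.value i)) hF)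
      (hφ.div hk hpos)
    convert Cob.ite (hφ.lt (numCob_length_binFun numCard_daOracles i)) h .nil using 3 with A s
    simp only [decide_eq_true_eq]
    split
    · rename_i hlt
      rw [OrderedStructure.length_binFun] at hlt
      obtain ⟨a, h1, h2⟩ := exists_tuples_getElem?_eq A.n_pos _ _
        (Nat.mod_lt (φ A s) (hpos A s))
      have hm : φ A s / A.n ^ σ.funArity i < A.width :=
        Nat.div_lt_of_lt_mul (by rwa [Nat.mul_comm])
      simp only [hF']
      rw [← h2, A.funQuery_coe, toBin_getElem? _ hm, ← A.binFun_getElem? i hm h1,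
        Nat.div_add_mod']
    · rw [List.getElem?_eq_none (by omega)]
      rfl

theorem indexable_bin : Indexable (daOracles σ) OrderedStructure.bin :=
  (Indexable.flatMap indexable_binRel _).append
    ((Indexable.flatMap indexable_binConst _).append (Indexable.flatMap indexable_binFun _))

/-- The oracles of a random-access machine can be computed by a direct-access machine. -/
theorem cob_raOracles (o : RAOracle) :
    Cob OrderedStructure.width (daOracles σ) ((raOracles σ).val o) := by
  cases o
  · exact indexable_bin.get (Cob.numCob (.var ()))
  · exact indexable_bin.length.clog

end DirectAccess

end PolylogTM

namespace PolylogTM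

/-! ## Access to the structure by queries to the encoding -/

/-- No summand decreases, and the one for a symbol of positive arity increases strictly. This makes
the length of the encoding determine n. -/
theorem encLen_lt {σ : Vocabulary}
    (hσ : (∃ i, 0 < σ.relArity i) ∨ (∃ i, 0 < σ.funArity i)) {m m' : ℕ} (h0 : 1 ≤ m)
    (h : m < m') : encLen σ m < encLen σ m' := by
  have hc : Nat.clog 2 m ≤ Nat.clog 2 m' := Nat.clog_mono_right 2 h.le
  have hp : ∀ k, m ^ k ≤ m' ^ k := fun k => Nat.pow_le_pow_left h.le k
  have hr : ∀ i ∈ Finset.univ, m ^ σ.relArity i ≤ m' ^ σ.relArity i := fun i _ => hp _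
  have hf : ∀ i ∈ Finset.univ, Nat.clog 2 m * m ^ σ.funArity i ≤
      Nat.clog 2 m' * m' ^ σ.funArity i := fun i _ => Nat.mul_le_mul hc (hp _)
  have hq := Nat.mul_le_mul_left σ.q hc
  rcases hσ with ⟨i, hi⟩ | ⟨i, hi⟩
  · exact Nat.add_lt_add_of_lt_of_le (Finset.sum_lt_sum hr
      ⟨i, Finset.mem_univ i, Nat.pow_lt_pow_left h hi.ne'⟩)
      (Nat.add_le_add hq (Finset.sum_le_sum hf))
  · refine Nat.add_lt_add_of_le_of_lt (Finset.sum_le_sum hr) (Nat.add_lt_add_of_le_of_lt hq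
      (Finset.sum_lt_sum hf ⟨i, Finset.mem_univ i, ?_⟩))
    -- The larger size is at least 2, so its logarithm is positive. Strictness thus holds also from
    -- m = 1, where the logarithm is 0.
    exact Nat.mul_lt_mul_of_le_of_lt hc (Nat.pow_lt_pow_left h hi.ne')
      (Nat.clog_pos (by omega) (by omega))

theorem clog_le_clog_encLen {σ : Vocabulary}
    (hσ : (∃ i, 0 < σ.relArity i) ∨ (∃ i, 0 < σ.funArity i)) (n : ℕ) :
    Nat.clog 2 n ≤ Nat.clog 2 (encLen σ n) := by
  -- For n = 1 the encoding of functions is empty, so n may exceed the length of the encoding; but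
  -- then log n = 0.
  rcases Nat.lt_or_ge n 2 with h | h
  · rw [Nat.clog_of_right_le_one (by omega)]
    exact Nat.zero_le _
  refine Nat.clog_mono_right 2 ?_
  rcases hσ with ⟨i, hi⟩ | ⟨i, hi⟩
  · exact (Nat.le_self_pow hi.ne' n).trans ((Finset.single_le_sum
      (f := fun i => n ^ σ.relArity i) (fun _ _ => Nat.zero_le _) (Finset.mem_univ i)).trans
      (Nat.le_add_right _ _))
  · have h1 : n ≤ Nat.clog 2 n * n ^ σ.funArity i := (Nat.le_self_pow hi.ne' n).trans
      (Nat.le_mul_of_pos_left _ (Nat.clog_pos (by omega) h))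
    exact h1.trans ((Finset.single_le_sum (f := fun i => Nat.clog 2 n * n ^ σ.funArity i)
      (fun _ _ => Nat.zero_le _) (Finset.mem_univ i)).trans
      ((Nat.le_add_left _ _).trans (Nat.le_add_left _ _)))

section RandomAccess

variable {σ : Vocabulary} {ι : Type}

theorem NumCob.query {φ : OrderedStructure σ → (ι → List Bool) → ℕ}
    (hφ : NumCob OrderedStructure.width (raOracles σ) φ) :
    FinCob OrderedStructure.width (raOracles σ) fun A s => A.bin[φ A s]? := by
  obtain ⟨X, hX, hX'⟩ := hφ
  have h := Cob.oracle_comp (size := OrderedStructure.width) (O := raOracles σ) .query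
    (G := fun _ => X) fun _ => hX
  convert FinCob.head? h using 3 with A s
  change _ = (A.bin[num (X A s)]?).toList.head?
  rw [hX']
  cases A.bin[φ A s]? <;> rfl

/-- The search for the size of the domain, most significant bit first: the bits of a number
`m < n` shifted by as many positions as there are bits left. -/
noncomputable def searchStep (A : OrderedStructure σ) (a : List Bool × List Bool) :
    List Bool × List Bool :=
  ((A.bin[encLen σ (num (a.2.tail ++ true :: a.1))]?).isSome :: a.1, a.2.tail)

/-- The search finds n - 1, the largest number below n, digit by digit. With k digits left the
prefix p satisfies p 2 ^ k < n ≤ (p + 1) 2 ^ k. Whether a candidate m is below n is seen from the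
existence of the cell `encLen σ m`, by strict monotonicity. -/
theorem num_search (hσ : (∃ i, 0 < σ.relArity i) ∨ (∃ i, 0 < σ.funArity i))
    (A : OrderedStructure σ) (z p : List Bool) (h1 : num p * 2 ^ z.length < A.n)
    (h2 : A.n ≤ (num p + 1) * 2 ^ z.length) :
    num (z.foldl (fun a _ => searchStep A a) (p, List.replicate z.length false)).1 + 1 = A.n := by
  induction z generalizing p with
  | nil =>
    simp only [List.length_nil, pow_zero, mul_one, List.foldl_nil] at *
    omega
  | cons b z ih =>
    have hc : num (List.replicate z.length false ++ true :: p) =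
        (2 * num p + 1) * 2 ^ z.length := by
      rw [num_append, num_replicate_false, List.length_replicate, num, Bool.toNat_true]
      ring
    have hpos : 0 < 2 ^ z.length := Nat.pow_pos (by omega)
    have hquery : (A.bin[encLen σ ((2 * num p + 1) * 2 ^ z.length)]?).isSome =
        decide ((2 * num p + 1) * 2 ^ z.length < A.n) := by
      rw [Bool.eq_iff_iff, decide_eq_true_iff, Option.isSome_iff_ne_none, Ne,
        List.getElem?_eq_none_iff, not_le, A.length_bin]
      -- Candidates end in a one followed by zeros, so they are at least 1, as monotonicity
      -- requires.
      refine ⟨fun h => ?_, fun h => encLen_lt hσ (Nat.mul_pos (by omega) hpos) h⟩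
      by_contra hle
      rcases Nat.eq_or_lt_of_le (not_lt.mp hle) with h' | h'
      · rw [← h'] at h
        exact h.false
      · exact (encLen_lt hσ A.n_pos h').not_gt h
    rw [List.foldl_cons, searchStep, List.length_cons, List.replicate_succ, List.tail_cons]
    dsimp only
    rw [hc, hquery]
    rw [List.length_cons, pow_succ] at h1 h2
    refine ih _ ?_ ?_
    · rw [num]
      by_cases h : (2 * num p + 1) * 2 ^ z.length < A.n
      · simp only [h, decide_true, Bool.toNat_true]
        linarith
      · simp only [h, decide_false, Bool.toNat_false]
        linarith
    · rw [num]
      by_cases h : (2 * num p + 1) * 2 ^ z.length < A.n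
      · simp only [h, decide_true, Bool.toNat_true]
        linarith
      · simp only [h, decide_false, Bool.toNat_false]
        linarith

theorem cob_clock :
    Cob OrderedStructure.width (raOracles σ) fun A (_ : ι → List Bool) =>
      List.replicate (Nat.clog 2 A.bin.length) true :=
  Cob.oracle_comp (size := OrderedStructure.width) (O := raOracles σ) .clock
    (G := fun j => nomatch j) fun j => nomatch j

theorem numCard_raOracles (hσ : (∃ i, 0 < σ.relArity i) ∨ (∃ i, 0 < σ.funArity i)) :
    NumCard (raOracles σ) := by
  have hd : Cob OrderedStructure.width (raOracles σ)
      fun A (s : Fin 2 ⊕ Empty → List Bool) => (s (.inl 1)).tail := (Cob.var _).tail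
  have hq := (NumCob.query (Cob.numCob (hd.append ((Cob.var (.inl 0)).cons true))).encLen).map
    Option.isSome
  have key := (Cob.fold₂ (fun _ A _ a => (searchStep A a).1) (fun _ A _ a => (searchStep A a).2)
    (cob_clock (σ := σ) (ι := Empty)) .nil (cob_clock.unary false)
    (fun _ => Cob.consBit hq (.var _)) (fun _ => hd)
    ⟨0, fun N e s _ _ b a => by simp [searchStep, Cob.len₂]⟩
    ⟨0, fun N e s _ _ b a => by
      have := le_max_right a.1.length a.2.length
      simp only [searchStep, Cob.len₂, List.length_tail]
      omega⟩).1
  obtain ⟨F, hF, hF'⟩ := (Cob.numCob key).add .one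
  refine ⟨F, hF, fun A s => ?_⟩
  rw [hF']
  -- The search starts with the empty prefix. The clock gives enough digits since log n ≤ log n̂.
  refine num_search hσ A _ [] (by simpa [num] using A.n_pos) ?_
  have := A.length_bin ▸ clog_le_clog_encLen hσ A.n
  rw [List.length_replicate, num, Nat.zero_add, Nat.one_mul]
  exact A.n_le.trans (Nat.pow_le_pow_right (by omega) this)

/-- A part of the encoding that starts at a position that can be computed. -/
def Placed (O : Oracles (OrderedStructure σ)) (L : OrderedStructure σ → List Bool) : Prop :=
  ∃ P R : OrderedStructure σ → List Bool,
    (∀ ι : Type, NumCob OrderedStructure.width O fun A (_ : ι → List Bool) => (P A).length) ∧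
      ∀ A, A.bin = P A ++ (L A ++ R A)

theorem flatMap_finRange_split {m : ℕ} (i : Fin m) : ∃ l l' : List (Fin m),
    ∀ f : Fin m → List Bool, (List.finRange m).flatMap f = l.flatMap f ++ (f i ++ l'.flatMap f) := by
  obtain ⟨l, l', h⟩ := List.append_of_mem (List.mem_finRange i)
  exact ⟨l, l', fun f => by rw [h, List.flatMap_append, List.flatMap_cons]⟩

theorem placed_binRel {O : Oracles (OrderedStructure σ)} (hn : NumCard O) (i : Fin σ.p) :
    Placed O fun A => A.binRel i := by
  obtain ⟨l, l', h⟩ := flatMap_finRange_split i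
  exact ⟨fun A => l.flatMap A.binRel, _,
    fun _ => numCob_length_flatMap (fun i => numCob_length_binRel hn i) l,
    fun A => by rw [OrderedStructure.bin, h, List.append_assoc, List.append_assoc]⟩

theorem placed_binConst {O : Oracles (OrderedStructure σ)} (hn : NumCard O) (i : Fin σ.q) :
    Placed O fun A => A.binConst i := by
  obtain ⟨l, l', h⟩ := flatMap_finRange_split i
  refine ⟨fun A => (List.finRange σ.p).flatMap A.binRel ++ l.flatMap A.binConst, _,
    fun _ => ?_, fun A => by rw [OrderedStructure.bin, h]; simp only [List.append_assoc]; rfl⟩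
  simp only [List.length_append]
  exact (numCob_length_flatMap (fun i => numCob_length_binRel hn i) _).add
    (numCob_length_flatMap (fun i => numCob_length_binConst hn i) l)

theorem placed_binFun {O : Oracles (OrderedStructure σ)} (hn : NumCard O) (i : Fin σ.s) :
    Placed O fun A => A.binFun i := by
  obtain ⟨l, l', h⟩ := flatMap_finRange_split i
  refine ⟨fun A => (List.finRange σ.p).flatMap A.binRel ++
    ((List.finRange σ.q).flatMap A.binConst ++ l.flatMap A.binFun), _,
    fun _ => ?_, fun A => by rw [OrderedStructure.bin, h]; simp only [List.append_assoc]; rfl⟩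
  simp only [List.length_append]
  exact (numCob_length_flatMap (fun i => numCob_length_binRel hn i) _).add
    ((numCob_length_flatMap (fun i => numCob_length_binConst hn i) _).add
      (numCob_length_flatMap (fun i => numCob_length_binFun hn i) l))

/-- Reading bits of the encoding in arithmetic progression. -/
theorem NumCob.gather {φ ψ : OrderedStructure σ → (ι → List Bool) → ℕ}
    {X : Fn (OrderedStructure σ) ι} (hφ : NumCob OrderedStructure.width (raOracles σ) φ)
    (hψ : NumCob OrderedStructure.width (raOracles σ) ψ)
    (hX : Cob OrderedStructure.width (raOracles σ) X) :
    Cob OrderedStructure.width (raOracles σ) fun A s =>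
      ((List.range (X A s).length).map fun m =>
        A.bin[φ A s + m * ψ A s]?.getD false).reverse := by
  obtain ⟨Y, hY, hY'⟩ := hφ
  obtain ⟨Z, hZ, hZ'⟩ := hψ
  have hq : FinCob OrderedStructure.width (raOracles σ)
      fun A (s : Fin 2 ⊕ Fin 3 → List Bool) => A.bin[num (s (.inl 0))]?.getD false :=
    (NumCob.query (Cob.numCob (.var _))).map fun o => o.getD false
  -- One accumulator is the current address, advanced by the difference of the progression; the
  -- other one collects the bits.
  have key := (Cob.fold₂ (ι := Fin 3) (X := fun _ s => s 0) (I₁ := fun _ s => s 1)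
    (I₂ := fun _ _ => [])
    (fun _ _ s a => addBits a.1 (s 2)) (fun _ (A : OrderedStructure σ) _ a => A.bin[num a.1]?.getD false :: a.2)
    (.var _) (.var _) .nil (fun _ => Cob.addBits (.var _) (.var _))
    (fun _ => Cob.consBit hq (.var _))
    ⟨1, fun N e s _ h b a => by
      have := le_max_left a.1.length a.2.length
      have := h 2
      rw [length_addBits, Cob.len₂, pow_one]
      omega⟩
    ⟨0, fun N e s _ _ b a => by simp [Cob.len₂]⟩).2
  have key' := key.comp (G := ![X, Y, Z]) fun j => by
    fin_cases j
    · exact hX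
    · exact hY
    · exact hZ
  convert key' using 3 with A s
  change _ = (List.foldl (fun a _ => (addBits a.1 (Z A s), A.bin[num a.1]?.getD false :: a.2))
    (Y A s, []) (X A s)).2
  rw [← hY', ← hZ']
  have : ∀ (x y o : List Bool), (x.foldl (fun (a : List Bool × List Bool) _ =>
      (addBits a.1 (Z A s), A.bin[num a.1]?.getD false :: a.2)) (y, o)).2 =
      ((List.range x.length).map fun m => A.bin[num y + m * num (Z A s)]?.getD false).reverse ++ o
      := by
    intro x
    induction x with
    | nil => simp
    | cons b x ih =>
      intro y o
      rw [List.foldl_cons, ih, num_addBits, List.length_cons, List.range_succ_eq_map,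
        List.map_cons, List.reverse_cons, List.map_map, List.append_assoc]
      congr 3
      · funext m
        rw [Function.comp_apply, Nat.succ_mul, Nat.add_assoc, Nat.add_comm (num (Z A s))]
      · simp
  rw [this, List.append_nil]

theorem finCob_inDomain (hn : NumCard (raOracles σ)) {k : ℕ} :
    FinCob OrderedStructure.width (raOracles σ)
      fun A (s : Fin k → List Bool) => decide (∀ j, num (s j) < A.n) := by
  convert (FinCob.pi fun j : Fin k => (Cob.numCob (Cob.var j)).lt hn.of_empty).map
    (fun f : Fin k → Bool => decide (∀ j, f j = true)) using 3
  simp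

theorem cob_rel (hn : NumCard (raOracles σ)) (i : Fin σ.p) :
    Cob OrderedStructure.width (raOracles σ) fun A (s : Fin (σ.relArity i) → List Bool) =>
      [A.relQuery i fun j => num (s j)] := by
  obtain ⟨P, R, hP, h⟩ := placed_binRel hn i
  convert Cob.ite (finCob_inDomain hn) (Cob.consBit ((((hP _).add (NumCob.tuplePos hn
    fun j : Fin (σ.relArity i) => Cob.numCob (.var j))).query).map fun o => o.getD false) .nil)
    (.const [false]) using 3 with A s
  simp only [decide_eq_true_eq]
  split
  · rename_i hlt
    have hb := A.binRel_getElem? i (tuples_getElem?_tuplePos fun j => ⟨num (s j), hlt j⟩)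
    rw [A.relQuery_coe i fun j => ⟨num (s j), hlt j⟩, h,
      List.getElem?_append_right (Nat.le_add_right _ _), Nat.add_sub_cancel_left,
      List.getElem?_append_left (List.getElem?_eq_some_iff.mp hb).1, hb]
    rfl
  · rename_i hlt
    simp only [OrderedStructure.relQuery, dif_neg hlt]

/-- The bits of a value lie n ^ k apart, at the position of the tuple in each of the relations that
make up the block. Outside of the domain the value-tape is blank, hence the empty string. -/
theorem cob_fun (hn : NumCard (raOracles σ)) (i : Fin σ.s) :
    Cob OrderedStructure.width (raOracles σ) fun A (s : Fin (σ.funArity i) → List Bool) =>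
      (A.funQuery i fun j => num (s j)).reverse := by
  obtain ⟨P, R, hP, h⟩ := placed_binFun hn i
  convert Cob.ite (finCob_inDomain hn) (NumCob.gather ((hP _).add (NumCob.tuplePos hn
    fun j : Fin (σ.funArity i) => Cob.numCob (.var j))) (hn.of_empty.pow (σ.funArity i))
    hn.of_empty.clog) .nil using 3 with A s
  simp only [decide_eq_true_eq]
  split
  · rename_i hlt
    rw [A.funQuery_coe i fun j => ⟨num (s j), hlt j⟩, toBin, List.length_replicate]
    congr 1
    refine List.map_congr_left fun m hm => ?_
    rw [List.mem_range] at hm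
    have hb := A.binFun_getElem? i hm (tuples_getElem?_tuplePos fun j => ⟨num (s j), hlt j⟩)
    rw [h, Nat.add_assoc, List.getElem?_append_right (Nat.le_add_right _ _),
      Nat.add_sub_cancel_left, Nat.add_comm,
      List.getElem?_append_left (List.getElem?_eq_some_iff.mp hb).1, hb]
    rfl
  · rename_i hlt
    simp only [OrderedStructure.funQuery, dif_neg hlt, List.reverse_nil]

theorem cob_const (hn : NumCard (raOracles σ)) (i : Fin σ.q) :
    Cob OrderedStructure.width (raOracles σ) fun A (_ : ι → List Bool) =>
      (A.binConst i).reverse := by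
  obtain ⟨P, R, hP, h⟩ := placed_binConst hn i
  convert NumCob.gather (hP ι) .one hn.of_empty.clog using 3 with A s
  rw [OrderedStructure.binConst, toBin, List.length_replicate]
  congr 1
  refine List.map_congr_left fun m hm => ?_
  rw [List.mem_range] at hm
  have hb := toBin_getElem? (A.const i) hm
  rw [h, Nat.mul_one, List.getElem?_append_right (Nat.le_add_right _ _),
    Nat.add_sub_cancel_left,
    List.getElem?_append_left (by rw [A.length_binConst]; exact hm), show (A.binConst i)[m]? = _
      from hb]
  rfl

/-- This expresses the length of n in binary by the logarithm, which is available in unary. -/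
theorem clog_succ_eq_size (n : ℕ) : Nat.clog 2 (n + 1) = n.size := by
  refine le_antisymm (Nat.clog_le_of_le_pow (Nat.lt_size_self n)) (Nat.size_le.mpr ?_)
  exact Nat.le_pow_clog (by omega) (n + 1)

/-- The oracles of a direct-access machine can be computed by a random-access machine. -/
theorem cob_daOracles (hσ : (∃ i, 0 < σ.relArity i) ∨ (∃ i, 0 < σ.funArity i)) (o : DAOracle σ) :
    Cob OrderedStructure.width (raOracles σ) ((daOracles σ).val o) := by
  have hn := numCard_raOracles hσ
  rcases o with i | i | i | _
  · exact cob_rel hn i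
  · exact cob_fun hn i
  · exact cob_const hn i
  · have := hn.bits (hn.add .one).clog
    simp only [List.length_replicate, clog_succ_eq_size] at this
    exact this

end RandomAccess

end PolylogTM

namespace PolylogTM

/-! ## Random-access machines as guests -/

section RandomAccess

variable {σ : Vocabulary} (M : RandomAccessTM)

attribute [instance] RandomAccessTM.finite_Q

variable (σ) in
/-- A random-access machine as a machine that observes a structure. -/
noncomputable def raGuest : Guest (OrderedStructure σ) where
  Q := M.Q
  Wr := Fin (M.k + 1)
  Ro := Empty
  Obs := Option Bool
  start := M.start
  accept := M.accept
  δ q r o := (M.δ q (o.map Sym.ofBool) r).map fun a => (a.1, a.2, fun l => l.elim)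
  obs A _ nums _ := A.bin[nums 0]?
  input l := if l = 0 then [false] else []

/-- The configuration of a random-access machine. -/
def raGuestConfig (c : (raGuest σ M).Config) : M.Config := ⟨c.state, c.wr⟩

theorem raGuestConfig_initial : raGuestConfig M (raGuest σ M).initial = M.initial := by
  simp only [raGuestConfig, Guest.initial, RandomAccessTM.initial, raGuest]
  congr 1
  funext l
  split <;> rfl

theorem raGuestConfig_step (A : OrderedStructure σ) (c : (raGuest σ M).Config) :
    M.step A.bin (raGuestConfig M c) = ((raGuest σ M).step A c).map (raGuestConfig M) := by
  simp only [RandomAccessTM.step, Guest.step, raGuestConfig, raGuest, Option.map_map]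
  cases M.δ c.state ((A.bin[(c.wr (0 : Fin (M.k + 1))).number]?).map Sym.ofBool)
    fun l => (c.wr l).read <;> rfl

theorem raGuest_observable : (raGuest σ M).Observable OrderedStructure.width (raOracles σ) :=
  fun _ X _ hX _ => NumCob.query (Cob.numCob (X := X (0 : Fin (M.k + 1))) (hX (0 : Fin (M.k + 1))))

end RandomAccess

/-! ## Direct-access machines as guests -/

section DirectAccess

variable {σ : Vocabulary}

instance : Finite (ReadOnlyTape σ) :=
  Finite.of_surjective (fun x : Fin σ.s ⊕ Fin σ.q ⊕ Unit =>
    x.elim ReadOnlyTape.value (Sum.elim ReadOnlyTape.const fun _ => ReadOnlyTape.size)) fun l => by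
    cases l with
    | value i => exact ⟨.inl i, rfl⟩
    | const i => exact ⟨.inr (.inl i), rfl⟩
    | size => exact ⟨.inr (.inr ()), rfl⟩

instance (k : ℕ) : Finite (WritableTape σ k) :=
  Finite.of_surjective (fun x : (Σ i, Fin (σ.relArity i)) ⊕ (Σ i, Fin (σ.funArity i)) ⊕ Fin k =>
    x.elim (fun j => WritableTape.relAddr j.1 j.2)
      (Sum.elim (fun j => WritableTape.funAddr j.1 j.2) WritableTape.work)) fun l => by
    cases l with
    | relAddr i j => exact ⟨.inl ⟨i, j⟩, rfl⟩
    | funAddr i j => exact ⟨.inr (.inl ⟨i, j⟩), rfl⟩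
    | work i => exact ⟨.inr (.inr i), rfl⟩

attribute [instance] DirectAccessTM.finite_Q

/-- The string on a read-only tape in terms of the numbers on the writable tapes. -/
def roContent {k : ℕ} (A : OrderedStructure σ) (started : Bool) (nums : WritableTape σ k → ℕ) :
    ReadOnlyTape σ → List Bool
  | .value i => if started then A.funQuery i fun j => nums (.funAddr i j) else []
  | .const i => A.binConst i
  | .size => toBin A.n.size A.n

variable (M : DirectAccessTM σ)

/-- A direct-access machine as a machine that observes a structure. -/
noncomputable def daGuest : Guest (OrderedStructure σ) where
  Q := M.Q
  Wr := WritableTape σ M.k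
  Ro := ReadOnlyTape σ
  Obs := (ReadOnlyTape σ → Sym) × (Fin σ.p → Bool)
  start := M.start
  accept := M.accept
  δ q r o := M.δ q r o.1 o.2
  obs A started nums pos := (fun l => Tape.contents (roContent A started nums l) (pos l),
    fun i => A.relQuery i fun j => nums (.relAddr i j))
  input _ := []

/-- The configuration of a direct-access machine. -/
noncomputable def daGuestConfig (A : OrderedStructure σ) (c : (daGuest M).Config) : M.Config :=
  ⟨c.state, c.wr, fun l =>
    ⟨Tape.contents (roContent A c.started (fun l => (c.wr l).number) l), c.pos l⟩⟩

theorem daGuestConfig_initial (A : OrderedStructure σ) :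
    daGuestConfig M A (daGuest M).initial = M.initial A := by
  simp only [daGuestConfig, Guest.initial, DirectAccessTM.initial]
  congr 1
  funext l
  cases l <;> rfl

/-- The contents of the read-only tapes need not be stored: after a step they are functions of the
current addresses. Only the initially blank value-tapes require the mark `started`. -/
theorem daGuestConfig_next (A : OrderedStructure σ) (c : (daGuest M).Config)
    (r : M.Q × (WritableTape σ M.k → Sym × Dir) × (ReadOnlyTape σ → Dir)) :
    M.next A (daGuestConfig M A c) r = daGuestConfig M A ((daGuest M).next c r) := by
  simp only [daGuestConfig, Guest.next, DirectAccessTM.next]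
  congr 1
  funext l
  congr 1
  · cases l <;> rfl
  · generalize r.2.2 l = d
    cases d <;> rfl

theorem daGuestConfig_step (A : OrderedStructure σ) (c : (daGuest M).Config) :
    M.step A (daGuestConfig M A c) = ((daGuest M).step A c).map (daGuestConfig M A) := by
  rw [DirectAccessTM.step, Guest.step, Option.map_map]
  exact Option.map_congr fun r _ => daGuestConfig_next M A c r

theorem daGuest_observable : (daGuest M).Observable OrderedStructure.width (daOracles σ) := by
  intro ι b X Y hX hY
  refine FinCob.pair (FinCob.pi fun l => ?_) (FinCob.pi fun i => ?_)
  · have h : Cob OrderedStructure.width (daOracles σ)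
        fun A s => roContent A b (fun l => num (X l A s)) l := by
      cases l with
      | value i =>
        cases b
        · exact .nil
        · have := (Cob.oracle_comp (size := OrderedStructure.width) (O := daOracles σ)
            (.ro (.value i)) (G := fun j => X (.funAddr i j)) fun j => hX _).reverse
          convert this using 3 with A s
          exact (List.reverse_reverse _).symm
      | const i =>
        have := (Cob.oracle_comp (ι := ι) (size := OrderedStructure.width) (O := daOracles σ)
          (.ro (.const i)) (G := fun j => nomatch j) fun j => nomatch j).reverse
        convert this using 3 with A s
        exact (List.reverse_reverse _).symm
      | size =>
        have := (Cob.oracle_comp (ι := ι) (size := OrderedStructure.width) (O := daOracles σ)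
          (.ro .size) (G := fun j => nomatch j) fun j => nomatch j).reverse
        convert this using 3 with A s
        exact (List.reverse_reverse _).symm
    -- With the head position in unary, the scanned symbol is found by dropping as many bits; past
    -- the end it is blank.
    convert (FinCob.head? ((hY l).drop_length h)).map fun o => o.elim Sym.blank Sym.ofBool using 3
    rw [List.head?_drop]
    rfl
  · have := Cob.oracle_comp (size := OrderedStructure.width) (O := daOracles σ)
      (.rel i) (G := fun j => X (.relAddr i j)) fun j => hX _
    exact FinCob.headD this false

end DirectAccess

/-! ## Polylogarithmic time -/

namespace Cob

variable {E : Type} {size : E → ℕ} {O : Oracles E} {ι : Type}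

theorem exists_length_mul {X Y : Fn E ι} (hX : Cob size O X) (hY : Cob size O Y) :
    ∃ F, Cob size O F ∧ ∀ e s, (F e s).length = (X e s).length * (Y e s).length := by
  have key := fold₁ (size := size) (O := O) (ι := Fin 2) (X := fun _ s => s 0)
    (I := fun _ _ => []) (fun _ _ s a => s 1 ++ a) (var _) nil (fun _ => (var _).append (var _))
    ⟨1, fun N e s _ h b a => by
      have := h 1
      rw [List.length_append, pow_one]
      omega⟩
  refine ⟨_, key.comp (G := ![X, Y]) fun j => by
    fin_cases j
    · exact hX
    · exact hY, fun e s => ?_⟩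
  change ((X e s).foldl (fun a _ => Y e s ++ a) []).length = _
  have : ∀ (x a : List Bool), (x.foldl (fun a _ => Y e s ++ a) a).length =
      a.length + x.length * (Y e s).length := by
    intro x
    induction x with
    | nil => simp
    | cons b x ih =>
      intro a
      rw [List.foldl_cons, ih, List.length_append, List.length_cons]
      ring
  rw [this, List.length_nil, Nat.zero_add]

theorem exists_length_pow {X : Fn E ι} (hX : Cob size O X) (d : ℕ) :
    ∃ F, Cob size O F ∧ ∀ e s, (F e s).length = (X e s).length ^ d := by
  induction d with
  | zero => exact ⟨_, const [true], fun _ _ => rfl⟩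
  | succ d ih =>
    obtain ⟨F, hF, hF'⟩ := ih
    obtain ⟨F', h, h'⟩ := exists_length_mul hF hX
    exact ⟨F', h, fun e s => by rw [h', hF', pow_succ]⟩

end Cob

theorem FinishesWithin.mono {Γ : Type} {step : Γ → Option Γ} {c₀ : Γ} {acc : Set Γ} {T T' : ℕ}
    (h : FinishesWithin step c₀ acc T) (hT : T ≤ T') : FinishesWithin step c₀ acc T' := by
  obtain ⟨t, ht, h⟩ := h
  exact ⟨t, ht.trans hT, h⟩

/-- The asymptotic bound fails for finitely many arguments at most; the sum of the values there is
one more constant to absorb. -/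
theorem IsPolylog.exists_le {T : ℕ → ℕ} (hT : IsPolylog T) :
    ∃ d, ∀ m, T m ≤ (Nat.clog 2 m + 2) ^ d := by
  obtain ⟨k, hk⟩ := hT
  obtain ⟨c, hc⟩ := hk.bound
  obtain ⟨N, hN⟩ := Filter.eventually_atTop.mp hc
  obtain ⟨d, hd⟩ := (PolyBdd.const (∑ m ∈ Finset.range N, T m)).add
    ((PolyBdd.const ⌈c⌉₊).mul (PolyBdd.id.pow k))
  refine ⟨d, fun m => le_trans ?_ (hd _)⟩
  rcases Nat.lt_or_ge m N with h | h
  · exact (Finset.single_le_sum (fun _ _ => Nat.zero_le _) (Finset.mem_range.mpr h)).trans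
      (Nat.le_add_right _ _)
  · refine le_trans ?_ (Nat.le_add_left _ _)
    have := hN m h
    rw [Real.norm_of_nonneg (by positivity), Real.norm_of_nonneg (by positivity)] at this
    have h2 : (T m : ℝ) ≤ ⌈c⌉₊ * (Nat.clog 2 m : ℝ) ^ k :=
      this.trans (mul_le_mul_of_nonneg_right (Nat.le_ceil c) (by positivity))
    exact_mod_cast h2

theorem isPolylog_pow_add (d c : ℕ) : IsPolylog fun m => (Nat.clog 2 m + 2) ^ d + c := by
  refine ⟨d, Asymptotics.IsBigO.of_bound (3 ^ d + c) ?_⟩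
  filter_upwards [Filter.eventually_ge_atTop 2] with m hm
  rw [Real.norm_of_nonneg (by positivity), Real.norm_of_nonneg (by positivity)]
  -- From m = 2 on the logarithm is at least 1, so ⌈log m⌉ + 2 ≤ 3 ⌈log m⌉, which explains the
  -- constant 3 ^ d + c.
  have h1 : 1 ≤ Nat.clog 2 m := Nat.clog_pos (by omega) hm
  have h2 : (Nat.clog 2 m + 2) ^ d + c ≤ (3 ^ d + c) * Nat.clog 2 m ^ d := by
    rw [Nat.add_mul, ← Nat.mul_pow]
    exact Nat.add_le_add (Nat.pow_le_pow_left (by omega) d)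
      (Nat.le_mul_of_pos_right _ (Nat.pow_pos h1))
  exact_mod_cast h2

/-- A class that is decided by a machine in time polynomial in the length of a string that can be
computed is decided by a function in the algebra. -/
theorem Guest.exists_cob_of_pow {E : Type} {size : E → ℕ} {O : Oracles E} (G : Guest E)
    (hobs : G.Observable size O) {f : E → ℕ}
    (hf : Cob size O fun e (_ : Empty → List Bool) => List.replicate (f e) true) {d : ℕ}
    (hfin : ∀ e, FinishesWithin (G.step e) G.initial G.accepting ((f e + 2) ^ d)) :
    ∃ F : Fn E Empty, Cob size O F ∧ ∀ e,
      (ReachesAccepting (G.step e) G.initial G.accepting ↔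
        (F e fun i => i.elim).head? = some true) := by
  -- The two additional bits give a string of length f e + 2, whose power is the clock.
  obtain ⟨X, hX, hX'⟩ := ((hf.cons true).cons true).exists_length_pow d
  refine G.exists_cob hobs hX fun e => (hfin e).mono ?_
  rw [hX']
  simp

/-! ### The two implications -/

section Equivalence

variable {σ : Vocabulary} {C : Set (OrderedStructure σ)}

/-- The simulated time is polynomial in log n̂, for which random-access machines have a clock
oracle. Exchanging oracles yields a direct-access machine that is polynomial in log n. -/
theorem exists_directAccessTM {M : RandomAccessTM} {T : ℕ → ℕ} (hT : IsPolylog T)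
    (hM : M.DecidesInTime C T) :
    ∃ (M : DirectAccessTM σ) (T : ℕ → ℕ), IsPolylog T ∧ M.DecidesInTime C T := by
  obtain ⟨d, hd⟩ := hT.exists_le
  obtain ⟨F, hF, hF'⟩ := (raGuest σ M).exists_cob_of_pow (raGuest_observable M) cob_clock (d := d)
    fun A => ((finishesWithin_map (raGuestConfig M) (raGuestConfig_initial M) (raGuestConfig_step M A) _).mp
      (hM A).2).mono (hd _)
  obtain ⟨M', d', hM'⟩ := exists_daMachine (C := C) (hF.lift cob_raOracles) fun A => by
    rw [← hF' A, (hM A).1]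
    exact reachesAccepting_map (raGuestConfig M) (raGuestConfig_initial M) (raGuestConfig_step M A)
  exact ⟨M', _, isPolylog_pow_add d' 5, hM'⟩

/-- A symbol of positive arity is needed twice: to recover n from the encoding, and to bound log n
by log n̂. -/
theorem exists_randomAccessTM (hσ : (∃ i, 0 < σ.relArity i) ∨ (∃ i, 0 < σ.funArity i))
    {M : DirectAccessTM σ} {T : ℕ → ℕ} (hT : IsPolylog T) (hM : M.DecidesInTime C T) :
    ∃ (M : RandomAccessTM) (T : ℕ → ℕ), IsPolylog T ∧ M.DecidesInTime C T := by
  obtain ⟨d, hd⟩ := hT.exists_le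
  obtain ⟨F, hF, hF'⟩ := (daGuest M).exists_cob_of_pow (daGuest_observable M)
    numCard_daOracles.clog (d := d)
    fun A => ((finishesWithin_map (daGuestConfig M A) (daGuestConfig_initial M A) (daGuestConfig_step M A) _).mp
      (hM A).2).mono (hd _)
  obtain ⟨M', d', hM'⟩ := exists_raMachine (C := C) (hF.lift (cob_daOracles hσ)) fun A => by
    rw [← hF' A, (hM A).1]
    exact reachesAccepting_map (daGuestConfig M A) (daGuestConfig_initial M A) (daGuestConfig_step M A)
  -- The compiled machine is timed in terms of log n, whereas the bound sought is in terms of log n̂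
  -- ≥ log n.
  refine ⟨M', _, isPolylog_pow_add d' 5, fun A => ⟨(hM' A).1, (hM' A).2.mono ?_⟩⟩
  rw [A.length_bin]
  exact Nat.add_le_add_right (Nat.pow_le_pow_left
    (Nat.add_le_add_right (clog_le_clog_encLen hσ A.n) 2) d') 5

end Equivalence

end PolylogTM

theorem theorem1 (σ : PolylogTM.Vocabulary)
    (hσ : (∃ i, 0 < σ.relArity i) ∨ (∃ i, 0 < σ.funArity i))
    (C : Set (PolylogTM.OrderedStructure σ)) :
    (∃ (M : PolylogTM.RandomAccessTM) (T : ℕ → ℕ),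
        PolylogTM.IsPolylog T ∧ M.DecidesInTime C T) ↔
      (∃ (M : PolylogTM.DirectAccessTM σ) (T : ℕ → ℕ),
        PolylogTM.IsPolylog T ∧ M.DecidesInTime C T) :=
  ⟨fun ⟨_, _, hT, hM⟩ => PolylogTM.exists_directAccessTM hT hM,
    fun ⟨_, _, hT, hM⟩ => PolylogTM.exists_randomAccessTM hσ hT hM⟩
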